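/- Let $H=(V_H,E_H)$ be a finite simple graph, let $d$ be a positive integer, and let $\mathbb{F}$ be a field (any field; in particular a finite field, $\mathbb{R}$, or any other computationally efficient field). Suppose that $H$ has a faithful $d$-dimensional independent representation over $\mathbb{F}$, that is, an assignment of a vector $x_v\in\mathbb{F}^d$ to each vertex $v\in V_H$ such that $x_v\notin\mathrm{span}(\{x_w : w\in N_H(v)\})$ for every $v\in V_H$, and such that for all $u,v\in V_H$ it holds that $\{u,v\}\in E_H$ if and only if $x_u\in\mathrm{span}(\{x_w : w\in N_H(v)\})$. Then the $H$-Coloring problem parameterized by the vertex cover number $k$ (given a finite simple graph $G$ and a vertex cover $X$ of $G$ with $|X|=k$, decide whether there is a homomorphism from $G$ to $H$) admits a kernel with $O(k^{d-1})$ vertices and bit-size $O(k^{d-1}\cdot\log k)$. Explicitly: instances $(G,X)$ are written as bit strings that list the vertices, the elements of $X$ and the edges of $G$, with vertices named in binary. There are a map $f:\{0,1\}^*\times\mathbb{N}\to\{0,1\}^*\times\mathbb{N}$ that a Turing machine computes in time polynomial in $|x|+k$, a computable function $h:\mathbb{N}\to\mathbb{N}$ with $h(k)=O(k^{d-1}\log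 k)$, and a function $g:\mathbb{N}\to\mathbb{N}$ with $g(k)=O(k^{d-1})$, such that for every $(x,k)$ the pair $(x',k')=f(x,k)$ satisfies: $(x,k)$ is a yes-instance if and only if $(x',k')$ is a yes-instance; $|x'|+k'\le h(k)$; and $(x',k')$ is a well-formed instance $(G',X')$ with $|X'|=k'$ in which $G'$ has at most $g(k)$ vertices. Here $H$, $d$ and $\mathbb{F}$ are fixed, so the constants hidden in the $O(\cdot)$ and the polynomial in the running time may depend on them. -/

import Mathlib

open Filter Asymptotics

/-! ### Independent representations of graphs -/

section Representations

variable {V : Type*} {F : Type*} [Field F] {d : ℕ}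

/-- An independent representation of `G` in `F ^ d`: the vector of a vertex never lies in the span of
the vectors of its neighbours. -/
def IsIndependentRep (G : SimpleGraph V) (x : V → Fin d → F) : Prop :=
  ∀ v : V, x v ∉ Submodule.span F (x '' G.neighborSet v)

/-- A faithful independent representation of `G` in `F ^ d`: moreover, `u` and `v` are adjacent if
and only if the vector of `u` lies in the span of the vectors of the neighbours of `v`. -/
def IsFaithfulIndependentRep (G : SimpleGraph V) (x : V → Fin d → F) : Prop :=
  IsIndependentRep G x ∧
    ∀ u v : V, G.Adj u v ↔ x u ∈ Submodule.span F (x '' G.neighborSet v)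

end Representations

/-! ### Parameterized problems and kernels over the binary alphabet -/

/-- A parameterized problem over the alphabet `{0, 1}`. -/
abbrev ParamProblem : Type := Set (List Bool × ℕ)

/-- The input / output format of machines that handle pairs `(x, k)`: the bits of `x` followed by `k`
in unary. Its length is exactly `|x| + k`. -/
def encodePair (p : List Bool × ℕ) : List (Option Bool) :=
  p.1.map some ++ List.replicate p.2 none

/-- A map on pairs `(x, k)` that a (multi-stack) Turing machine computes in time polynomial in
`|x| + k`. -/
def IsPolyTime (f : List Bool × ℕ → List Bool × ℕ) : Prop :=
  Nonempty (Turing.TM2ComputableInPolyTime encodePair encodePair f)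

/-- `f` is a kernel of bit-size `h` for the parameterized problem `Q`. -/
structure IsKernel (Q : ParamProblem) (f : List Bool × ℕ → List Bool × ℕ) (h : ℕ → ℕ) : Prop where
  polyTime : IsPolyTime f
  mem_iff : ∀ p : List Bool × ℕ, p ∈ Q ↔ f p ∈ Q
  computable_size : Computable h
  size_le : ∀ (x : List Bool) (k : ℕ), (f (x, k)).1.length + (f (x, k)).2 ≤ h k

/-! ### `H`-colouring parameterized by the vertex cover number -/

/-- A finite simple graph on the vertex set `{0, …, n - 1}` together with a vertex cover of it. -/
structure GraphWithCover where
  n : ℕ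
  graph : SimpleGraph (Fin n)
  cover : Finset (Fin n)
  isVertexCover : graph.IsVertexCover (cover : Set (Fin n))

/-- Self-delimiting binary code of a natural number: every binary digit (least significant first) is
preceded by `1`, and the code ends with `0`. -/
def natCode (a : ℕ) : List Bool :=
  (a.bits.flatMap fun b => [true, b]) ++ [false]

/-- Self-delimiting code of a list: every item is preceded by `1`, and the code ends with `0`. -/
def listCode {α : Type*} (code : α → List Bool) (l : List α) : List Bool :=
  (l.flatMap fun a => true :: code a) ++ [false]

/-- The bit string `x` describes the graph with vertex cover `I`: it consists of the number of
vertices in unary, a list of the vertices of the cover (in any order, without repetition), and a list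
of the edges (in any order), all vertices being written in binary. -/
def Encodes (x : List Bool) (I : GraphWithCover) : Prop :=
  ∃ (c : List (Fin I.n)) (es : List (Fin I.n × Fin I.n)),
    c.Nodup ∧ (∀ v, v ∈ I.cover ↔ v ∈ c) ∧
    (∀ u v, I.graph.Adj u v ↔ (u, v) ∈ es ∨ (v, u) ∈ es) ∧
    x = List.replicate I.n true ++ [false] ++
      listCode (fun v : Fin I.n => natCode v) c ++
      listCode (fun e : Fin I.n × Fin I.n => natCode e.1 ++ natCode e.2) es

/-- The pair `(x, k)` is a well-formed instance, which stands for the graph with vertex cover `I`: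
the parameter is the size of the given vertex cover. -/
def IsInstance (p : List Bool × ℕ) (I : GraphWithCover) : Prop :=
  Encodes p.1 I ∧ I.cover.card = p.2

/-- The `H`-colouring problem parameterized by the vertex cover number: the well-formed instances
whose graph has a homomorphism to `H`. -/
def HColoringVC {V : Type*} (H : SimpleGraph V) : ParamProblem :=
  {p | ∃ I : GraphWithCover, IsInstance p I ∧ Nonempty (I.graph →g H)}

/-! The vertices outside the cover are independent, so a colouring of the cover extends to the whole
graph exactly when, for every outer vertex, the colours of its neighbourhood `N` have a common
neighbour in `H`. Only the edges inside the cover and the family of sets `N` matter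
(`colorable_iff_starColorable`).

Write `d = m + 1` and let `x` be a faithful independent representation. The colours of `N` have a
common neighbour if and only if every `m`-tuple from `N` does and the vectors of every `(m +
1)`-tuple from `N` have determinant zero. Indeed, vectors of neighbours of one vertex span a proper
subspace. Conversely, if the rank is at most `m`, then at most `m` members of `N` span everything,
and faithfulness makes a common neighbour of these adjacent to all colours (`tupleDet_eq_zero`,
`exists_common_neighbor`). The first kind of condition costs at most `k ^ m` small stars. The second
kind is highly redundant: if all vectors lie in an affine hyperplane `ℓ = 1`, the determinant of a
tuple is the alternating sum of numbers attached to its `m + 1` faces (`tupleDet_eq`). Each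
determinant condition is then linear in `k ^ m` unknowns, with integer coefficients that do not
depend on the colouring, and it suffices to keep the tuples whose boundary rows form a basis. Every
kept star is part of an original one, so no new condition arises (`starColorable_keptStars_iff`).

To eliminate over a fixed finite field, the representation is moved. In the algebraic closure, which
is infinite, some functional vanishes at none of the vectors, and rescaling puts them in a
hyperplane. The result is witnessed by finitely many equations in a finitely generated ring, and
these survive in the quotient by a maximal ideal, a field of positive characteristic
(`IsFaithfulIndependentRep.exists_prime`).

The at most `k ^ 2` edges inside the cover are harmless for `m ≥ 2`. For `d = 2` a graph `H` with an
edge is bipartite, hence the problem is the same as for a single edge; there the edge condition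
itself is linear for colours `1` and `-1`, and the same elimination leaves at most `k` edges. If `H`
has no edges, which includes `d = 1`, a constant number of outputs suffices.

For the running time, structured stack programs are compiled to multi-stack machines. The class `PT`
of functions on tree-coded types contains the kernel map because it is closed under composition,
pairing, case distinction and folds with polynomially bounded states. -/

/-! ### Structured programs on stacks -/

/-- The contents of countably many stacks over the alphabet `Option Bool`. -/
abbrev Store := ℕ → List (Option Bool)

/-- Structured programs that act on stacks. Tests inspect the top of a stack. -/
inductive Prog
  | skip
  | push (i : ℕ) (a : Option Bool)
  | pop (i : ℕ)
  | seq (P Q : Prog)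
  | ite (i : ℕ) (t : Option (Option Bool) → Bool) (P Q : Prog)
  | loop (i : ℕ) (t : Option (Option Bool) → Bool) (P : Prog)

namespace Prog

/-- `Runs P s s' n`: started on `s`, the program `P` ends after `n` steps with the store `s'`. -/
inductive Runs : Prog → Store → Store → ℕ → Prop
  | skip (s : Store) : Runs .skip s s 1
  | push (s : Store) (i : ℕ) (a : Option Bool) :
      Runs (.push i a) s (Function.update s i (a :: s i)) 1
  | pop (s : Store) (i : ℕ) : Runs (.pop i) s (Function.update s i (s i).tail) 1
  | seq {P Q : Prog} {s s' s'' : Store} {m n : ℕ} : Runs P s s' m → Runs Q s' s'' n →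
      Runs (.seq P Q) s s'' (1 + m + n)
  | ite_true {P Q : Prog} {s s' : Store} {n i : ℕ} {t : Option (Option Bool) → Bool} :
      t (s i).head? = true → Runs P s s' n → Runs (.ite i t P Q) s s' (1 + n)
  | ite_false {P Q : Prog} {s s' : Store} {n i : ℕ} {t : Option (Option Bool) → Bool} :
      t (s i).head? = false → Runs Q s s' n → Runs (.ite i t P Q) s s' (1 + n)
  | loop_false {P : Prog} {s : Store} {i : ℕ} {t : Option (Option Bool) → Bool} :
      t (s i).head? = false → Runs (.loop i t P) s s 1
  | loop_true {P : Prog} {s s' s'' : Store} {m n i : ℕ} {t : Option (Option Bool) → Bool} :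
      t (s i).head? = true → Runs P s s' m → Runs (.loop i t P) s' s'' n →
      Runs (.loop i t P) s s'' (1 + m + n)

/-- A strict bound on the stacks that a program mentions. -/
def width : Prog → ℕ
  | skip => 0
  | push i _ => i + 1
  | pop i => i + 1
  | seq P Q => max P.width Q.width
  | ite i _ P Q => max (i + 1) (max P.width Q.width)
  | loop i _ P => max (i + 1) P.width

/-- One step of the execution of a list of programs. -/
def next : List Prog × Store → Option (List Prog × Store)
  | ([], _) => none
  | (skip :: K, s) => some (K, s)
  | (push i a :: K, s) => some (K, Function.update s i (a :: s i))
  | (pop i :: K, s) => some (K, Function.update s i (s i).tail)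
  | (seq P Q :: K, s) => some (P :: Q :: K, s)
  | (ite i t P Q :: K, s) => some ((if t (s i).head? then P else Q) :: K, s)
  | (loop i t P :: K, s) => some (if t (s i).head? then P :: loop i t P :: K else K, s)

/-- Every constructor of `Runs` charges one unit for the single application of `next` that unfolds
it, so the count is exact. The arbitrary continuation `K` is what lets the induction pass through
sequences and loops. -/
theorem Runs.iterate_next {P : Prog} {s s' : Store} {n : ℕ} (h : Runs P s s' n) (K : List Prog) :
    (flip Bind.bind next)^[n] (some (P :: K, s)) = some (K, s') := by
  induction h generalizing K with
  | skip | push | pop => rfl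
  | @seq P Q s s' s'' m n _ _ ih₁ ih₂ =>
    rw [show 1 + m + n = n + (m + 1) by ring, Function.iterate_add_apply,
      Function.iterate_succ_apply]
    change (flip Bind.bind next)^[n] ((flip Bind.bind next)^[m] (some (P :: Q :: K, s))) = _
    rw [ih₁, ih₂]
  | @ite_true P Q s s' n i t ht _ ih =>
    rw [add_comm, Function.iterate_succ_apply]
    change (flip Bind.bind next)^[n] (some ((if t (s i).head? then P else Q) :: K, s)) = _
    rw [ht]; exact ih K
  | @ite_false P Q s s' n i t ht _ ih =>
    rw [add_comm, Function.iterate_succ_apply]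
    change (flip Bind.bind next)^[n] (some ((if t (s i).head? then P else Q) :: K, s)) = _
    rw [ht]; exact ih K
  | @loop_false P s i t ht =>
    change some (if t (s i).head? then P :: loop i t P :: K else K, s) = _
    simp [ht]
  | @loop_true P s s' s'' m n i t ht _ _ ih₁ ih₂ =>
    rw [show 1 + m + n = n + (m + 1) by ring, Function.iterate_add_apply,
      Function.iterate_succ_apply]
    change (flip Bind.bind next)^[n] ((flip Bind.bind next)^[m]
      (some (if t (s i).head? then P :: loop i t P :: K else K, s))) = _
    rw [if_pos ht, ih₁, ih₂]

/-! ### Compilation of programs to Turing machines. -/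

/-- The continuations that occur while `P` is executed in front of `K`. -/
def conts : Prog → List Prog → Set (List Prog)
  | seq P Q, K => insert (seq P Q :: K) (conts P (Q :: K) ∪ conts Q K)
  | ite i t P Q, K => insert (ite i t P Q :: K) (conts P K ∪ conts Q K)
  | loop i t P, K => insert (loop i t P :: K) (conts P (loop i t P :: K))
  | P, K => {P :: K}

/-- Continuations serve as machine labels, and a machine may have only finitely many. A loop returns
to its own continuation, so unrolling creates no new ones. -/
theorem finite_conts (P : Prog) (K : List Prog) : (P.conts K).Finite := by
  induction P generalizing K with
  | seq P Q ihP ihQ => exact ((ihP _).union (ihQ _)).insert _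
  | ite i t P Q ihP ihQ => exact ((ihP _).union (ihQ _)).insert _
  | loop i t P ih => exact (ih _).insert _
  | _ => exact Set.finite_singleton _

theorem cons_mem_conts (P : Prog) (K : List Prog) : P :: K ∈ P.conts K := by
  cases P <;> simp [conts]

theorem next_mem_conts (P : Prog) (K : List Prog) {L L' : List Prog} {s s' : Store}
    (hL : L ∈ P.conts K) (h : next (L, s) = some (L', s')) : L' ∈ insert K (P.conts K) := by
  induction P generalizing K with
  | seq P Q ihP ihQ =>
    rcases hL with rfl | hL | hL
    · simp only [next, Option.some.injEq, Prod.mk.injEq] at h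
      exact Or.inr (Or.inr (Or.inl (h.1 ▸ cons_mem_conts _ _)))
    · rcases ihP _ hL with rfl | h
      · exact Or.inr (Or.inr (Or.inr (cons_mem_conts _ _)))
      · exact Or.inr (Or.inr (Or.inl h))
    · rcases ihQ _ hL with rfl | h
      · exact Or.inl rfl
      · exact Or.inr (Or.inr (Or.inr h))
  | ite i t P Q ihP ihQ =>
    rcases hL with rfl | hL | hL
    · simp only [next, Option.some.injEq, Prod.mk.injEq] at h
      rw [← h.1]
      split_ifs
      · exact Or.inr (Or.inr (Or.inl (cons_mem_conts _ _)))
      · exact Or.inr (Or.inr (Or.inr (cons_mem_conts _ _)))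
    · rcases ihP _ hL with rfl | h
      · exact Or.inl rfl
      · exact Or.inr (Or.inr (Or.inl h))
    · rcases ihQ _ hL with rfl | h
      · exact Or.inl rfl
      · exact Or.inr (Or.inr (Or.inr h))
  | loop i t P ih =>
    rcases hL with rfl | hL
    · simp only [next, Option.some.injEq, Prod.mk.injEq] at h
      rw [← h.1]
      split_ifs
      · exact Or.inr (Or.inr (cons_mem_conts _ _))
      · exact Or.inl rfl
    · rcases ih _ hL with rfl | h
      · exact Or.inr (Or.inl rfl)
      · exact Or.inr (Or.inr h)
  | _ =>
    cases hL
    simp only [next, Option.some.injEq, Prod.mk.injEq] at h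
    exact Or.inl h.1.symm

/-- The labels of the machine that executes `P`. -/
abbrev Label (P : Prog) : Type := ↥(insert [] (P.conts []) : Set (List Prog))

open Classical in
/-- A list of programs as a label, if it is one. -/
noncomputable def toLabel (P : Prog) (L : List Prog) : P.Label :=
  if h : L ∈ insert [] (P.conts []) then ⟨L, h⟩ else ⟨[], Or.inl rfl⟩

theorem toLabel_val (P : Prog) {L : List Prog} (h : L ∈ insert [] (P.conts [])) :
    (P.toLabel L).1 = L := by
  rw [toLabel, dif_pos h]

/-- The code of the machine that executes `P`. -/
noncomputable def stmt (P : Prog) : List Prog →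
    Turing.TM2.Stmt (fun _ : Fin (P.width + 1) => Option Bool) P.Label (Option (Option Bool))
  -- A halted machine has to be back in its initial internal state, so the last symbol read is
  -- erased first.
  | [] => .load (fun _ => none) .halt
  | skip :: K => .goto fun _ => P.toLabel K
  | push i a :: K => .push (Fin.ofNat _ i) (fun _ => a) (.goto fun _ => P.toLabel K)
  | pop i :: K => .pop (Fin.ofNat _ i) (fun v _ => v) (.goto fun _ => P.toLabel K)
  | seq Q R :: K => .goto fun _ => P.toLabel (Q :: R :: K)
  | ite i t Q R :: K => .peek (Fin.ofNat _ i) (fun _ x => x)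
      (.goto fun v => P.toLabel ((if t v then Q else R) :: K))
  | loop i t Q :: K => .peek (Fin.ofNat _ i) (fun _ x => x)
      (.goto fun v => P.toLabel (if t v then Q :: loop i t Q :: K else K))

/-- The machine that executes `P`. -/
noncomputable def machine (P : Prog) : Turing.FinTM2 where
  K := Fin (P.width + 1)
  k₀ := 0
  k₁ := 0
  Γ _ := Option Bool
  Λ := P.Label
  main := P.toLabel [P]
  ΛFin := ((finite_conts P []).insert []).fintype
  σ := Option (Option Bool)
  initialState := none
  m L := P.stmt L.1

/-- The configuration of the machine that represents a list of programs and a store. -/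
noncomputable def conf (P : Prog) (c : List Prog × Store) (v : Option (Option Bool)) :
    P.machine.Cfg :=
  ⟨some (P.toLabel c.1), v, fun k => c.2 k.1⟩

theorem update_val {N i : ℕ} (hi : i < N + 1) (s : Store) (l : List (Option Bool)) :
    Function.update (fun k : Fin (N + 1) => s k.1) (Fin.ofNat _ i) l =
      fun k => Function.update s i l k.1 := by
  funext k
  have : k = Fin.ofNat (N + 1) i ↔ k.1 = i := by
    rw [Fin.ext_iff, Fin.val_ofNat, Nat.mod_eq_of_lt hi]
  by_cases h : k.1 = i
  · rw [this.2 h]; simp [Nat.mod_eq_of_lt hi]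
  · rw [Function.update_of_ne (fun e => h (this.1 e)), Function.update_of_ne h]

/-- Two invariants are carried along: the continuation is a genuine label, so `toLabel` does not
take its default value, and no stack index exceeds the width, so reduction modulo `P.width + 1`
changes nothing. -/
theorem step_conf (P : Prog) {L L' : List Prog} {s s' : Store} (v : Option (Option Bool))
    (hL : L ∈ insert [] (P.conts [])) (hw : ∀ Q ∈ L, Q.width ≤ P.width)
    (h : next (L, s) = some (L', s')) :
    L' ∈ insert [] (P.conts []) ∧ (∀ Q ∈ L', Q.width ≤ P.width) ∧
      ∃ v', P.machine.step (P.conf (L, s) v) = some (P.conf (L', s') v') := by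
  refine ⟨?_, ?_, ?_⟩
  · rcases hL with rfl | hL
    · simp [next] at h
    · exact next_mem_conts P [] hL h
  · cases L with
    | nil => simp [next] at h
    | cons Q K =>
      simp only [List.forall_mem_cons] at hw
      cases Q <;> simp only [next, Option.some.injEq, Prod.mk.injEq] at h <;> rw [← h.1] <;>
        simp only [width, max_le_iff] at hw
      · exact hw.2
      · exact hw.2
      · exact hw.2
      · simpa [List.forall_mem_cons, and_assoc] using hw
      · split_ifs <;> simp <;> tauto
      · split_ifs
        · simp only [List.forall_mem_cons, width, max_le_iff]; tauto
        · exact hw.2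
  · have key : ∃ v', Turing.TM2.stepAux (P.stmt L) v (fun k => s k.1) =
        (P.conf (L', s') v' : Turing.TM2.Cfg _ _ _) := by
      cases L with
      | nil => simp [next] at h
      | cons Q K =>
        have hQ := hw Q List.mem_cons_self
        cases Q <;> simp only [next, Option.some.injEq, Prod.mk.injEq] at h <;>
          obtain ⟨rfl, rfl⟩ := h <;> simp only [width, max_le_iff] at hQ <;>
          simp only [stmt, Turing.TM2.stepAux]
        · exact ⟨_, rfl⟩
        · rename_i i a
          refine ⟨v, ?_⟩
          rw [update_val (by omega)]
          simp [conf, Nat.mod_eq_of_lt (show i < P.width + 1 by omega)]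
          rfl
        · rename_i i
          refine ⟨v, ?_⟩
          rw [update_val (by omega)]
          simp [conf, Nat.mod_eq_of_lt (show i < P.width + 1 by omega)]
          rfl
        · exact ⟨_, rfl⟩
        · rename_i i _ _ _
          refine ⟨(s i).head?, ?_⟩
          simp [conf, Nat.mod_eq_of_lt (show i < P.width + 1 by omega)]
          rfl
        · rename_i i _ _
          refine ⟨(s i).head?, ?_⟩
          simp [conf, Nat.mod_eq_of_lt (show i < P.width + 1 by omega)]
          rfl
    obtain ⟨v', hv'⟩ := key
    refine ⟨v', ?_⟩
    change some (Turing.TM2.stepAux (P.stmt (P.toLabel L).1) v (fun k => s k.1)) = _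
    rw [toLabel_val P hL, hv']
    rfl

theorem iterate_conf (P : Prog) (n : ℕ) {L L' : List Prog} {s s' : Store}
    (v : Option (Option Bool)) (hL : L ∈ insert [] (P.conts [])) (hw : ∀ Q ∈ L, Q.width ≤ P.width)
    (h : (flip Bind.bind next)^[n] (some (L, s)) = some (L', s')) :
    ∃ v', (flip Bind.bind P.machine.step)^[n] (some (P.conf (L, s) v)) =
      some (P.conf (L', s') v') := by
  have hnone : ∀ n, (flip Bind.bind next)^[n] none = none := fun n => by
    induction n with
    | zero => rfl
    | succ n ih => rw [Function.iterate_succ_apply]; exact ih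
  induction n generalizing L s v with
  | zero =>
    simp only [Function.iterate_zero, id, Option.some.injEq, Prod.mk.injEq] at h
    obtain ⟨rfl, rfl⟩ := h
    exact ⟨v, rfl⟩
  | succ n ih =>
    rw [Function.iterate_succ_apply] at h
    change (flip Bind.bind next)^[n] (next (L, s)) = _ at h
    cases hn : next (L, s) with
    | none => rw [hn, hnone] at h; cases h
    | some c =>
      obtain ⟨L₁, s₁⟩ := c
      obtain ⟨h₁, h₂, v₁, h₃⟩ := step_conf P v hL hw hn
      rw [hn] at h
      obtain ⟨v', hv'⟩ := ih v₁ h₁ h₂ h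
      refine ⟨v', ?_⟩
      rw [Function.iterate_succ_apply]
      have e : flip Bind.bind P.machine.step (some (P.conf (L, s) v)) =
          P.machine.step (P.conf (L, s) v) := rfl
      rw [e, h₃, hv']

/-- The store with one stack in use. -/
def single (l : List (Option Bool)) : Store := Function.update (fun _ => []) 0 l

/-- A program that computes `f` on the first stack in polynomial time gives a polynomial time
machine. -/
theorem isPolyTime {f : List Bool × ℕ → List Bool × ℕ} (P : Prog) (q : Polynomial ℕ)
    (h : ∀ p, ∃ n ≤ q.eval (encodePair p).length,
      Runs P (single (encodePair p)) (single (encodePair (f p))) n) : IsPolyTime f := by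
  choose n hn hP using h
  have hrun : ∀ p, (flip Bind.bind P.machine.step)^[n p + 1]
      (some (Turing.initList P.machine (encodePair p))) =
        some (Turing.haltList P.machine (encodePair (f p))) := fun p => by
    obtain ⟨v', hv'⟩ := iterate_conf P (n p) none (Or.inr (cons_mem_conts P []))
      (by simp) ((hP p).iterate_next [])
    have hinit : Turing.initList P.machine (encodePair p) =
        P.conf ([P], single (encodePair p)) none := by
      unfold Turing.initList conf
      congr 1
      funext k
      by_cases hk : k = (0 : Fin (P.width + 1))
      · subst hk; simp [machine, single]; rfl
      · have : k.1 ≠ 0 := fun e => hk (Fin.ext e)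
        rw [dif_neg (show ¬ k = P.machine.k₀ from hk)]
        simp [single, this]; rfl
    -- The additional step is the halting statement at the empty continuation.
    rw [hinit, add_comm, Function.iterate_add_apply, hv']
    change some (Turing.TM2.stepAux (P.stmt (P.toLabel []).1) v'
      (fun k : Fin (P.width + 1) => single (encodePair (f p)) k.1)) = _
    rw [toLabel_val P (Or.inl rfl)]
    simp only [stmt, Turing.TM2.stepAux]
    unfold Turing.haltList
    refine congrArg some (congrArg (Turing.TM2.Cfg.mk _ _) (funext fun k => ?_))
    by_cases hk : k = (0 : Fin (P.width + 1))
    · subst hk; simp [machine, single]; rfl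
    · have : k.1 ≠ 0 := fun e => hk (Fin.ext e)
      simp [machine, single, hk, this]
  exact ⟨{
    tm := P.machine
    inputAlphabet := Equiv.refl _
    outputAlphabet := Equiv.refl _
    time := q + 1
    outputsFun := fun p =>
      { steps := n p + 1
        evals_in_steps := by
          have e : ∀ l : List (Option Bool), List.map (Equiv.refl (Option Bool)).invFun l = l :=
            fun l => List.map_id l
          have := hrun p
          erw [e, e]
          exact this
        steps_le_m := by
          rw [Polynomial.eval_add, Polynomial.eval_one]
          exact Nat.add_le_add_right (hn p) 1 } }⟩

end Prog

/-! ### Runs with time bounds and basic stack routines. -/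

namespace Prog

/-- `P` leads from `s` to `s'` in at most `n` steps. -/
def Does (P : Prog) (s s' : Store) (n : ℕ) : Prop := ∃ m ≤ n, Runs P s s' m

theorem Does.mono {P : Prog} {s s' : Store} {m n : ℕ} (h : Does P s s' m) (hmn : m ≤ n) :
    Does P s s' n := h.imp fun _ h => ⟨h.1.trans hmn, h.2⟩

theorem Does.seq {P Q : Prog} {s s' s'' : Store} {m n : ℕ} (hP : Does P s s' m)
    (hQ : Does Q s' s'' n) : Does (seq P Q) s s'' (1 + m + n) := by
  obtain ⟨m', hm, hP⟩ := hP
  obtain ⟨n', hn, hQ⟩ := hQ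
  exact ⟨_, by omega, hP.seq hQ⟩

theorem Does.ite_true {P Q : Prog} {s s' : Store} {n i : ℕ} {t : Option (Option Bool) → Bool}
    (ht : t (s i).head? = true) (h : Does P s s' n) : Does (ite i t P Q) s s' (1 + n) := by
  obtain ⟨m, hm, h⟩ := h
  exact ⟨_, by omega, .ite_true ht h⟩

theorem Does.ite_false {P Q : Prog} {s s' : Store} {n i : ℕ} {t : Option (Option Bool) → Bool}
    (ht : t (s i).head? = false) (h : Does Q s s' n) : Does (ite i t P Q) s s' (1 + n) := by
  obtain ⟨m, hm, h⟩ := h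
  exact ⟨_, by omega, .ite_false ht h⟩

theorem Does.loop_false {P : Prog} {s : Store} {i : ℕ} {t : Option (Option Bool) → Bool}
    (ht : t (s i).head? = false) : Does (loop i t P) s s 1 := ⟨_, le_rfl, .loop_false ht⟩

theorem Does.loop_true {P : Prog} {s s' s'' : Store} {m n i : ℕ}
    {t : Option (Option Bool) → Bool} (ht : t (s i).head? = true) (hP : Does P s s' m)
    (hQ : Does (loop i t P) s' s'' n) : Does (loop i t P) s s'' (1 + m + n) := by
  obtain ⟨m', hm, hP⟩ := hP
  obtain ⟨n', hn, hQ⟩ := hQ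
  exact ⟨_, by omega, .loop_true ht hP hQ⟩

/-- The store with the given stacks. -/
def stk (ls : List (List (Option Bool))) : Store := fun k => ls.getD k []

theorem update_stk {ls : List (List (Option Bool))} {i : ℕ} (hi : i < ls.length)
    (l : List (Option Bool)) : Function.update (stk ls) i l = stk (ls.set i l) := by
  funext k
  by_cases h : k = i
  · subst h; simp [stk, hi]
  · simp [stk, h, Ne.symm h]

/-- Absent stacks and empty stacks are the same, so a routine may open scratch stacks on demand and
forget them once they are empty again. -/
theorem stk_append_nil (ls : List (List (Option Bool))) (n : ℕ) :
    stk (ls ++ List.replicate n []) = stk ls := by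
  funext k
  simp only [stk, List.getD_eq_getElem?_getD, List.getElem?_append, List.getElem?_replicate]
  split_ifs with h₁ h₂
  · rfl
  all_goals simp [List.getElem?_eq_none (not_lt.1 h₁)]

theorem does_skip (s : Store) : Does skip s s 1 := ⟨_, le_rfl, .skip s⟩

theorem does_push {ls : List (List (Option Bool))} (i : ℕ) (a : Option Bool) (hi : i < ls.length) :
    Does (push i a) (stk ls) (stk (ls.set i (a :: ls.getD i []))) 1 := by
  rw [← update_stk hi]
  exact ⟨_, le_rfl, .push _ i a⟩

theorem does_pop {ls : List (List (Option Bool))} (i : ℕ) (hi : i < ls.length) :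
    Does (pop i) (stk ls) (stk (ls.set i (ls.getD i []).tail)) 1 := by
  rw [← update_stk hi]
  exact ⟨_, le_rfl, .pop _ i⟩

/-- Test whether the top of a stack is a given symbol. -/
def isTop (a : Option Bool) (x : Option (Option Bool)) : Bool := x == some a

/-- Push the given word, the last symbol first. -/
def pushAll (i : ℕ) : List (Option Bool) → Prog
  | [] => skip
  | a :: l => seq (pushAll i l) (push i a)

theorem does_pushAll {ls : List (List (Option Bool))} (i : ℕ) (hi : i < ls.length)
    (l : List (Option Bool)) :
    Does (pushAll i l) (stk ls) (stk (ls.set i (l ++ ls.getD i []))) (2 * l.length + 1) := by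
  induction l with
  | nil =>
    have : ls.set i ([] ++ ls.getD i []) = ls := by simp [hi]
    rw [this]; exact does_skip _
  | cons a l ih =>
    have h := ih.seq (does_push i a (by simpa using hi))
    rw [List.set_set] at h
    simp only [List.getD_eq_getElem?_getD, List.getElem?_set_self hi, Option.getD_some] at h
    exact h.mono (by simp; omega)

/-- Empty a stack. -/
def clear (i : ℕ) : Prog := loop i Option.isSome (pop i)

theorem does_clear {ls : List (List (Option Bool))} (i : ℕ) (hi : i < ls.length) :
    Does (clear i) (stk ls) (stk (ls.set i [])) (2 * (ls.getD i []).length + 1) := by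
  generalize hl : ls.getD i [] = l
  induction l generalizing ls with
  | nil =>
    have : ls.set i [] = ls := by
      rw [← hl]; simp [hi]
    rw [this]
    exact Does.loop_false (by rw [show stk ls i = _ from hl]; rfl)
  | cons a l ih =>
    have h := ih (ls := ls.set i l) (by simpa using hi) (by simp [hi])
    rw [List.set_set] at h
    have h' := does_pop (ls := ls) i hi
    rw [hl] at h'
    exact (Does.loop_true (by rw [show stk ls i = _ from hl]; rfl) h' h).mono
      (by simp; omega)

/-- Move the top of a stack to another one. -/
def transfer (i j : ℕ) : Prog :=
  seq (ite i (isTop (some true)) (push j (some true))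
    (ite i (isTop (some false)) (push j (some false)) (push j none))) (pop i)

/-- A program has no memory besides its stacks, so the symbol is identified by branching before it
is pushed; `none` is the remaining case. -/
theorem does_transfer {ls : List (List (Option Bool))} (i j : ℕ) (hi : i < ls.length)
    (hj : j < ls.length) (hij : i ≠ j) {a : Option Bool} {l : List (Option Bool)}
    (hl : ls.getD i [] = a :: l) :
    Does (transfer i j) (stk ls) (stk ((ls.set j (a :: ls.getD j [])).set i l)) 5 := by
  have h1 : stk ls i = a :: l := hl
  have h2 : Does (pop i) (stk (ls.set j (a :: ls.getD j []))) _ 1 := does_pop i (by simpa using hi)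
  have h3 : (ls.set j (a :: ls.getD j [])).getD i [] = a :: l := by
    rw [List.getD_eq_getElem?_getD, List.getElem?_set_ne hij.symm, ← List.getD_eq_getElem?_getD, hl]
  rw [h3] at h2
  refine (Does.seq (m := 3) ?_ h2)
  rcases a with _ | _ | _
  · exact .ite_false (by rw [h1]; rfl) (.ite_false (by rw [h1]; rfl) (does_push j _ hj))
  · exact .ite_false (by rw [h1]; rfl) (.ite_true (by rw [h1]; rfl) (does_push j _ hj))
  · exact (Does.ite_true (by rw [h1]; rfl) (does_push j _ hj)).mono (by norm_num)

/-- Move a stack to another one, in reverse order. -/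
def move (i j : ℕ) : Prog := loop i Option.isSome (transfer i j)

theorem does_move {ls : List (List (Option Bool))} (i j : ℕ) (hi : i < ls.length)
    (hj : j < ls.length) (hij : i ≠ j) :
    Does (move i j) (stk ls) (stk ((ls.set i []).set j ((ls.getD i []).reverse ++ ls.getD j [])))
      (6 * (ls.getD i []).length + 1) := by
  generalize hl : ls.getD i [] = l
  induction l generalizing ls with
  | nil =>
    have : (ls.set i []).set j ([].reverse ++ ls.getD j []) = ls := by
      have h : ls[i]? = some [] := by
        rw [List.getElem?_eq_getElem hi]; simpa [hi] using hl
      refine List.ext_getElem? fun n => ?_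
      simp only [List.getElem?_set, List.length_set]
      split_ifs <;> simp_all
    rw [this]
    exact Does.loop_false (by rw [show stk ls i = _ from hl]; rfl)
  | cons a l ih =>
    have h := ih (ls := (ls.set j (a :: ls.getD j [])).set i l) (by simpa using hi)
      (by simpa using hj) (by simp [hi])
    have e : ((ls.set j (a :: ls.getD j [])).set i l).getD j [] = a :: ls.getD j [] := by
      rw [List.getD_eq_getElem?_getD, List.getElem?_set_ne hij, List.getElem?_set_self hj,
        Option.getD_some]
    have e₂ : (((ls.set j (a :: ls.getD j [])).set i l).set i []).set j
        (l.reverse ++ a :: ls.getD j []) =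
          (ls.set i []).set j ((a :: l).reverse ++ ls.getD j []) := by
      refine List.ext_getElem? fun n => ?_
      simp only [List.getElem?_set, List.length_set]
      split_ifs <;> simp_all
    rw [e, e₂] at h
    have h' := does_transfer i j hi hj hij hl
    exact (Does.loop_true (by rw [show stk ls i = _ from hl]; rfl) h' h).mono (by simp; omega)

/-- Move a stack to two others, in reverse order. -/
def moveTwo (i j k : ℕ) : Prog :=
  loop i Option.isSome (seq (ite i (isTop (some true)) (push k (some true))
    (ite i (isTop (some false)) (push k (some false)) (push k none))) (transfer i j))

theorem does_moveTwo {ls : List (List (Option Bool))} (i j k : ℕ) (hi : i < ls.length)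
    (hj : j < ls.length) (hk : k < ls.length) (hij : i ≠ j) (hik : i ≠ k) (hjk : j ≠ k) :
    Does (moveTwo i j k) (stk ls) (stk (((ls.set i []).set j
      ((ls.getD i []).reverse ++ ls.getD j [])).set k ((ls.getD i []).reverse ++ ls.getD k [])))
      (10 * (ls.getD i []).length + 1) := by
  generalize hl : ls.getD i [] = l
  induction l generalizing ls with
  | nil =>
    have : (((ls.set i []).set j ([].reverse ++ ls.getD j []))).set k
        ([].reverse ++ ls.getD k []) = ls := by
      have h : ls[i]? = some [] := by
        rw [List.getElem?_eq_getElem hi]; simpa [hi] using hl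
      refine List.ext_getElem? fun n => ?_
      simp only [List.getElem?_set, List.length_set]
      split_ifs <;> simp_all
    rw [this]
    exact Does.loop_false (by rw [show stk ls i = _ from hl]; rfl)
  | cons a l ih =>
    have h1 : stk ls i = a :: l := hl
    have hP : Does (ite i (isTop (some true)) (push k (some true))
        (ite i (isTop (some false)) (push k (some false)) (push k none))) (stk ls)
        (stk (ls.set k (a :: ls.getD k []))) 3 := by
      rcases a with _ | _ | _
      · exact .ite_false (by rw [h1]; rfl) (.ite_false (by rw [h1]; rfl) (does_push k _ hk))
      · exact .ite_false (by rw [h1]; rfl) (.ite_true (by rw [h1]; rfl) (does_push k _ hk))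
      · exact (Does.ite_true (by rw [h1]; rfl) (does_push k _ hk)).mono (by norm_num)
    have h2 := does_transfer (ls := ls.set k (a :: ls.getD k [])) i j (by simpa using hi)
      (by simpa using hj) hij (a := a) (l := l) (by
        rw [List.getD_eq_getElem?_getD, List.getElem?_set_ne hik.symm,
          ← List.getD_eq_getElem?_getD, hl])
    have e1 : (ls.set k (a :: ls.getD k [])).getD j [] = ls.getD j [] := by
      rw [List.getD_eq_getElem?_getD, List.getElem?_set_ne hjk.symm, ← List.getD_eq_getElem?_getD]
    rw [e1] at h2
    have h := ih (ls := ((ls.set k (a :: ls.getD k [])).set j (a :: ls.getD j [])).set i l)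
      (by simpa using hi) (by simpa using hj) (by simpa using hk) (by simp [hi])
    have e : (((ls.set k (a :: ls.getD k [])).set j (a :: ls.getD j [])).set i l).getD j [] =
        a :: ls.getD j [] := by
      rw [List.getD_eq_getElem?_getD, List.getElem?_set_ne hij,
        List.getElem?_set_self (by simpa using hj), Option.getD_some]
    have e' : (((ls.set k (a :: ls.getD k [])).set j (a :: ls.getD j [])).set i l).getD k [] =
        a :: ls.getD k [] := by
      rw [List.getD_eq_getElem?_getD, List.getElem?_set_ne hik, List.getElem?_set_ne hjk,
        List.getElem?_set_self hk, Option.getD_some]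
    have e₂ : (((((ls.set k (a :: ls.getD k [])).set j (a :: ls.getD j [])).set i l).set i []).set j
        (l.reverse ++ a :: ls.getD j [])).set k (l.reverse ++ a :: ls.getD k []) =
          ((ls.set i []).set j ((a :: l).reverse ++ ls.getD j [])).set k
            ((a :: l).reverse ++ ls.getD k []) := by
      refine List.ext_getElem? fun n => ?_
      simp only [List.getElem?_set, List.length_set]
      split_ifs <;> simp_all
    rw [e, e', e₂] at h
    exact (Does.loop_true (by rw [show stk ls i = _ from hl]; rfl) (hP.seq h2) h).mono (by simp; omega)

/-- The same program on the stacks above the lowest one. -/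
def lift : Prog → Prog
  | skip => skip
  | push i a => push (i + 1) a
  | pop i => pop (i + 1)
  | seq P Q => seq P.lift Q.lift
  | ite i t P Q => ite (i + 1) t P.lift Q.lift
  | loop i t P => loop (i + 1) t P.lift

/-- Insert a stack below the others. -/
def insertBelow (l : List (Option Bool)) (s : Store) : Store := fun k => k.casesOn l s

theorem insertBelow_update (l : List (Option Bool)) (s : Store) (i : ℕ) (x : List (Option Bool)) :
    insertBelow l (Function.update s i x) = Function.update (insertBelow l s) (i + 1) x := by
  funext k
  cases k with
  | zero => simp [insertBelow]
  | succ k => simp [insertBelow, Function.update_apply]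

/-- A lifted program never touches stack `0`. This allows a value to be parked there while an
arbitrary program works above it, which is how several results are kept at once. -/
theorem Runs.lift {P : Prog} {s s' : Store} {n : ℕ} (h : Runs P s s' n)
    (l : List (Option Bool)) : Runs P.lift (insertBelow l s) (insertBelow l s') n := by
  induction h with
  | skip => exact .skip _
  | push => rw [insertBelow_update]; exact .push _ _ _
  | pop => rw [insertBelow_update]; exact .pop _ _
  | seq _ _ ih₁ ih₂ => exact .seq ih₁ ih₂
  | ite_true ht _ ih => exact .ite_true ht ih
  | ite_false ht _ ih => exact .ite_false ht ih
  | loop_false ht => exact .loop_false ht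
  | loop_true ht _ _ ih₁ ih₂ => exact .loop_true ht ih₁ ih₂

theorem Does.lift {P : Prog} {ls ls' : List (List (Option Bool))} {n : ℕ}
    (h : Does P (stk ls) (stk ls') n) (l : List (Option Bool)) :
    Does P.lift (stk (l :: ls)) (stk (l :: ls')) n := by
  obtain ⟨m, hm, h⟩ := h
  have e : ∀ ls, stk (l :: ls) = insertBelow l (stk ls) := fun ls => by
    funext k; cases k <;> rfl
  rw [e, e]
  exact ⟨m, hm, h.lift l⟩

end Prog

/-! ### Polynomial time functions on binary trees -/

/-- Binary trees, the universal data type of the functions below. -/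
inductive Data
  | nil
  | cons (a b : Data)

namespace Data

/-- The prefix code of a tree. -/
def code : Data → List (Option Bool)
  | nil => [some false]
  | cons a b => some true :: (a.code ++ b.code)

/-- The length of the code of a tree. -/
def size (t : Data) : ℕ := t.code.length

theorem size_nil : size nil = 1 := rfl

theorem size_cons (a b : Data) : size (cons a b) = a.size + b.size + 1 := by
  simp [size, code]

theorem size_pos (t : Data) : 0 < t.size := by cases t <;> simp [size, code]

/-- The code is self-delimiting: its first symbol decides between leaf and node, and each subtree
ends where its own code says. -/
theorem code_append_inj {t t' : Data} {r r' : List (Option Bool)}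
    (h : t.code ++ r = t'.code ++ r') : t = t' ∧ r = r' := by
  induction t generalizing t' r r' with
  | nil =>
    cases t' with
    | nil => simpa [code] using h
    | cons => simp [code] at h
  | cons a b iha ihb =>
    cases t' with
    | nil => simp [code] at h
    | cons a' b' =>
      simp only [code, List.cons_append, List.append_assoc, List.cons.injEq, true_and] at h
      obtain ⟨rfl, h'⟩ := iha h
      obtain ⟨rfl, h''⟩ := ihb h'
      exact ⟨rfl, h''⟩

theorem code_injective : Function.Injective code := fun t t' h =>
  (code_append_inj (r := []) (r' := []) (by simpa using h)).1

theorem ne_none_of_mem_code (t : Data) : ∀ a ∈ t.code, a ≠ none := by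
  induction t with
  | nil => simp [code]
  | cons a b iha ihb =>
    simp only [code, List.mem_cons, List.mem_append]
    rintro _ (rfl | h | h)
    · simp
    · exact iha _ h
    · exact ihb _ h

/-- The left subtree. -/
def hd : Data → Data
  | nil => nil
  | cons a _ => a

/-- The right subtree. -/
def tl : Data → Data
  | nil => nil
  | cons _ b => b

end Data

theorem Polynomial.eval_mono_nat (q : Polynomial ℕ) {m n : ℕ} (h : m ≤ n) :
    q.eval m ≤ q.eval n := by
  simp only [Polynomial.eval_eq_sum_range]
  gcongr

/-! ### Stack routines for codes of trees. -/

namespace Prog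

theorem head?_stk (ls : List (List (Option Bool))) (i : ℕ) :
    (stk ls i).head? = (ls.getD i []).head? := rfl

/-- Move a tree from stack `0` to stack `2`, in reverse order, with stack `3` as a counter. -/
def takeTree : Prog :=
  seq (push 3 (some true)) (loop 3 Option.isSome
    (seq (ite 0 (isTop (some true)) (push 3 (some true)) (pop 3)) (transfer 0 2)))

/-- The height of stack `3` is the number of subtrees still to be read: a node symbol raises it by
one, a leaf lowers it by one. The rest of the run enters as the hypothesis `h`, since both subtrees
of a node are read by the same loop. -/
theorem does_takeTree_loop (t : Data) (r x u c : List (Option Bool)) {s : Store} {n : ℕ}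
    (h : Does (loop 3 Option.isSome
      (seq (ite 0 (isTop (some true)) (push 3 (some true)) (pop 3)) (transfer 0 2)))
      (stk [r, x, t.code.reverse ++ u, c]) s n) :
    Does (loop 3 Option.isSome
      (seq (ite 0 (isTop (some true)) (push 3 (some true)) (pop 3)) (transfer 0 2)))
      (stk [t.code ++ r, x, u, some true :: c]) s (n + 10 * t.size) := by
  induction t generalizing r u c n with
  | nil =>
    refine (Does.loop_true (m := 8) rfl ?_ h).mono (by rw [Data.size_nil]; omega)
    refine Does.seq (m := 2) (n := 5) (Does.ite_false (i := 0) rfl (does_pop 3 (by simp))) ?_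
    exact does_transfer 0 2 (by simp) (by simp) (by simp) rfl
  | cons a b iha ihb =>
    refine (Does.loop_true (m := 8) (n := n + 10 * b.size + 10 * a.size) rfl
      (Does.seq (m := 2) (n := 5) (Does.ite_true (i := 0) rfl (does_push 3 _ (by simp)))
      (does_transfer 0 2 (by simp) (by simp) (by simp) (l := a.code ++ b.code ++ r) rfl)) ?_).mono
      (by rw [Data.size_cons]; omega)
    have := iha (b.code ++ r) (some true :: u) (some true :: c) (n := n + 10 * b.size)
      (ihb r _ c (by simpa [Data.code] using h))
    simpa using this

theorem does_takeTree (t : Data) (r x u : List (Option Bool)) :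
    Does takeTree (stk [t.code ++ r, x, u, []]) (stk [r, x, t.code.reverse ++ u, []])
      (10 * t.size + 3) :=
  ((does_push 3 _ (by simp)).seq
    (does_takeTree_loop t r x u [] (n := 1) (Does.loop_false rfl))).mono (by omega)

/-- Copy stack `0` to stack `1`. -/
def copy : Prog := seq (move 0 2) (moveTwo 2 0 1)

theorem does_copy (l : List (Option Bool)) :
    Does copy (stk [l]) (stk [l, l]) (16 * l.length + 3) := by
  have e1 : stk [l] = stk [l, [], []] := (stk_append_nil [l] 2).symm
  have e2 : stk [l, l] = stk [l, l, []] := (stk_append_nil [l, l] 1).symm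
  rw [e1, e2]
  have h1 := does_move (ls := [l, [], []]) 0 2 (by simp) (by simp) (by simp)
  have h2 := does_moveTwo (ls := [[], [], l.reverse]) 2 0 1 (by simp) (by simp) (by simp)
    (by simp) (by simp) (by simp)
  simp only [List.set, List.getD_cons_succ, List.getD_cons_zero, List.reverse_reverse,
    List.append_nil, List.length_reverse] at h1 h2
  exact (h1.seq h2).mono (by omega)

/-- Copy stack `0` to stack `2`. -/
def copyTwo : Prog := seq (move 0 3) (moveTwo 3 0 2)

theorem does_copyTwo (l x : List (Option Bool)) :
    Does copyTwo (stk [l, x]) (stk [l, x, l]) (16 * l.length + 3) := by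
  have e1 : stk [l, x] = stk [l, x, [], []] := (stk_append_nil [l, x] 2).symm
  have e2 : stk [l, x, l] = stk [l, x, l, []] := (stk_append_nil [l, x, l] 1).symm
  rw [e1, e2]
  have h1 := does_move (ls := [l, x, [], []]) 0 3 (by simp) (by simp) (by simp)
  have h2 := does_moveTwo (ls := [[], x, [], l.reverse]) 3 0 2 (by simp) (by simp) (by simp)
    (by simp) (by simp) (by simp)
  simp only [List.set, List.getD_cons_succ, List.getD_cons_zero, List.reverse_reverse,
    List.append_nil, List.length_reverse] at h1 h2
  exact (h1.seq h2).mono (by omega)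

/-- Replace the stacks `0`, `1` and `2` by the code of the pair of the trees on the stacks `1`
and `2`. -/
def combine : Prog :=
  seq (clear 0) (seq (move 2 3) (seq (move 3 0) (seq (move 1 3) (seq (move 3 0)
    (push 0 (some true))))))

theorem does_combine (l x y : List (Option Bool)) :
    Does combine (stk [l, x, y]) (stk [some true :: (x ++ y)])
      (2 * l.length + 12 * x.length + 12 * y.length + 11) := by
  have e1 : stk [l, x, y] = stk [l, x, y, []] := (stk_append_nil [l, x, y] 1).symm
  have e2 : stk [some true :: (x ++ y)] = stk [some true :: (x ++ y), [], [], []] :=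
    (stk_append_nil [some true :: (x ++ y)] 3).symm
  rw [e1, e2]
  have h1 := does_clear (ls := [l, x, y, []]) 0 (by simp)
  have h2 := does_move (ls := [[], x, y, []]) 2 3 (by simp) (by simp) (by simp)
  have h3 := does_move (ls := [[], x, [], y.reverse]) 3 0 (by simp) (by simp) (by simp)
  have h4 := does_move (ls := [y, x, [], []]) 1 3 (by simp) (by simp) (by simp)
  have h5 := does_move (ls := [y, [], [], x.reverse]) 3 0 (by simp) (by simp) (by simp)
  have h6 := does_push (ls := [x ++ y, [], [], []]) 0 (some true) (by simp)
  simp only [List.set, List.getD_cons_succ, List.getD_cons_zero, List.reverse_reverse,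
    List.append_nil, List.length_reverse] at h1 h2 h3 h4 h5 h6
  exact (h1.seq (h2.seq (h3.seq (h4.seq (h5.seq h6))))).mono (by omega)

end Prog

/-! ### Coded types and functions computable in polynomial time. -/

/-- Types whose elements are represented by trees. -/
class Enc (α : Type*) where
  /-- The tree that represents an element. -/
  enc : α → Data
  inj : Function.Injective enc

open Enc (enc)

instance : Enc Data := ⟨id, fun _ _ h => h⟩

instance : Enc Bool :=
  ⟨fun b => bif b then .cons .nil .nil else .nil, fun a b h => by cases a <;> cases b <;> simp_all⟩

/-- The unary representation of a natural number. -/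
def Nat.toData : ℕ → Data
  | 0 => .nil
  | n + 1 => .cons .nil n.toData

theorem Nat.toData_injective : Function.Injective Nat.toData := fun m => by
  induction m with
  | zero => intro n h; cases n <;> simp_all [Nat.toData]
  | succ m ih =>
    intro n h
    cases n with
    | zero => simp [Nat.toData] at h
    | succ n =>
      simp only [Nat.toData, Data.cons.injEq, true_and] at h
      rw [ih h]

instance : Enc ℕ := ⟨Nat.toData, Nat.toData_injective⟩

instance {α β : Type*} [Enc α] [Enc β] : Enc (α × β) :=
  ⟨fun p => .cons (enc p.1) (enc p.2), fun p q h => by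
    simp only [Data.cons.injEq] at h
    exact Prod.ext (Enc.inj h.1) (Enc.inj h.2)⟩

/-- The representation of a list. -/
def List.toData {α : Type*} [Enc α] : List α → Data
  | [] => .nil
  | a :: l => .cons (enc a) l.toData

instance {α : Type*} [Enc α] : Enc (List α) := ⟨List.toData, fun l => by
  induction l with
  | nil => intro l' h; cases l' <;> simp_all [List.toData]
  | cons a l ih =>
    intro l' h
    cases l' with
    | nil => simp [List.toData] at h
    | cons b l' =>
      simp only [List.toData, Data.cons.injEq] at h
      rw [Enc.inj h.1, ih h.2]⟩

/-- The size of the representation of an element. -/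
def esize {α : Type*} [Enc α] (a : α) : ℕ := (enc a).size

/-- A function that a stack program computes in polynomial time. -/
def PT {α β : Type*} [Enc α] [Enc β] (f : α → β) : Prop :=
  ∃ (q : Polynomial ℕ) (P : Prog), ∀ a,
    Prog.Does P (Prog.stk [(enc a).code]) (Prog.stk [(enc (f a)).code]) (q.eval (esize a)) ∧
      esize (f a) ≤ q.eval (esize a)

namespace PT

open Prog Polynomial

variable {α β γ δ σ : Type*} [Enc α] [Enc β] [Enc γ] [Enc δ] [Enc σ]

theorem esize_le {f : α → β} (hf : PT f) :
    ∃ q : Polynomial ℕ, ∀ a, esize (f a) ≤ q.eval (esize a) :=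
  hf.imp fun _ ⟨_, h⟩ a => (h a).2

protected theorem id : PT (fun a : α => a) :=
  ⟨X + 1, .skip, fun a => ⟨(does_skip _).mono (by simp), by simp⟩⟩

/-- `PT` refers to the arguments and values only through their codes, so a change of type that
preserves codes costs nothing. -/
theorem toEnc {f : α → β} (hf : PT f) : PT (fun a => enc (f a)) := hf

theorem of_enc {f : α → β} (hf : PT (fun a => enc (f a))) : PT f := hf

/-- The time of the second program is measured in the size of the intermediate value; this is why
`PT` also records a bound on the size of the result. -/
theorem comp {g : β → γ} {f : α → β} (hg : PT g) (hf : PT f) : PT (fun a => g (f a)) := by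
  obtain ⟨p, P, hP⟩ := hf
  obtain ⟨q, Q, hQ⟩ := hg
  refine ⟨1 + p + q.comp p, P.seq Q, fun a => ⟨((hP a).1.seq (hQ (f a)).1).mono ?_, ?_⟩⟩
  · have := q.eval_mono_nat (hP a).2
    simp only [eval_add, eval_one, eval_comp]; omega
  · have := (hQ (f a)).2.trans (q.eval_mono_nat (hP a).2)
    simp only [eval_add, eval_one, eval_comp]; omega

theorem const (b : β) : PT (fun _ : α => b) := by
  refine ⟨2 * X + C (2 * (enc b).code.length + 3 + esize b), .seq (.clear 0) (.pushAll 0 (enc b).code),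
    fun a => ⟨?_, by simp; omega⟩⟩
  have h1 := does_clear (ls := [(enc a).code]) 0 (by simp)
  have h2 := does_pushAll (ls := [[]]) 0 (by simp) (enc b).code
  simp only [List.set, List.getD_cons_zero, List.append_nil] at h1 h2
  refine (h1.seq h2).mono ?_
  simp only [eval_add, eval_mul, eval_ofNat, eval_X, eval_C]
  have : esize a = (enc a).code.length := rfl
  omega

/-- The input is copied before each of the two computations, which are lifted so that the saved
input and the first result lie below them. -/
theorem pair {f : α → β} {g : α → γ} (hf : PT f) (hg : PT g) : PT (fun a => (f a, g a)) := by
  obtain ⟨p, P, hP⟩ := hf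
  obtain ⟨q, Q, hQ⟩ := hg
  refine ⟨34 * X + 13 * p + 13 * q + 22, .seq .copy (.seq P.lift (.seq .copyTwo
    (.seq Q.lift.lift .combine))), fun a => ⟨?_, ?_⟩⟩
  · have h := (does_copy (enc a).code).seq (((hP a).1.lift (enc a).code).seq
      ((does_copyTwo (enc a).code (enc (f a)).code).seq
      ((((hQ a).1.lift (enc (f a)).code).lift (enc a).code).seq (does_combine _ _ _))))
    refine h.mono ?_
    have h1 := (hP a).2
    have h2 := (hQ a).2
    simp only [esize, Data.size] at h1 h2 ⊢
    simp only [eval_add, eval_mul, eval_ofNat, eval_X]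
    omega
  · have h1 := (hP a).2
    have h2 := (hQ a).2
    have : esize (f a, g a) = esize (f a) + esize (g a) + 1 := Data.size_cons _ _
    simp only [eval_add, eval_mul, eval_ofNat, eval_X]
    omega

/-- Only the first symbol of the code of `c a` is inspected; testing for the leaf covers booleans
and empty lists alike. -/
theorem cond {c : α → γ} {f g : α → β} (hc : PT c) (hf : PT f) (hg : PT g) (p : α → Prop)
    [DecidablePred p] (h : ∀ a, enc (c a) = .nil ↔ ¬ p a) :
    PT (fun a => if p a then f a else g a) := by
  obtain ⟨r, R, hR⟩ := hc
  obtain ⟨p', P, hP⟩ := hf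
  obtain ⟨q, Q, hQ⟩ := hg
  refine ⟨16 * X + 3 * r + p' + q + 10, .seq .copy (.seq R.lift (.ite 1 (isTop (some true))
    (.seq (.clear 1) P) (.seq (.clear 1) Q))), fun a => ⟨?_, ?_⟩⟩
  · have h0 := does_clear (ls := [(enc a).code, (enc (c a)).code]) 1 (by simp)
    simp only [List.set, List.getD_cons_zero, List.getD_cons_succ] at h0
    have e : stk [(enc a).code, []] = stk [(enc a).code] := stk_append_nil [(enc a).code] 1
    rw [e] at h0
    have h1 := (hR a).2
    by_cases hp : p a
    · have ht : isTop (some true) (stk [(enc a).code, (enc (c a)).code] 1).head? = true := by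
        have := fun e => (h a).1 e hp
        rw [head?_stk]
        cases hh : enc (c a) with
        | nil => exact absurd hh this
        | cons => rfl
      simp only [if_pos hp]
      refine ((does_copy _).seq (((hR a).1.lift _).seq
        (.ite_true ht (h0.seq (hP a).1)))).mono ?_
      simp only [esize, Data.size] at h1 ⊢
      simp only [eval_add, eval_mul, eval_ofNat, eval_X]
      omega
    · have ht : isTop (some true) (stk [(enc a).code, (enc (c a)).code] 1).head? = false := by
        rw [head?_stk, (h a).2 hp]; rfl
      simp only [if_neg hp]
      refine ((does_copy _).seq (((hR a).1.lift _).seq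
        (.ite_false ht (h0.seq (hQ a).1)))).mono ?_
      simp only [esize, Data.size] at h1 ⊢
      simp only [eval_add, eval_mul, eval_ofNat, eval_X]
      omega
  · have h1 := (hP a).2
    have h2 := (hQ a).2
    simp only [eval_add, eval_mul, eval_ofNat, eval_X]
    split_ifs <;> omega

theorem data_hd : PT Data.hd := by
  refine ⟨24 * X + 20, .ite 0 (isTop (some true)) (.seq (.pop 0) (.seq .takeTree
    (.seq (.clear 0) (.move 2 0)))) .skip, fun a => ?_⟩
  cases a with
  | nil => exact ⟨(Does.ite_false rfl (does_skip _)).mono (by simp), by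
      simp; exact le_add_left (by norm_num [esize, enc, Data.hd, Data.size_nil])⟩
  | cons a b =>
    have hs : esize (Data.cons a b) = a.size + b.size + 1 := Data.size_cons a b
    refine ⟨?_, ?_⟩
    · have e1 : stk [(Data.cons a b).code] = stk [(Data.cons a b).code, [], [], []] :=
        (stk_append_nil [_] 3).symm
      have e2 : stk [a.code] = stk [a.code, [], [], []] := (stk_append_nil [_] 3).symm
      change Does _ (stk [(Data.cons a b).code]) (stk [a.code]) _
      rw [e1, e2]
      have h1 := does_pop (ls := [(Data.cons a b).code, [], [], []]) 0 (by simp)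
      have h2 := does_takeTree a b.code [] []
      have h3 := does_clear (ls := [b.code, [], a.code.reverse, []]) 0 (by simp)
      have h4 := does_move (ls := [[], [], a.code.reverse, []]) 2 0 (by simp) (by simp) (by simp)
      simp only [List.set, List.getD_cons_succ, List.getD_cons_zero, List.reverse_reverse,
        List.append_nil, List.length_reverse, Data.code, List.tail_cons] at h1 h2 h3 h4
      refine (Does.ite_true rfl (h1.seq (h2.seq (h3.seq h4)))).mono ?_
      simp only [eval_add, eval_mul, eval_ofNat, eval_X, hs]
      simp only [Data.size]
      omega
    · simp only [eval_add, eval_mul, eval_ofNat, eval_X, hs]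
      have : esize (Data.cons a b).hd = a.size := rfl
      omega

theorem data_tl : PT Data.tl := by
  refine ⟨24 * X + 20, .ite 0 (isTop (some true)) (.seq (.pop 0) (.seq .takeTree (.clear 2))) .skip,
    fun a => ?_⟩
  cases a with
  | nil => exact ⟨(Does.ite_false rfl (does_skip _)).mono (by simp), by
      simp; exact le_add_left (by norm_num [esize, enc, Data.tl, Data.size_nil])⟩
  | cons a b =>
    have hs : esize (Data.cons a b) = a.size + b.size + 1 := Data.size_cons a b
    refine ⟨?_, ?_⟩
    · have e1 : stk [(Data.cons a b).code] = stk [(Data.cons a b).code, [], [], []] :=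
        (stk_append_nil [_] 3).symm
      have e2 : stk [b.code] = stk [b.code, [], [], []] := (stk_append_nil [_] 3).symm
      change Does _ (stk [(Data.cons a b).code]) (stk [b.code]) _
      rw [e1, e2]
      have h1 := does_pop (ls := [(Data.cons a b).code, [], [], []]) 0 (by simp)
      have h2 := does_takeTree a b.code [] []
      have h3 := does_clear (ls := [b.code, [], a.code.reverse, []]) 2 (by simp)
      simp only [List.set, List.getD_cons_succ, List.getD_cons_zero,
        List.append_nil, List.length_reverse, Data.code, List.tail_cons] at h1 h2 h3
      refine (Does.ite_true rfl (h1.seq (h2.seq h3))).mono ?_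
      simp only [eval_add, eval_mul, eval_ofNat, eval_X, hs]
      simp only [Data.size]
      omega
    · simp only [eval_add, eval_mul, eval_ofNat, eval_X, hs]
      have : esize (Data.cons a b).tl = b.size := rfl
      omega

theorem fst {f : α → β × γ} (hf : PT f) : PT (fun a => (f a).1) := data_hd.comp hf.toEnc

theorem snd {f : α → β × γ} (hf : PT f) : PT (fun a => (f a).2) := data_tl.comp hf.toEnc

end PT

theorem esize_nil {α : Type*} [Enc α] : esize ([] : List α) = 1 := rfl

theorem esize_cons {α : Type*} [Enc α] (a : α) (l : List α) :
    esize (a :: l) = esize a + esize l + 1 := Data.size_cons _ _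

theorem esize_pair {α β : Type*} [Enc α] [Enc β] (a : α) (b : β) :
    esize (a, b) = esize a + esize b + 1 := Data.size_cons _ _

theorem esize_pos {α : Type*} [Enc α] (a : α) : 0 < esize a := Data.size_pos _

theorem esize_nat (n : ℕ) : esize n = 2 * n + 1 := by
  induction n with
  | zero => rfl
  | succ n ih =>
    have : esize (n + 1) = 1 + esize n + 1 := Data.size_cons _ _
    omega

theorem length_lt_esize {α : Type*} [Enc α] (l : List α) : l.length < esize l := by
  induction l with
  | nil => simp [esize_nil]
  | cons a l ih => rw [esize_cons, List.length_cons]; have := esize_pos a; omega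

theorem esize_lt_of_mem {α : Type*} [Enc α] {a : α} {l : List α} (h : a ∈ l) :
    esize a < esize l := by
  induction l with
  | nil => simp at h
  | cons b l ih =>
    rw [esize_cons]
    rcases List.mem_cons.1 h with rfl | h
    · omega
    · have := ih h; omega

/-! ### Folds with bounded states, and equality. -/

namespace PT

open Prog Polynomial

variable {α β γ δ σ : Type*} [Enc α] [Enc β] [Enc γ] [Enc δ] [Enc σ]

/-- Stack `0` holds the unread part of the list and stack `1` the state. Each round puts the next
item in front of the state, which makes the code of a pair, and runs the lifted step on it. `M`
bounds all states that are reached, `N` all items. -/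
theorem does_fold_loop {g : β × σ → σ} {q : Polynomial ℕ} {P : Prog}
    (hP : ∀ a, Does P (stk [(enc a).code]) (stk [(enc (g a)).code]) (q.eval (esize a)))
    {M N : ℕ} (l : List β) (s : σ) (hN : ∀ x ∈ l, esize x ≤ N)
    (hM : ∀ l', l' <+: l → esize (l'.foldl (fun s x => g (x, s)) s) ≤ M) :
    Does (loop 0 (isTop (some true)) (.seq (.pop 0) (.seq .takeTree (.seq (.move 2 1)
      (.seq (.push 1 (some true)) P.lift)))))
      (stk [(enc l).code, (enc s).code])
      (stk [[some false], (enc (l.foldl (fun s x => g (x, s)) s)).code])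
      (l.length * (16 * N + 20 + q.eval (N + M + 1)) + 1) := by
  induction l generalizing s with
  | nil => exact (Does.loop_false rfl).mono (by omega)
  | cons x l ih =>
    have h := ih (g (x, s)) (fun y hy => hN y (List.mem_cons_of_mem _ hy))
      (fun l' hl' => by simpa using hM (x :: l') (by simpa using hl'))
    have e1 : stk [(enc (x :: l)).code, (enc s).code] =
      stk [(enc (x :: l)).code, (enc s).code, [], []] := (stk_append_nil [_, _] 2).symm
    have e2 : stk [(enc l).code, (enc (x, s)).code] =
      stk [(enc l).code, (enc (x, s)).code, [], []] := (stk_append_nil [_, _] 2).symm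
    have h1 := does_pop (ls := [(enc (x :: l)).code, (enc s).code, [], []]) 0 (by simp)
    have h2 := does_takeTree (enc x) (enc l).code (enc s).code []
    have h3 := does_move (ls := [(enc l).code, (enc s).code, (enc x).code.reverse, []]) 2 1
      (by simp) (by simp) (by simp)
    have h4 := does_push (ls := [(enc l).code, (enc x).code ++ (enc s).code, [], []]) 1
      (some true) (by simp)
    have h5 := (hP (x, s)).lift (enc l).code
    have e3 : (enc (x :: l)).code = some true :: ((enc x).code ++ (enc l).code) := rfl
    have e4 : (enc (x, s)).code = some true :: ((enc x).code ++ (enc s).code) := rfl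
    simp only [List.set, List.getD_cons_succ, List.getD_cons_zero, List.reverse_reverse,
      List.append_nil, List.length_reverse] at h1 h2 h3 h4
    rw [e3, List.tail_cons, ← e3, ← e1] at h1
    rw [← e4, ← e2] at h4
    refine (Does.loop_true rfl (h1.seq (h2.seq (h3.seq (h4.seq h5)))) h).mono ?_
    have hx := hN x List.mem_cons_self
    have hs : esize s ≤ M := hM [] (List.nil_prefix)
    have hq : q.eval (esize (x, s)) ≤ q.eval (N + M + 1) :=
      q.eval_mono_nat (by rw [esize_pair]; omega)
    simp only [esize, Data.size] at hx hq ⊢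
    rw [List.length_cons, Nat.add_mul]
    omega

/-- Iterating a polynomial time step can produce exponentially large states, so a polynomial bound
on every intermediate state is required as a hypothesis. -/
theorem foldl_aux {g : β × σ → σ} (hg : PT g) {l : α → List β} {init : α → σ} (hl : PT l)
    (hi : PT init) (B : Polynomial ℕ)
    (hB : ∀ a l', l' <+: l a → esize (l'.foldl (fun s x => g (x, s)) (init a)) ≤
      B.eval (esize a)) : PT (fun a => (l a).foldl (fun s x => g (x, s)) (init a)) := by
  obtain ⟨p, P, hP⟩ := hl.pair hi
  obtain ⟨q, Q, hQ⟩ := hg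
  refine ⟨p * (16 * p + 20 + q.comp (p + B + 1)) + 40 * p + 12 * B + 40, .seq P (.seq (.pop 0)
    (.seq .takeTree (.seq (.move 0 3) (.seq (.move 3 1) (.seq (.move 2 0)
    (.seq (loop 0 (isTop (some true)) (.seq (.pop 0) (.seq .takeTree (.seq (.move 2 1)
      (.seq (.push 1 (some true)) Q.lift))))) (.seq (.pop 0) (.seq (.move 1 2)
      (.move 2 0))))))))), fun a => ⟨?_, ?_⟩⟩
  · beta_reduce
    have h0 := (hP a).1
    have hs := (hP a).2
    rw [esize_pair] at hs
    have hBa := hB a _ List.prefix_rfl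
    have hlen := length_lt_esize (l a)
    have h7 := does_fold_loop (fun a => (hQ a).1) (l a) (init a)
      (M := B.eval (esize a)) (N := p.eval (esize a))
      (fun x hx => by have := esize_lt_of_mem hx; omega) (fun l' hl' => hB a l' hl')
    generalize (l a).foldl (fun s x => g (x, s)) (init a) = s' at *
    have hmul : (l a).length * (16 * p.eval (esize a) + 20 +
        q.eval (p.eval (esize a) + B.eval (esize a) + 1)) ≤ p.eval (esize a) *
        (16 * p.eval (esize a) + 20 + q.eval (p.eval (esize a) + B.eval (esize a) + 1)) :=
      Nat.mul_le_mul_right _ (by omega)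
    have e1 : stk [(enc (l a, init a)).code] = stk [(enc (l a, init a)).code, [], [], []] :=
      (stk_append_nil [_] 3).symm
    have e2 : stk [(enc (l a)).code, (enc (init a)).code] =
      stk [(enc (l a)).code, (enc (init a)).code, [], []] := (stk_append_nil [_, _] 2).symm
    have e3 : stk [[some false], (enc s').code] = stk [[some false], (enc s').code, []] :=
      (stk_append_nil [_, _] 1).symm
    have e4 : stk [(enc s').code] = stk [(enc s').code, [], []] :=
      (stk_append_nil [_] 2).symm
    have e5 : (enc (l a, init a)).code = some true :: ((enc (l a)).code ++ (enc (init a)).code) :=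
      rfl
    have h1 := does_pop (ls := [(enc (l a, init a)).code, [], [], []]) 0 (by simp)
    have h2 := does_takeTree (enc (l a)) (enc (init a)).code [] []
    have h3 := does_move (ls := [(enc (init a)).code, [], (enc (l a)).code.reverse, []]) 0 3
      (by simp) (by simp) (by simp)
    have h4 := does_move (ls := [[], [], (enc (l a)).code.reverse, (enc (init a)).code.reverse])
      3 1 (by simp) (by simp) (by simp)
    have h5 := does_move (ls := [[], (enc (init a)).code, (enc (l a)).code.reverse, []])
      2 0 (by simp) (by simp) (by simp)
    have h8 := does_pop (ls := [[some false], (enc s').code, []]) 0 (by simp)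
    have h9 := does_move (ls := [[], (enc s').code, []]) 1 2 (by simp) (by simp) (by simp)
    have h10 := does_move (ls := [[], [], (enc s').code.reverse]) 2 0 (by simp) (by simp) (by simp)
    simp only [List.set, List.getD_cons_succ, List.getD_cons_zero, List.reverse_reverse,
      List.append_nil, List.length_reverse, List.tail_cons] at h1 h2 h3 h4 h5 h8 h9 h10
    rw [e5, List.tail_cons, ← e5, ← e1] at h1
    rw [← e2] at h5
    rw [← e3] at h8
    rw [← e4] at h10
    refine (h0.seq (h1.seq (h2.seq (h3.seq (h4.seq (h5.seq (h7.seq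
      (h8.seq (h9.seq h10))))))))).mono ?_
    simp only [eval_add, eval_mul, eval_ofNat, eval_comp, eval_one]
    simp only [esize, Data.size] at hs hBa hmul ⊢
    omega
  · have := hB a _ List.prefix_rfl
    simp only [eval_add, eval_mul, eval_ofNat, eval_comp, eval_one]
    omega

theorem foldl {step : α → σ → β → σ} (hs : PT (fun p : (α × σ) × β => step p.1.1 p.1.2 p.2))
    {l : α → List β} {init : α → σ} (hl : PT l) (hi : PT init) (B : Polynomial ℕ)
    (hB : ∀ a l', l' <+: l a → esize (l'.foldl (step a) (init a)) ≤ B.eval (esize a)) :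
    PT (fun a => (l a).foldl (step a) (init a)) := by
  have key : ∀ a (l' : List β) s, l'.foldl (fun (s : α × σ) x => (s.1, step s.1 s.2 x)) (a, s) =
      (a, l'.foldl (step a) s) := fun a l' => by
    induction l' with
    | nil => simp
    | cons x l' ih => intro s; simp [ih]
  -- The argument `a` travels inside the state, so that the step may depend on it.
  have h := foldl_aux (g := fun p : β × (α × σ) => (p.2.1, step p.2.1 p.2.2 p.1)) (l := l)
    (init := fun a => (a, init a))
    (PT.pair (PT.id.snd.fst) (hs.comp (f := fun p : β × (α × σ) => ((p.2.1, p.2.2), p.1))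
      ((PT.id.snd.fst.pair PT.id.snd.snd).pair PT.id.fst)))
    hl (PT.id.pair hi) (X + B + 1) (fun a l' hl' => by
      rw [key, esize_pair]
      have := hB a l' hl'
      simp only [eval_add, eval_one, eval_X]
      omega)
  have h2 := h.snd
  simpa only [key] using h2

/-- Stack `2` collects one mark for each position where the words differ, including positions beyond
the end of `x`. The words agree exactly if no mark was set and nothing of `x` remains. The word `y`
must avoid `none`, since any symbol other than `some true` is treated as `some false`. -/
theorem does_eq_loop (y x u : List (Option Bool)) (hy : ∀ a ∈ y, a ≠ none) :
    ∃ x' u' : List (Option Bool), (x' = [] ∧ u' = [] ↔ u = [] ∧ x = y) ∧ x'.length ≤ x.length ∧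
      u'.length ≤ u.length + y.length ∧
      Does (loop 0 Option.isSome (.seq (ite 0 (isTop (some true))
        (ite 1 (isTop (some true)) .skip (.push 2 none))
        (ite 1 (isTop (some false)) .skip (.push 2 none))) (.seq (.pop 0) (.pop 1))))
        (stk [y, x, u]) (stk [[], x', u']) (8 * y.length + 1) := by
  induction y generalizing x u with
  | nil => exact ⟨x, u, by tauto, le_rfl, by simp, Does.loop_false rfl⟩
  | cons a y ih =>
    have h1 : ∃ u₁ : List (Option Bool), (u₁ = [] ↔ u = [] ∧ x.head? = some a) ∧
        u₁.length ≤ u.length + 1 ∧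
        Does (ite 0 (isTop (some true)) (ite 1 (isTop (some true)) .skip (.push 2 none))
          (ite 1 (isTop (some false)) .skip (.push 2 none))) (stk [a :: y, x, u])
          (stk [a :: y, x, u₁]) 3 := by
      have hne : ∀ b, x.head? ≠ some b → isTop b x.head? = false := fun b h => by
        simpa [isTop] using h
      by_cases hx : x.head? = some a
      · refine ⟨u, by tauto, by omega, ?_⟩
        match a, hx, hy a (by simp) with
        | some true, hx, _ =>
          exact .ite_true rfl (.ite_true (by rw [head?_stk]; simp [hx, isTop]) (does_skip _))
        | some false, hx, _ =>
          exact .ite_false rfl (.ite_true (by rw [head?_stk]; simp [hx, isTop]) (does_skip _))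
      · refine ⟨none :: u, by simp [hx], by simp, ?_⟩
        match a, hx, hy a (by simp) with
        | some true, hx, _ =>
          exact .ite_true rfl (.ite_false (by rw [head?_stk]; exact hne _ hx)
            (does_push 2 none (by simp)))
        | some false, hx, _ =>
          exact .ite_false rfl (.ite_false (by rw [head?_stk]; exact hne _ hx)
            (does_push 2 none (by simp)))
    obtain ⟨u₁, hu₁, hlen₁, h1⟩ := h1
    obtain ⟨x', u', hiff, hx', hu', h⟩ := ih x.tail u₁ (fun b hb => hy b (by simp [hb]))
    have h2 := does_pop (ls := [a :: y, x, u₁]) 0 (by simp)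
    have h3 := does_pop (ls := [y, x, u₁]) 1 (by simp)
    refine ⟨x', u', ?_, hx'.trans (by simp), by simp; omega,
      (Does.loop_true rfl (h1.seq (h2.seq h3)) h).mono (by simp; omega)⟩
    rw [hiff, hu₁]
    cases x with
    | nil => simp
    | cons b x => simp only [List.head?_cons, Option.some.injEq, List.tail_cons, List.cons.injEq]; tauto

theorem data_eq : PT (fun p : Data × Data => @decide (p.1 = p.2) (Classical.dec _)) := by
  classical
  refine ⟨60 * X + 60, .seq (.pop 0) (.seq .takeTree (.seq (.move 2 1) (.seq
    (loop 0 Option.isSome (.seq (ite 0 (isTop (some true))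
        (ite 1 (isTop (some true)) .skip (.push 2 none))
        (ite 1 (isTop (some false)) .skip (.push 2 none))) (.seq (.pop 0) (.pop 1))))
    (ite 2 Option.isSome (.seq (.clear 1) (.seq (.clear 2) (.pushAll 0 (enc false).code)))
      (ite 1 Option.isSome (.seq (.clear 1) (.pushAll 0 (enc false).code))
        (.pushAll 0 (enc true).code)))))), fun ⟨s, t⟩ => ⟨?_, ?_⟩⟩
  · obtain ⟨x', u', hiff, hx', hu', h⟩ := does_eq_loop t.code s.code [] t.ne_none_of_mem_code
    have e1 : stk [(enc (s, t)).code] = stk [(enc (s, t)).code, [], [], []] :=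
      (stk_append_nil [_] 3).symm
    have e2 : stk [t.code, s.code, [], []] = stk [t.code, s.code, []] :=
      (stk_append_nil [t.code, s.code, []] 1)
    have e3 : ∀ l, stk [l, [], []] = stk [l] := fun l => (stk_append_nil [l] 2)
    have e5 : (enc (s, t)).code = some true :: (s.code ++ t.code) := rfl
    have h1 := does_pop (ls := [(enc (s, t)).code, [], [], []]) 0 (by simp)
    have h2 := does_takeTree s t.code [] []
    have h3 := does_move (ls := [t.code, [], s.code.reverse, []]) 2 1
      (by simp) (by simp) (by simp)
    simp only [List.set, List.getD_cons_succ, List.getD_cons_zero, List.reverse_reverse,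
      List.append_nil, List.length_reverse] at h1 h2 h3
    rw [e5, List.tail_cons, ← e5, ← e1] at h1
    rw [e2] at h3
    have hs : esize (s, t) = s.code.length + t.code.length + 1 := esize_pair s t
    have key : Does (ite 2 Option.isSome (.seq (.clear 1) (.seq (.clear 2)
        (.pushAll 0 (enc false).code))) (ite 1 Option.isSome (.seq (.clear 1)
        (.pushAll 0 (enc false).code)) (.pushAll 0 (enc true).code))) (stk [[], x', u'])
        (stk [(enc (decide (s = t))).code]) (2 * x'.length + 2 * u'.length + 20) := by
      have c1 := does_clear (ls := [[], x', u']) 1 (by simp)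
      have c2 := does_clear (ls := [[], [], u']) 2 (by simp)
      have c3 := does_pushAll (ls := [[], [], []]) 0 (by simp) (enc false).code
      have c4 := does_pushAll (ls := [[], [], []]) 0 (by simp) (enc true).code
      simp only [List.set, List.getD_cons_succ, List.getD_cons_zero, List.append_nil] at c1 c2 c3 c4
      rw [e3 (enc _).code] at c3 c4
      have l3 : (enc false).code.length = 1 := rfl
      have l4 : (enc true).code.length = 3 := rfl
      by_cases hst : s = t
      · obtain ⟨rfl, rfl⟩ := hiff.2 ⟨rfl, by rw [hst]⟩
        rw [decide_eq_true hst]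
        refine (Does.ite_false rfl (.ite_false rfl c4)).mono ?_
        omega
      · rw [decide_eq_false hst]
        have hne : ¬ (x' = [] ∧ u' = []) := fun e => hst (Data.code_injective (hiff.1 e).2)
        cases u' with
        | cons b u' =>
          refine (Does.ite_true rfl (c1.seq (c2.seq c3))).mono ?_
          omega
        | nil =>
          cases x' with
          | nil => simp at hne
          | cons b x' =>
            refine (Does.ite_false rfl (.ite_true rfl (c1.seq c3))).mono ?_
            omega
    refine (h1.seq (h2.seq (h3.seq (h.seq key)))).mono ?_
    simp only [eval_add, eval_mul, eval_ofNat, eval_X, hs]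
    simp only [List.length_nil] at hu'
    simp only [Data.size]
    omega
  · simp only [eval_add, eval_mul, eval_ofNat, eval_X]
    have : ∀ b : Bool, esize b ≤ 3 := by intro b; cases b <;> decide
    have := this (decide (s = t))
    omega

/-- Codes are injective, so equality may be tested on them. -/
theorem decide_eq [DecidableEq β] {f g : α → β} (hf : PT f) (hg : PT g) :
    PT (fun a => decide (f a = g a)) := by
  have h := data_eq.comp (hf.toEnc.pair hg.toEnc)
  refine (congrArg PT (funext fun a => ?_)).mp h
  by_cases e : f a = g a <;> simp [e, Enc.inj.eq_iff]


/-! ### From tree functions to machines -/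

/-- Convert the input of a machine to the code of a tree. -/
def readInput : Prog :=
  seq (move 0 1) (seq (push 0 (some false)) (seq
    (loop 1 (isTop none) (.seq (.pop 1) (.seq (.push 0 (some false)) (.push 0 (some true)))))
    (seq (push 0 (some false)) (seq
    (loop 1 Option.isSome (.seq (ite 1 (isTop (some true)) (pushAll 0 (enc true).code)
      (pushAll 0 (enc false).code)) (.seq (.pop 1) (push 0 (some true)))))
    (push 0 (some true))))))

theorem does_read_unary (n k : ℕ) (y : List (Option Bool)) (hy : isTop none y.head? = false) :
    Does (loop 1 (isTop none) (.seq (.pop 1) (.seq (.push 0 (some false)) (.push 0 (some true)))))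
      (stk [(enc k).code, List.replicate n none ++ y]) (stk [(enc (k + n)).code, y])
      (6 * n + 1) := by
  induction n generalizing k with
  | zero => exact (Does.loop_false hy)
  | succ n ih =>
    have h1 := does_pop (ls := [(enc k).code, none :: (List.replicate n none ++ y)]) 1 (by simp)
    have h2 := does_push (ls := [(enc k).code, List.replicate n none ++ y]) 0 (some false) (by simp)
    have h3 := does_push (ls := [some false :: (enc k).code, List.replicate n none ++ y]) 0
      (some true) (by simp)
    have h := ih (k + 1)
    rw [show k + 1 + n = k + (n + 1) by ring] at h
    rw [List.replicate_succ, List.cons_append]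
    exact (Does.loop_true rfl (h1.seq (h2.seq h3)) h).mono (by omega)

theorem does_read_bits (x l : List Bool) (r : List (Option Bool)) :
    Does (loop 1 Option.isSome (.seq (ite 1 (isTop (some true)) (pushAll 0 (enc true).code)
      (pushAll 0 (enc false).code)) (.seq (.pop 1) (push 0 (some true)))))
      (stk [(enc l).code ++ r, x.map some]) (stk [(enc (x.reverse ++ l)).code ++ r, []])
      (14 * x.length + 1) := by
  induction x generalizing l with
  | nil => exact (Does.loop_false rfl)
  | cons b x ih =>
    have l3 : (enc false).code.length = 1 := rfl
    have l4 : (enc true).code.length = 3 := rfl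
    have h1 : Does (ite 1 (isTop (some true)) (pushAll 0 (enc true).code)
        (pushAll 0 (enc false).code)) (stk [(enc l).code ++ r, (b :: x).map some])
        (stk [(enc b).code ++ ((enc l).code ++ r), (b :: x).map some]) 8 := by
      cases b
      · refine (Does.ite_false rfl (does_pushAll 0 (by simp) _)).mono ?_
        omega
      · refine (Does.ite_true rfl (does_pushAll 0 (by simp) _)).mono ?_
        omega
    have h2 := does_pop (ls := [(enc b).code ++ ((enc l).code ++ r), (b :: x).map some]) 1 (by simp)
    have h3 := does_push (ls := [(enc b).code ++ ((enc l).code ++ r), x.map some]) 0 (some true)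
      (by simp)
    have h := ih (b :: l)
    have e : (enc (b :: l)).code ++ r = some true :: ((enc b).code ++ ((enc l).code ++ r)) := by
      change some true :: ((enc b).code ++ (enc l).code) ++ r = _
      simp
    rw [e] at h
    rw [show (b :: x).reverse ++ l = x.reverse ++ b :: l by simp]
    exact (Does.loop_true rfl (h1.seq (h2.seq h3)) h).mono (by simp; omega)

/-- Moving the input reverses it: the unary parameter comes up first and then the bits from the last
to the first. This is the order in which the code of the pair is built from its end. -/
theorem does_readInput (p : List Bool × ℕ) :
    Does readInput (stk [encodePair p]) (stk [(enc p).code])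
      (20 * (encodePair p).length + 12) := by
  obtain ⟨x, k⟩ := p
  have e1 : stk [encodePair (x, k)] = stk [encodePair (x, k), []] := (stk_append_nil [_] 1).symm
  have e2 : stk [(enc (x, k)).code] = stk [(enc (x, k)).code, []] := (stk_append_nil [_] 1).symm
  have e3 : (encodePair (x, k)).reverse = List.replicate k none ++ x.reverse.map some := by
    simp [encodePair]
  have e4 : (encodePair (x, k)).length = x.length + k := by simp [encodePair]
  rw [e1, e2, e4]
  have h1 := does_move (ls := [encodePair (x, k), []]) 0 1 (by simp) (by simp) (by simp)
  have h2 := does_push (ls := [[], (encodePair (x, k)).reverse]) 0 (some false) (by simp)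
  have h3 := does_read_unary k 0 (x.reverse.map some) (by
    generalize x.reverse = y; cases y <;> rfl)
  have h4 := does_push (ls := [(enc k).code, x.reverse.map some]) 0 (some false) (by simp)
  have h5 := does_read_bits x.reverse [] (enc k).code
  have h6 := does_push (ls := [(enc x).code ++ (enc k).code, []]) 0 (some true) (by simp)
  rw [zero_add] at h3
  simp only [List.set, List.getD_cons_succ, List.getD_cons_zero,
    List.append_nil, List.reverse_reverse, List.length_reverse] at h1 h2 h3 h4 h5 h6
  rw [e4] at h1
  rw [e3] at h1 h2
  exact (h1.seq (h2.seq (h3.seq (h4.seq (h5.seq h6))))).mono (by omega)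

/-- Convert the code of a tree to the output of a machine. -/
def writeOutput : Prog :=
  seq (pop 0) (seq (loop 0 (isTop (some true)) (seq (pop 0) (ite 0 (isTop (some true))
      (seq (pop 0) (seq (pop 0) (seq (pop 0) (push 1 (some true)))))
      (seq (pop 0) (push 1 (some false))))))
    (seq (pop 0) (seq (loop 0 (isTop (some true)) (seq (pop 0) (seq (pop 0) (push 1 none))))
      (seq (pop 0) (move 1 0)))))

theorem does_write_bits (x : List Bool) (r u : List (Option Bool)) :
    Does (loop 0 (isTop (some true)) (seq (pop 0) (ite 0 (isTop (some true))
      (seq (pop 0) (seq (pop 0) (seq (pop 0) (push 1 (some true)))))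
      (seq (pop 0) (push 1 (some false))))))
      (stk [(enc x).code ++ r, u]) (stk [some false :: r, (x.map some).reverse ++ u])
      (11 * x.length + 1) := by
  induction x generalizing u with
  | nil => exact (Does.loop_false rfl)
  | cons b x ih =>
    have e : (enc (b :: x)).code ++ r = some true :: ((enc b).code ++ ((enc x).code ++ r)) := by
      change some true :: ((enc b).code ++ (enc x).code) ++ r = _
      simp
    have h1 : Does (ite 0 (isTop (some true))
        (seq (pop 0) (seq (pop 0) (seq (pop 0) (push 1 (some true)))))
        (seq (pop 0) (push 1 (some false)))) (stk [(enc b).code ++ ((enc x).code ++ r), u])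
        (stk [(enc x).code ++ r, some b :: u]) 8 := by
      cases b
      · refine (Does.ite_false rfl ((does_pop 0 (by simp)).seq (does_push 1 _ (by simp)))).mono ?_
        omega
      · exact (Does.ite_true rfl ((does_pop 0 (by simp)).seq ((does_pop 0 (by simp)).seq
          ((does_pop 0 (by simp)).seq (does_push 1 _ (by simp))))))
    rw [e]
    have h := ih (some b :: u)
    rw [show (x.map some).reverse ++ some b :: u = ((b :: x).map some).reverse ++ u by simp] at h
    exact (Does.loop_true rfl ((does_pop 0 (by simp)).seq h1) h).mono (by simp; omega)

theorem does_write_unary (k : ℕ) (u : List (Option Bool)) :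
    Does (loop 0 (isTop (some true)) (seq (pop 0) (seq (pop 0) (push 1 none))))
      (stk [(enc k).code, u]) (stk [[some false], List.replicate k none ++ u]) (6 * k + 1) := by
  induction k generalizing u with
  | zero => exact (Does.loop_false rfl)
  | succ k ih =>
    have h := ih (none :: u)
    rw [show List.replicate k none ++ none :: u = List.replicate (k + 1) none ++ u by
      rw [List.replicate_succ']; simp] at h
    exact (Does.loop_true rfl ((does_pop 0 (by simp)).seq ((does_pop 0 (by simp)).seq
      (does_push 1 _ (by simp)))) h).mono (by omega)

theorem does_writeOutput (p : List Bool × ℕ) :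
    Does writeOutput (stk [(enc p).code]) (stk [encodePair p]) (20 * esize p + 20) := by
  obtain ⟨x, k⟩ := p
  have e1 : stk [(enc (x, k)).code] = stk [(enc (x, k)).code, []] := (stk_append_nil [_] 1).symm
  have e2 : stk [encodePair (x, k)] = stk [encodePair (x, k), []] := (stk_append_nil [_] 1).symm
  have e3 : (encodePair (x, k)).reverse = List.replicate k none ++ (x.map some).reverse := by
    simp [encodePair]
  have e4 : (encodePair (x, k)).length = x.length + k := by simp [encodePair]
  rw [e1, e2, esize_pair, esize_nat]
  have hx := length_lt_esize x
  have h1 := does_pop (ls := [(enc (x, k)).code, []]) 0 (by simp)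
  have h2 := does_write_bits x (enc k).code []
  have h3 := does_pop (ls := [some false :: (enc k).code, (x.map some).reverse]) 0 (by simp)
  have h4 := does_write_unary k (x.map some).reverse
  have h5 := does_pop (ls := [[some false], (encodePair (x, k)).reverse]) 0 (by simp)
  have h6 := does_move (ls := [[], (encodePair (x, k)).reverse]) 1 0 (by simp) (by simp) (by simp)
  simp only [List.set, List.getD_cons_succ, List.getD_cons_zero, List.tail_cons,
    List.append_nil, List.reverse_reverse, List.length_reverse] at h1 h2 h3 h4 h5 h6
  rw [← e3] at h4
  rw [e4] at h6
  exact (h1.seq (h2.seq (h3.seq (h4.seq (h5.seq h6))))).mono (by omega)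

theorem esize_input_le (p : List Bool × ℕ) : esize p ≤ 6 * (encodePair p).length + 3 := by
  obtain ⟨x, k⟩ := p
  have e4 : (encodePair (x, k)).length = x.length + k := by simp [encodePair]
  rw [esize_pair, esize_nat, e4]
  have : esize x ≤ 4 * x.length + 1 := by
    induction x with
    | nil => simp [esize_nil]
    | cons b x ih =>
      have : ∀ b : Bool, esize b ≤ 3 := by intro b; cases b <;> decide
      have := this b
      rw [esize_cons, List.length_cons]
      have := ih (by simp [encodePair])
      omega
  omega

/-- The factor `21` covers both the run of the program and the writing of a result whose size has
the same bound. -/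
theorem isPolyTime {f : List Bool × ℕ → List Bool × ℕ} (hf : PT f) : IsPolyTime f := by
  obtain ⟨q, P, hP⟩ := hf
  refine Prog.isPolyTime (.seq readInput (.seq P writeOutput))
    (20 * X + 40 + 21 * q.comp (6 * X + 3)) fun p => ?_
  have e : ∀ l, single l = stk [l] := fun l => by
    funext k
    cases k <;> simp [single, stk]
  rw [e, e]
  have h := ((does_readInput p).seq ((hP p).1.seq (does_writeOutput (f p)))).mono
    (n := (20 * X + 40 + 21 * q.comp (6 * X + 3)).eval (encodePair p).length) (by
      have h1 := (hP p).2
      have h2 := q.eval_mono_nat (esize_input_le p)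
      simp only [eval_add, eval_mul, eval_ofNat, eval_comp, eval_X]
      omega)
  exact h

end PT

/-! ### A library of polynomial time functions -/

instance : Enc Unit := ⟨fun _ => .nil, fun _ _ _ => rfl⟩

instance {p : ℕ} [NeZero p] : Enc (ZMod p) :=
  ⟨fun a => enc a.val, fun _ _ h => ZMod.val_injective p (Enc.inj h)⟩

theorem esize_append {α : Type*} [Enc α] (l m : List α) :
    esize (l ++ m) + 1 = esize l + esize m := by
  induction l with
  | nil => simp [esize_nil]; omega
  | cons a l ih => rw [List.cons_append, esize_cons, esize_cons]; omega

theorem esize_reverse {α : Type*} [Enc α] (l : List α) : esize l.reverse = esize l := by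
  induction l with
  | nil => rfl
  | cons a l ih =>
    rw [List.reverse_cons, esize_cons]
    have := esize_append l.reverse [a]
    rw [esize_cons, esize_nil] at this
    omega

theorem esize_le_of_prefix {α : Type*} [Enc α] {l m : List α} (h : l <+: m) :
    esize l ≤ esize m := by
  obtain ⟨t, rfl⟩ := h
  have := esize_append l t
  have := esize_pos t
  omega

theorem esize_list_le {α : Type*} [Enc α] (l : List α) {N : ℕ} (h : ∀ x ∈ l, esize x ≤ N) :
    esize l ≤ l.length * (N + 1) + 1 := by
  induction l with
  | nil => simp [esize_nil]
  | cons a l ih =>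
    rw [esize_cons, List.length_cons]
    have := ih fun x hx => h x (List.mem_cons_of_mem _ hx)
    have := h a List.mem_cons_self
    rw [Nat.add_mul]
    omega

theorem esize_bool_le (b : Bool) : esize b ≤ 3 := by cases b <;> decide

-- The closure properties are given to `fun_prop`, so that most later polynomial time claims follow
-- by unfolding the definition.
attribute [fun_prop] PT
attribute [fun_prop] PT.id PT.const PT.pair PT.fst PT.snd PT.comp

namespace PT

open Prog Polynomial

variable {α β γ δ σ : Type*} [Enc α] [Enc β] [Enc γ] [Enc δ] [Enc σ]

@[fun_prop]
theorem ite {c : α → Bool} {f g : α → β} (hc : PT c) (hf : PT f) (hg : PT g) :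
    PT (fun a => if c a = true then f a else g a) :=
  cond hc hf hg _ fun a => by cases c a <;> simp [enc]

@[fun_prop]
theorem not {c : α → Bool} (hc : PT c) : PT (fun a => !c a) :=
  (congrArg PT (funext fun a => by cases c a <;> rfl)).mp (hc.ite (const false) (const true))

@[fun_prop]
theorem and {b c : α → Bool} (hb : PT b) (hc : PT c) : PT (fun a => b a && c a) :=
  (congrArg PT (funext fun a => by cases b a <;> rfl)).mp (hb.ite hc (const false))

@[fun_prop]
theorem or {b c : α → Bool} (hb : PT b) (hc : PT c) : PT (fun a => b a || c a) :=
  (congrArg PT (funext fun a => by cases b a <;> rfl)).mp (hb.ite (const true) hc)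

attribute [fun_prop] decide_eq

theorem ite_eq [DecidableEq γ] {u v : α → γ} {f g : α → β} (hu : PT u) (hv : PT v) (hf : PT f)
    (hg : PT g) : PT (fun a => if u a = v a then f a else g a) := by
  simpa using (decide_eq hu hv).ite hf hg

attribute [fun_prop] ite_eq

@[fun_prop]
theorem list_cons {f : α → β} {l : α → List β} (hf : PT f) (hl : PT l) :
    PT (fun a => f a :: l a) := hf.pair hl

@[fun_prop]
theorem list_tail {l : α → List β} (hl : PT l) : PT (fun a => (l a).tail) :=
  (congrArg PT (funext fun a => by cases l a <;> rfl)).mp (data_tl.comp hl.toEnc) |>.of_enc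

theorem ite_nil {l : α → List γ} {f g : α → β} (hl : PT l) (hf : PT f) (hg : PT g) :
    PT (fun a => if l a ≠ [] then f a else g a) :=
  cond hl hf hg _ fun a => by cases l a <;> simp [enc, List.toData]

@[fun_prop]
theorem list_headD {l : α → List β} {d : α → β} (hl : PT l) (hd : PT d) :
    PT (fun a => (l a).headD (d a)) := by
  have h := ite_nil hl (data_hd.comp hl.toEnc) hd.toEnc
  refine of_enc ((congrArg PT (funext fun a => ?_)).mp h)
  cases l a <;> rfl

@[fun_prop]
theorem list_isEmpty {l : α → List β} (hl : PT l) : PT (fun a => (l a).isEmpty) :=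
  (congrArg PT (funext fun a => by cases l a <;> rfl)).mp (ite_nil hl (const false) (const true))

@[fun_prop]
theorem list_reverse {l : α → List β} (hl : PT l) : PT (fun a => (l a).reverse) := by
  have key : ∀ l m : List β, l.foldl (fun s x => x :: s) m = l.reverse ++ m := fun l => by
    induction l with
    | nil => simp
    | cons x l ih => intro m; simp [ih]
  obtain ⟨q, hq⟩ := hl.esize_le
  have h := foldl (step := fun (_ : α) (s : List β) x => x :: s) (l := l) (init := fun _ => [])
    (by fun_prop) hl (by fun_prop) q (fun a l' hl' => by
      rw [key, List.append_nil, esize_reverse]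
      exact (esize_le_of_prefix hl').trans (hq a))
  simpa only [key, List.append_nil] using h

@[fun_prop]
theorem list_append {l m : α → List β} (hl : PT l) (hm : PT m) : PT (fun a => l a ++ m a) := by
  have key : ∀ l m : List β, l.foldl (fun s x => x :: s) m = l.reverse ++ m := fun l => by
    induction l with
    | nil => simp
    | cons x l ih => intro m; simp [ih]
  obtain ⟨q, hq⟩ := hl.esize_le
  obtain ⟨r, hr⟩ := hm.esize_le
  have h := foldl (step := fun (_ : α) (s : List β) x => x :: s) (l := fun a => (l a).reverse)
    (init := m) (by fun_prop) hl.list_reverse hm (q + r) (fun a l' hl' => by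
      rw [key]
      have h1 := esize_append l'.reverse (m a)
      rw [esize_reverse] at h1
      have h2 := (esize_le_of_prefix hl')
      rw [esize_reverse] at h2
      have := hq a
      have := hr a
      rw [eval_add]; omega)
  simpa only [key, List.reverse_reverse] using h

/-- Every intermediate state has at most as many blocks as the list has items, and each block is
polynomially bounded because the item is part of the polynomially bounded list. -/
theorem list_flatMap {g : α → β → List γ} (hg : PT (fun p : α × β => g p.1 p.2))
    {l : α → List β} (hl : PT l) : PT (fun a => (l a).flatMap (g a)) := by
  have key : ∀ a (l : List β) m, l.foldl (fun s x => s ++ g a x) m = m ++ l.flatMap (g a) :=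
    fun a l => by
      induction l with
      | nil => simp
      | cons x l ih => intro m; simp [ih]
  obtain ⟨q, hq⟩ := hl.esize_le
  obtain ⟨r, hr⟩ := hg.esize_le
  have h := foldl (step := fun a s x => s ++ g a x) (l := l)
    (init := fun _ => []) (by fun_prop) hl (by fun_prop) (q * r.comp (X + q + 1) + 1)
    (fun a l' hl' => by
      rw [key, List.nil_append]
      have h1 : ∀ x ∈ l a, esize (g a x) ≤ (r.comp (X + q + 1)).eval (esize a) := fun x hx => by
        refine (hr (a, x)).trans ?_
        rw [eval_comp]
        refine r.eval_mono_nat ?_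
        rw [esize_pair]
        have := esize_lt_of_mem hx
        have := hq a
        simp only [eval_add, eval_X, eval_one]; omega
      have h2 : ∀ l' : List β, (∀ x ∈ l', esize (g a x) ≤ (r.comp (X + q + 1)).eval (esize a)) →
          esize (l'.flatMap (g a)) ≤ l'.length * (r.comp (X + q + 1)).eval (esize a) + 1 :=
        fun l' => by
          induction l' with
          | nil => simp [esize_nil]
          | cons x l' ih =>
            intro h
            have h3 := ih (fun y hy => h y (List.mem_cons_of_mem _ hy))
            have h4 := h x List.mem_cons_self
            have h5 := esize_append (g a x) (l'.flatMap (g a))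
            rw [List.flatMap_cons, List.length_cons, Nat.add_mul]
            omega
      have h3 := h2 l' fun x hx => h1 x (hl'.subset hx)
      rw [eval_add, eval_mul, eval_one]
      refine h3.trans (Nat.add_le_add_right (Nat.mul_le_mul_right _ ?_) 1)
      exact (hl'.length_le.trans (length_lt_esize _).le).trans (hq a))
  simpa only [key, List.nil_append] using h

theorem list_map {g : α → β → γ} (hg : PT (fun p : α × β => g p.1 p.2))
    {l : α → List β} (hl : PT l) : PT (fun a => (l a).map (g a)) := by
  have h := list_flatMap (g := fun a x => [g a x]) (by fun_prop) hl
  simpa only [List.map_eq_flatMap] using h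

theorem list_filter {c : α → β → Bool} (hc : PT (fun p : α × β => c p.1 p.2))
    {l : α → List β} (hl : PT l) : PT (fun a => (l a).filter (c a)) := by
  have h := list_flatMap (g := fun a x => if c a x = true then [x] else []) (by fun_prop) hl
  have key : ∀ (a : α) (l : List β), l.flatMap (fun x => if c a x = true then [x] else []) =
      l.filter (c a) := fun a l => by
    induction l with
    | nil => rfl
    | cons x l ih => by_cases h : c a x = true <;> simp [ih, h]
  simpa only [key] using h

theorem list_any {c : α → β → Bool} (hc : PT (fun p : α × β => c p.1 p.2))
    {l : α → List β} (hl : PT l) : PT (fun a => (l a).any (c a)) := by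
  refine (congrArg PT (funext fun a => ?_)).mp (list_filter hc hl).list_isEmpty.not
  rw [Bool.eq_iff_iff]
  simp

theorem list_all {c : α → β → Bool} (hc : PT (fun p : α × β => c p.1 p.2))
    {l : α → List β} (hl : PT l) : PT (fun a => (l a).all (c a)) := by
  refine (congrArg PT (funext fun a => ?_)).mp
    (list_any (c := fun a x => !c a x) (by fun_prop) hl).not
  rw [Bool.eq_iff_iff]
  simp

theorem list_elem {x : α → β} {l : α → List β} [∀ a, Decidable (x a ∈ l a)] (hx : PT x)
    (hl : PT l) : PT (fun a => decide (x a ∈ l a)) := by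
  classical
  refine (congrArg PT (funext fun a => ?_)).mp
    (list_any (c := fun a y => decide (x a = y)) (by fun_prop) hl)
  rw [Bool.eq_iff_iff]
  simp

attribute [fun_prop] list_elem

attribute [fun_prop] list_flatMap list_map list_filter list_any list_all

/-! #### Natural numbers -/

theorem enc_replicate (n : ℕ) : enc (List.replicate n ()) = enc n := by
  induction n with
  | zero => rfl
  | succ n ih => exact congrArg (Data.cons .nil) ih

@[fun_prop]
theorem list_replicate {n : α → ℕ} (hn : PT n) : PT (fun a => List.replicate (n a) ()) :=
  of_enc (by simpa only [enc_replicate] using hn.toEnc)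

@[fun_prop]
theorem list_length {l : α → List β} (hl : PT l) : PT (fun a => (l a).length) := by
  have h := list_map (g := fun (_ : α) (_ : β) => ()) (by fun_prop) hl
  refine of_enc ((congrArg PT (funext fun a => ?_)).mp h.toEnc)
  rw [List.map_const', enc_replicate]

@[fun_prop]
theorem nat_add {m n : α → ℕ} (hm : PT m) (hn : PT n) : PT (fun a => m a + n a) := by
  have h := (list_append (list_replicate hm) (list_replicate hn)).list_length
  simpa using h

@[fun_prop]
theorem nat_pred {n : α → ℕ} (hn : PT n) : PT (fun a => n a - 1) :=
  of_enc ((congrArg PT (funext fun a => by cases n a <;> rfl)).mp (data_tl.comp hn.toEnc))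

/-- Numbers are coded in unary, so iterating `n a` times is a fold over a list no longer than the
code of `n a`. -/
theorem iterate {step : α → σ → σ} (hs : PT (fun p : α × σ => step p.1 p.2)) {n : α → ℕ}
    {init : α → σ} (hn : PT n) (hi : PT init) (B : Polynomial ℕ)
    (hB : ∀ a, ∀ i ≤ n a, esize ((step a)^[i] (init a)) ≤ B.eval (esize a)) :
    PT (fun a => (step a)^[n a] (init a)) := by
  have key : ∀ a (l : List Unit) s, l.foldl (fun s _ => step a s) s = (step a)^[l.length] s :=
    fun a l => by
      induction l with
      | nil => simp
      | cons x l ih => intro s; simp [ih]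
  have h := foldl (step := fun a s (_ : Unit) => step a s)
    (l := fun a => List.replicate (n a) ()) (init := init)
    (hs.comp (f := fun p : (α × σ) × Unit => p.1) (by fun_prop)) (by fun_prop) hi B
    (fun a l' hl' => by
      rw [key]
      exact hB a _ (by simpa using hl'.length_le))
  simpa only [key, List.length_replicate] using h

@[fun_prop]
theorem nat_sub {m n : α → ℕ} (hm : PT m) (hn : PT n) : PT (fun a => m a - n a) := by
  have key : ∀ n m : ℕ, (fun x => x - 1)^[n] m = m - n := fun n => by
    induction n with
    | zero => simp
    | succ n ih => intro m; rw [Function.iterate_succ_apply, ih]; omega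
  obtain ⟨q, hq⟩ := hm.esize_le
  have h := iterate (step := fun (_ : α) x => x - 1) (by fun_prop) hn hm q (fun a i _ => by
    rw [key]
    have := hq a
    rw [esize_nat] at this ⊢
    omega)
  simpa only [key] using h

@[fun_prop]
theorem nat_lt {m n : α → ℕ} (hm : PT m) (hn : PT n) : PT (fun a => decide (m a < n a)) := by
  have h := (decide_eq (nat_sub hn hm) (const 0)).not
  refine (congrArg PT (funext fun a => ?_)).mp h
  rw [Bool.eq_iff_iff]
  simp [Nat.sub_eq_zero_iff_le]

@[fun_prop]
theorem list_drop {n : α → ℕ} {l : α → List β} (hn : PT n) (hl : PT l) :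
    PT (fun a => (l a).drop (n a)) := by
  have key : ∀ (n : ℕ) (l : List β), List.tail^[n] l = l.drop n := fun n => by
    induction n with
    | zero => simp
    | succ n ih => intro m; rw [Function.iterate_succ_apply, ih]; cases m <;> simp
  obtain ⟨q, hq⟩ := hl.esize_le
  have h := iterate (step := fun (_ : α) (x : List β) => x.tail) (by fun_prop) hn hl q
    (fun a i _ => by
      rw [show (fun x : List β => x.tail) = List.tail from rfl, key]
      refine le_trans ?_ (hq a)
      have h1 := esize_append ((l a).take i) ((l a).drop i)
      rw [List.take_append_drop] at h1
      have := esize_pos ((l a).take i)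
      omega)
  simpa only [key] using h

@[fun_prop]
theorem list_getD {l : α → List β} {n : α → ℕ} {d : α → β} (hl : PT l) (hn : PT n) (hd : PT d) :
    PT (fun a => (l a).getD (n a) (d a)) := by
  refine (congrArg PT (funext fun a => ?_)).mp ((hn.list_drop hl).list_headD hd)
  simp

@[fun_prop]
theorem list_range {n : α → ℕ} (hn : PT n) : PT (fun a => List.range (n a)) := by
  have key : ∀ n : ℕ, (fun l : List ℕ => l ++ [l.length])^[n] [] = List.range n := fun n => by
    induction n with
    | zero => rfl
    | succ n ih => rw [Function.iterate_succ_apply', ih, List.range_succ, List.length_range]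
  obtain ⟨q, hq⟩ := hn.esize_le
  have h := iterate (step := fun (_ : α) (l : List ℕ) => l ++ [l.length]) (n := n)
    (init := fun _ => []) (by fun_prop) hn (by fun_prop) (q * (q + 1) + 1)
    (fun a i hi => by
      rw [key]
      have h1 := hq a
      rw [esize_nat] at h1
      have h2 := esize_list_le (List.range i) (N := q.eval (esize a)) (fun x hx => by
        rw [esize_nat]
        have := List.mem_range.1 hx
        omega)
      simp only [eval_add, eval_mul, eval_one]
      refine h2.trans (Nat.add_le_add_right (Nat.mul_le_mul_right _ ?_) 1)
      rw [List.length_range]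
      omega)
  simpa only [key] using h

/-- Increment of a little endian binary number. -/
def _root_.List.incBits : List Bool → List Bool
  | [] => [true]
  | false :: l => true :: l
  | true :: l => false :: l.incBits

theorem _root_.Nat.bits_succ (n : ℕ) : (n + 1).bits = n.bits.incBits := by
  induction n using Nat.strong_induction_on with
  | _ n ih =>
    rcases Nat.eq_zero_or_pos n with rfl | hn
    · rfl
    · rcases Nat.even_or_odd' n with ⟨m, rfl | rfl⟩
      · rw [Nat.bit0_bits m (by omega), Nat.bit1_bits]; rfl
      · rw [show 2 * m + 1 + 1 = 2 * (m + 1) by ring, Nat.bit0_bits _ (by omega), Nat.bit1_bits,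
          ih m (by omega)]
        rfl

/-- One digit of an increment; the state is the carry and the digits so far. -/
def incStep (s : Bool × List Bool) (b : Bool) : Bool × List Bool :=
  (s.1 && b, s.2 ++ [if s.1 = true then !b else b])

-- One pass from the low end with a carry; a carry that survives the pass becomes a new highest
-- digit.
@[fun_prop]
theorem list_incBits {l : α → List Bool} (hl : PT l) : PT (fun a => (l a).incBits) := by
  have key : ∀ (l : List Bool) (m : List Bool),
      ((l.foldl incStep (true, m)).2 ++ if (l.foldl incStep (true, m)).1 = true then [true] else [])
        = m ++ l.incBits ∧ (l.foldl incStep (false, m)) = (false, m ++ l) := fun l => by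
    induction l with
    | nil => simp [List.incBits]
    | cons b l ih =>
      intro m
      cases b
      · simp [incStep, List.incBits, (ih _).2]
      · simp [incStep, List.incBits, (ih _).1, (ih _).2]
  have hlen : ∀ (l : List Bool) s, (l.foldl incStep s).2.length = s.2.length + l.length :=
    fun l => by
      induction l with
      | nil => simp
      | cons b l ih => intro s; simp [ih, incStep]; omega
  obtain ⟨q, hq⟩ := hl.esize_le
  have h := foldl (step := fun (_ : α) s b => incStep s b) (l := l)
    (init := fun _ => (true, [])) (by unfold incStep; fun_prop) hl (by fun_prop) (4 * q + 5)
    (fun a l' hl' => by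
      generalize hs : l'.foldl (fun s b => incStep s b) (true, []) = s
      have h1 := hlen l' (true, [])
      rw [hs] at h1
      have h2 := esize_list_le s.2 (N := 3) fun x _ => esize_bool_le x
      have h3 := hl'.length_le
      have h4 := length_lt_esize (l a)
      have h5 := hq a
      have h6 := esize_bool_le s.1
      have h7 : esize s = _ := esize_pair s.1 s.2
      simp only [eval_add, eval_mul, eval_ofNat]
      simp at h1
      omega)
  have h' : PT (fun a => ((l a).foldl incStep (true, [])).2 ++
      if ((l a).foldl incStep (true, [])).1 = true then [true] else []) := by fun_prop
  simpa only [(key _ _).1, List.nil_append] using h'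

-- Counting up from zero with binary increments takes `n` rounds, which is affordable for a number
-- given in unary.
@[fun_prop]
theorem nat_bits {n : α → ℕ} (hn : PT n) : PT (fun a => (n a).bits) := by
  have key : ∀ n : ℕ, List.incBits^[n] [] = n.bits := fun n => by
    induction n with
    | zero => rfl
    | succ n ih => rw [Function.iterate_succ_apply', ih, Nat.bits_succ]
  have hlen : ∀ l : List Bool, l.incBits.length ≤ l.length + 1 := fun l => by
    induction l with
    | nil => simp [List.incBits]
    | cons b l ih => cases b <;> simp [List.incBits]; omega
  have hlen' : ∀ n : ℕ, (List.incBits^[n] []).length ≤ n := fun n => by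
    induction n with
    | zero => simp
    | succ n ih => rw [Function.iterate_succ_apply']; exact (hlen _).trans (by omega)
  obtain ⟨q, hq⟩ := hn.esize_le
  have h := iterate (step := fun (_ : α) (l : List Bool) => l.incBits) (n := n)
    (init := fun _ => []) (by fun_prop) hn (by fun_prop) (4 * q + 1) (fun a i hi => by
      have h1 := hlen' i
      have h2 := esize_list_le (List.incBits^[i] []) (N := 3) fun x _ => esize_bool_le x
      have h3 := hq a
      rw [esize_nat] at h3
      simp only [eval_add, eval_mul, eval_ofNat, eval_one]
      refine h2.trans ?_
      omega)
  simpa only [key] using h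

/-! #### Functions on finite types -/

/-- A lookup table, realised as nested tests for equality. In particular this gives the arithmetic
of a fixed `ZMod p`. -/
theorem of_finite [Finite α] (f : α → β) : PT f := by
  classical
  have := Fintype.ofFinite α
  rcases isEmpty_or_nonempty α with h | ⟨⟨a₀⟩⟩
  · exact ⟨0, .skip, fun a => h.elim a⟩
  · have key : ∀ L : List α, ∃ g : α → β, PT g ∧ ∀ a ∈ L, g a = f a := fun L => by
      induction L with
      | nil => exact ⟨fun _ => f a₀, const _, by simp⟩
      | cons b L ih =>
        obtain ⟨g, hg, h⟩ := ih
        refine ⟨fun a => if a = b then f b else g a, by fun_prop, fun a ha => ?_⟩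
        by_cases e : a = b
        · simp [e]
        · simp only [e, if_false]
          exact h a ((List.mem_cons.1 ha).resolve_left e)
    obtain ⟨g, hg, h⟩ := key Finset.univ.toList
    exact (funext fun a => h a (by simp) : g = f) ▸ hg

variable {p : ℕ} [NeZero p]

@[fun_prop]
theorem zmod_sub {f g : α → ZMod p} (hf : PT f) (hg : PT g) : PT (fun a => f a - g a) :=
  (of_finite (fun x : ZMod p × ZMod p => x.1 - x.2)).comp (hf.pair hg)

@[fun_prop]
theorem zmod_add {f g : α → ZMod p} (hf : PT f) (hg : PT g) : PT (fun a => f a + g a) :=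
  (of_finite (fun x : ZMod p × ZMod p => x.1 + x.2)).comp (hf.pair hg)

@[fun_prop]
theorem zmod_neg {f : α → ZMod p} (hf : PT f) : PT (fun a => - f a) :=
  (of_finite (fun x : ZMod p => - x)).comp hf

@[fun_prop]
theorem zmod_mul {f g : α → ZMod p} (hf : PT f) (hg : PT g) : PT (fun a => f a * g a) :=
  (of_finite (fun x : ZMod p × ZMod p => x.1 * x.2)).comp (hf.pair hg)

@[fun_prop]
theorem zmod_inv {f : α → ZMod p} (hf : PT f) : PT (fun a => (f a)⁻¹) :=
  (of_finite (fun x : ZMod p => x⁻¹)).comp hf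

end PT

theorem esize_zmod_le {p : ℕ} [NeZero p] (a : ZMod p) : esize a ≤ 2 * p := by
  have : esize a = esize a.val := rfl
  rw [this, esize_nat]
  have := a.val_lt
  omega

namespace PT

variable {α β γ δ σ : Type*} [Enc α] [Enc β] [Enc γ] [Enc δ] [Enc σ]

open Polynomial

@[fun_prop]
theorem list_replicate_const {n : α → ℕ} {b : α → β} (hn : PT n) (hb : PT b) :
    PT (fun a => List.replicate (n a) (b a)) := by
  have h : PT (fun a => (List.replicate (n a) ()).map (fun _ => b a)) := by fun_prop
  simpa using h

@[fun_prop]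
theorem zmod_sum {p : ℕ} [NeZero p] {l : α → List (ZMod p)} (hl : PT l) :
    PT (fun a => (l a).sum) := by
  have key : ∀ (l : List (ZMod p)) s, l.foldl (fun s x => s + x) s = s + l.sum := fun l => by
    induction l with
    | nil => simp
    | cons x l ih => intro s; simp [ih, add_assoc]
  have h := foldl (step := fun (_ : α) (s : ZMod p) x => s + x) (l := l) (init := fun _ => 0)
    (by fun_prop) hl (by fun_prop) (C (2 * p)) (fun a l' hl' => by
      rw [eval_C]; exact esize_zmod_le _)
  simpa only [key, zero_add] using h

end PT

/-! ### Greedy elimination of dependent rows -/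

section Elimination

variable {p : ℕ} {α γ : Type*}

/-- The position of the first nonzero entry of a row. -/
def pivot (b : List (ZMod p)) : ℕ :=
  ((List.range b.length).filter fun i => !decide (b.getD i 0 = 0)).headD 0

/-- Subtract the multiple of `b` from `r` that makes the entry at the pivot of `b` vanish. -/
def reduceRow (r b : List (ZMod p)) : List (ZMod p) :=
  (List.range r.length).map fun i =>
    r.getD i 0 - r.getD (pivot b) 0 * (b.getD (pivot b) 0)⁻¹ * b.getD i 0

/-- One step of the elimination; the state consists of the reduced rows and of the labels of the
rows that do not depend on the previous ones. -/
def elimStep (s : List (List (ZMod p)) × List γ) (x : List (ZMod p) × γ) :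
    List (List (ZMod p)) × List γ :=
  if (s.1.foldl reduceRow x.1).any (fun a => !decide (a = 0)) = true then
    (s.1 ++ [s.1.foldl reduceRow x.1], s.2 ++ [x.2]) else s

/-- The labels of the rows that do not depend on the previous ones. -/
def elim (l : List (List (ZMod p) × γ)) : List γ := (l.foldl elimStep ([], [])).2

theorem length_foldl_reduceRow (l : List (List (ZMod p))) (r : List (ZMod p)) :
    (l.foldl reduceRow r).length = r.length := by
  induction l generalizing r with
  | nil => rfl
  | cons b l ih => rw [List.foldl_cons, ih]; simp [reduceRow]

variable [NeZero p] [Enc α] [Enc γ]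

open Polynomial

/-- Entries come from a fixed finite ring, so the size of a row is governed by its length alone and
elimination causes no growth of coefficients. -/
theorem esize_row_le (r : List (ZMod p)) : esize r ≤ r.length * (2 * p + 1) + 1 :=
  esize_list_le r fun x _ => esize_zmod_le x

theorem PT.pivot {b : α → List (ZMod p)} (hb : PT b) : PT (fun a => pivot (b a)) := by
  unfold _root_.pivot; fun_prop

attribute [fun_prop] PT.pivot

theorem PT.reduceRow {r b : α → List (ZMod p)} (hr : PT r) (hb : PT b) :
    PT (fun a => reduceRow (r a) (b a)) := by
  unfold _root_.reduceRow; fun_prop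

attribute [fun_prop] PT.reduceRow

theorem PT.foldl_reduceRow {l : α → List (List (ZMod p))} {r : α → List (ZMod p)} (hl : PT l)
    (hr : PT r) : PT (fun a => (l a).foldl _root_.reduceRow (r a)) := by
  obtain ⟨q, hq⟩ := hr.esize_le
  refine PT.foldl (step := fun (_ : α) r b => _root_.reduceRow r b) (by fun_prop) hl hr
    (q * C (2 * p + 1) + 1) fun a l' _ => ?_
  refine (esize_row_le _).trans ?_
  rw [show (fun r b => _root_.reduceRow r b) = (_root_.reduceRow (p := p)) from rfl,
    length_foldl_reduceRow, eval_add, eval_mul, eval_C, eval_one]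
  exact Nat.add_le_add_right (Nat.mul_le_mul_right _ ((length_lt_esize _).le.trans (hq a))) 1

attribute [fun_prop] PT.foldl_reduceRow

theorem PT.elimStep {s : α → List (List (ZMod p)) × List γ} {x : α → List (ZMod p) × γ}
    (hs : PT s) (hx : PT x) : PT (fun a => elimStep (s a) (x a)) := by
  unfold _root_.elimStep; fun_prop

attribute [fun_prop] PT.elimStep

/-- A step adds at most one label and one reduced row, and reduction keeps the length of the row. -/
theorem esize_foldl_elimStep_le (l : List (List (ZMod p) × γ)) {N : ℕ}
    (hN : ∀ x ∈ l, esize x ≤ N) (s : List (List (ZMod p)) × List γ) :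
    esize (l.foldl elimStep s) ≤ esize s + l.length * (N * (2 * p + 1) + 2 + N + 1) := by
  induction l generalizing s with
  | nil => simp
  | cons x l ih =>
    rw [List.foldl_cons, List.length_cons, Nat.add_mul]
    have h1 := ih (fun y hy => hN y (List.mem_cons_of_mem _ hy)) (elimStep s x)
    have h2 : esize (elimStep s x) ≤ esize s + (N * (2 * p + 1) + 2 + N + 1) := by
      have hx := hN x List.mem_cons_self
      rw [← Prod.mk.eta (p := x), esize_pair] at hx
      have h3 := esize_row_le (s.1.foldl reduceRow x.1)
      rw [length_foldl_reduceRow] at h3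
      have h4 : x.1.length * (2 * p + 1) ≤ N * (2 * p + 1) :=
        Nat.mul_le_mul_right _ (by have := length_lt_esize x.1; omega)
      unfold elimStep
      split_ifs
      · rw [← Prod.mk.eta (p := s), esize_pair, esize_pair]
        have h5 := esize_append s.1 [s.1.foldl reduceRow x.1]
        have h6 := esize_append s.2 [x.2]
        rw [esize_cons, esize_nil] at h5 h6
        dsimp only
        omega
      · omega
    omega

theorem PT.elim {l : α → List (List (ZMod p) × γ)} (hl : PT l) : PT (fun a => elim (l a)) := by
  obtain ⟨q, hq⟩ := hl.esize_le
  refine PT.snd (PT.foldl (step := fun (_ : α) s x => _root_.elimStep s x)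
    (init := fun _ => ([], [])) (by fun_prop) hl (by fun_prop)
    (3 + q * (q * C (2 * p + 1) + 2 + q + 1)) fun a l' hl' => ?_)
  refine (esize_foldl_elimStep_le l' (N := q.eval (esize a)) (fun x hx => ?_) _).trans ?_
  · exact (esize_lt_of_mem (hl'.subset hx)).le.trans (hq a)
  · simp only [eval_add, eval_mul, eval_C, eval_ofNat, eval_one]
    refine Nat.add_le_add le_rfl (Nat.mul_le_mul_right _ ?_)
    exact hl'.length_le.trans ((length_lt_esize _).le.trans (hq a))

attribute [fun_prop] PT.elim

end Elimination

/-! ### Coding of instances -/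

/-- The data of an instance: the number of vertices, the vertices of the cover, the edges. -/
abbrev InstData : Type := ℕ × List ℕ × List (ℕ × ℕ)

/-- The bit string that lists the data of an instance. -/
def encodeInst (I : InstData) : List Bool :=
  List.replicate I.1 true ++ [false] ++ listCode natCode I.2.1 ++
    listCode (fun e : ℕ × ℕ => natCode e.1 ++ natCode e.2) I.2.2

/-- The state of the parser: a mode, the number of vertices, the number that is being read, the
first end of the edge that is being read, the vertices of the cover, the edges. -/
abbrev ParseState : Type :=
  ℕ × ℕ × (List Bool × List Bool) × List (List Bool) × List (List Bool × List Bool)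

/-- One step of the parser. -/
def parseStep : ParseState → Bool → ParseState
  | (mode, n, (cur, first), cs, es), b =>
    if mode = 0 then (if b = true then (0, n + 1, (cur, first), cs, es)
      else (1, n, (cur, first), cs, es)) else
    if mode = 1 then (if b = true then (2, n, (cur, first), cs, es)
      else (4, n, (cur, first), cs, es)) else
    if mode = 2 then (if b = true then (3, n, (cur, first), cs, es)
      else (1, n, ([], first), cs ++ [cur], es)) else
    if mode = 3 then (2, n, (cur ++ [b], first), cs, es) else
    if mode = 4 then (if b = true then (5, n, (cur, first), cs, es)
      else (9, n, (cur, first), cs, es)) else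
    if mode = 5 then (if b = true then (6, n, (cur, first), cs, es)
      else (7, n, ([], cur), cs, es)) else
    if mode = 6 then (5, n, (cur ++ [b], first), cs, es) else
    if mode = 7 then (if b = true then (8, n, (cur, first), cs, es)
      else (4, n, ([], []), cs, es ++ [(first, cur)])) else
    if mode = 8 then (7, n, (cur ++ [b], first), cs, es) else
    (mode, n, (cur, first), cs, es)

/-- Read the data of an instance, the vertices being given by their digits. -/
def parse (x : List Bool) : ParseState := x.foldl parseStep (0, 0, ([], []), [], [])

/-- The number below `n` with the given digits. -/
def lookupBits (n : ℕ) (bs : List Bool) : ℕ :=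
  ((List.range n).filter fun i => decide (i.bits = bs)).headD 0

/-- The data of the instance that a bit string encodes. -/
def decodeInst (x : List Bool) : InstData :=
  ((parse x).2.1, (parse x).2.2.2.1.map (lookupBits (parse x).2.1),
    (parse x).2.2.2.2.map fun e => (lookupBits (parse x).2.1 e.1, lookupBits (parse x).2.1 e.2))

/-- Whether a list has no repeated entries. -/
def nodupTest (c : List ℕ) : Bool :=
  (List.range c.length).all fun i => !decide (c.getD i 0 ∈ c.drop (i + 1))

/-- Whether the data are those of a graph with a vertex cover of size `k`. -/
def isValid (k : ℕ) (I : InstData) : Bool :=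
  decide (I.2.1.length = k) && I.2.1.all (fun v => decide (v < I.1)) && nodupTest I.2.1 &&
    I.2.2.all fun e => decide (e.1 < I.1) && decide (e.2 < I.1) && !decide (e.1 = e.2) &&
      (decide (e.1 ∈ I.2.1) || decide (e.2 ∈ I.2.1))

/-! ### The kernel -/

/-- Whether two vertices are adjacent. -/
def adjTest (es : List (ℕ × ℕ)) (u v : ℕ) : Bool := decide ((u, v) ∈ es) || decide ((v, u) ∈ es)

/-- All tuples of the given length of numbers below `k`. -/
def tuples (k : ℕ) : ℕ → List (List ℕ)
  | 0 => [[]]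
  | j + 1 => (List.range k).flatMap fun i => (tuples k j).map fun T => i :: T

/-- The neighbours in the cover, by their positions, of the vertices outside of the cover. -/
def outerNeighbors (k : ℕ) (I : InstData) : List (List ℕ) :=
  ((List.range I.1).filter fun v => !decide (v ∈ I.2.1)).map fun v =>
    (List.range k).filter fun i => adjTest I.2.2 (I.2.1.getD i 0) v

/-- The edges within the cover, by positions. -/
def innerEdges (k : ℕ) (I : InstData) : List (ℕ × ℕ) :=
  ((List.range k).flatMap fun i => (List.range k).map fun j => (i, j)).filter fun e =>
    adjTest I.2.2 (I.2.1.getD e.1 0) (I.2.1.getD e.2 0)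

/-- The tuples of a given length that are contained in one of the given lists. -/
def starTuples (k j : ℕ) (Ns : List (List ℕ)) : List (List ℕ) :=
  (tuples k j).filter fun T => Ns.any fun N => T.all fun i => decide (i ∈ N)

/-- The signed faces of a tuple of length `j`. -/
def faces (p : ℕ) : ℕ → List ℕ → List (ZMod p × List ℕ)
  | 0, _ => []
  | j + 1, S => (1, S.tail) :: (faces p j S.tail).map fun x => (-x.1, S.headD 0 :: x.2)

/-- The boundary of a tuple of length `m + 1`. -/
def starRow (p k m : ℕ) (S : List ℕ) : List (ZMod p) :=
  (tuples k m).map fun T => ((faces p (m + 1) S).map fun x => if x.2 = T then x.1 else 0).sum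

/-- The row of an edge. -/
def edgeRow (p k : ℕ) (e : ℕ × ℕ) : List (ZMod p) :=
  (List.range k).map fun t => (if e.1 = t then 1 else 0) + (if e.2 = t then 1 else 0)

/-- The stars that the kernel keeps. -/
def keptStars (p : ℕ) [NeZero p] (m k : ℕ) (Ns : List (List ℕ)) : List (List ℕ) :=
  starTuples k m Ns ++ elim ((starTuples k (m + 1) Ns).map fun S => (starRow p k m S, S))

/-- The edges that the kernel keeps if `thin` holds. -/
def thinEdges (p : ℕ) [NeZero p] (thin : Bool) (k : ℕ) (E : List (ℕ × ℕ)) : List (ℕ × ℕ) :=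
  if thin = true then elim (E.map fun e => (edgeRow p k e, e)) else E

/-- The graph with the vertices below `k`, the given edges, and a new vertex for every star. -/
def starGraph (k : ℕ) (E : List (ℕ × ℕ)) (stars : List (List ℕ)) : InstData :=
  (k + stars.length, List.range k,
    E ++ (List.range stars.length).flatMap fun j => (stars.getD j []).map fun i => (i, k + j))

/-- The kernel of an instance. -/
def kernelInst (p : ℕ) [NeZero p] (m : ℕ) (thin : Bool) (k : ℕ) (I : InstData) : InstData :=
  starGraph k (thinEdges p thin k (innerEdges k I)) (keptStars p m k (outerNeighbors k I))

/-- The kernel map, with a fixed value for the bit strings that do not encode an instance. -/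
def kernelMap (p : ℕ) [NeZero p] (m : ℕ) (thin : Bool) (no : List Bool × ℕ)
    (x : List Bool × ℕ) : List Bool × ℕ :=
  if (decide (encodeInst (decodeInst x.1) = x.1) && isValid x.2 (decodeInst x.1)) = true then
    (encodeInst (kernelInst p m thin x.2 (decodeInst x.1)), x.2) else no

/-- The kernel map for graphs without edges. -/
def edgelessMap (empty single no : List Bool × ℕ) (x : List Bool × ℕ) : List Bool × ℕ :=
  if (decide (encodeInst (decodeInst x.1) = x.1) && isValid x.2 (decodeInst x.1) &&
    (decodeInst x.1).2.2.isEmpty) = true then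
    (if (decodeInst x.1).1 = 0 then empty else single) else no

namespace PT

open Polynomial

variable {α : Type*} [Enc α]

@[fun_prop]
theorem natCode {n : α → ℕ} (hn : PT n) : PT (fun a => natCode (n a)) := by
  unfold _root_.natCode; fun_prop

@[fun_prop]
theorem encodeInst {I : α → InstData} (hI : PT I) : PT (fun a => encodeInst (I a)) := by
  unfold _root_.encodeInst _root_.listCode; fun_prop

theorem parseStep : PT (fun s : ParseState × Bool => parseStep s.1 s.2) := by
  unfold _root_.parseStep; fun_prop

/-- The parser moves data between its registers without duplicating them, so a step adds only a
constant to the size. -/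
theorem esize_parseStep_le (s : ParseState) (b : Bool) :
    esize (_root_.parseStep s b).2 ≤ esize s.2 + 4 ∧
      ((_root_.parseStep s b).1 ≤ 9 ∨ (_root_.parseStep s b).1 = s.1) := by
  obtain ⟨mode, n, ⟨cur, first⟩, cs, es⟩ := s
  have hb := esize_bool_le b
  have h1 := esize_append cur [b]
  have h2 := esize_append cs [cur]
  have h3 := esize_append es [(first, cur)]
  have h4 := esize_pos first
  simp only [esize_cons, esize_nil, esize_pair] at h1 h2 h3
  unfold _root_.parseStep
  dsimp only
  split_ifs <;> simp only [esize_pair, esize_nat, esize_nil] <;> refine ⟨by omega, by simp⟩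

theorem esize_foldl_parseStep_le (l : List Bool) (s : ParseState) (hs : s.1 ≤ 9) :
    (l.foldl _root_.parseStep s).1 ≤ 9 ∧
      esize (l.foldl _root_.parseStep s).2 ≤ esize s.2 + 4 * l.length := by
  induction l generalizing s with
  | nil => exact ⟨hs, le_rfl⟩
  | cons b l ih =>
    have h1 := esize_parseStep_le s b
    have h2 := ih (_root_.parseStep s b) (by omega)
    rw [List.foldl_cons, List.length_cons]
    omega

theorem esize_foldl_parseStep_init (l : List Bool) :
    esize (l.foldl _root_.parseStep (0, 0, ([], []), [], [])) ≤ 4 * l.length + 40 := by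
  have h1 := esize_foldl_parseStep_le l (0, 0, ([], []), [], []) (Nat.zero_le _)
  generalize l.foldl _root_.parseStep (0, 0, ([], []), [], []) = s at *
  obtain ⟨mode, s⟩ := s
  rw [esize_pair, esize_nat]
  simp only [esize_pair, esize_nat, esize_nil] at h1
  omega

theorem parse {x : α → List Bool} (hx : PT x) : PT (fun a => parse (x a)) := by
  obtain ⟨q, hq⟩ := hx.esize_le
  unfold _root_.parse
  refine PT.foldl (step := fun (_ : α) => _root_.parseStep) (parseStep.comp
    (f := fun p : (α × ParseState) × Bool => (p.1.2, p.2)) (by fun_prop)) hx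
    (const _) (4 * q + 40) fun a l' hl' => (esize_foldl_parseStep_init l').trans ?_
  have h2 := hl'.length_le
  have h3 := length_lt_esize (x a)
  have h4 := hq a
  simp only [eval_add, eval_mul, eval_ofNat]
  omega

attribute [fun_prop] PT.parse

@[fun_prop]
theorem lookupBits {n : α → ℕ} {b : α → List Bool} (hn : PT n) (hb : PT b) :
    PT (fun a => lookupBits (n a) (b a)) := by
  unfold _root_.lookupBits; fun_prop

@[fun_prop]
theorem decodeInst {x : α → List Bool} (hx : PT x) : PT (fun a => decodeInst (x a)) := by
  unfold _root_.decodeInst; fun_prop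

@[fun_prop]
theorem isValid {k : α → ℕ} {I : α → InstData} (hk : PT k) (hI : PT I) :
    PT (fun a => isValid (k a) (I a)) := by
  unfold _root_.isValid _root_.nodupTest; fun_prop

@[fun_prop]
theorem adjTest {es : α → List (ℕ × ℕ)} {u v : α → ℕ} (he : PT es) (hu : PT u) (hv : PT v) :
    PT (fun a => adjTest (es a) (u a) (v a)) := by
  unfold _root_.adjTest; fun_prop

-- The length `j` is fixed, so the `k ^ j` tuples are polynomially many.
@[fun_prop]
theorem tuples {k : α → ℕ} (hk : PT k) (j : ℕ) : PT (fun a => tuples (k a) j) := by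
  refine comp (f := k) (g := fun k => _root_.tuples k j) ?_ hk
  induction j with
  | zero => exact const _
  | succ j ih =>
    have h : PT (fun p : ℕ × ℕ => _root_.tuples p.1 j) := ih.comp (by fun_prop)
    exact list_flatMap (list_map (g := fun (p : ℕ × ℕ) T => p.2 :: T) (by fun_prop) h) (by fun_prop)

@[fun_prop]
theorem outerNeighbors {k : α → ℕ} {I : α → InstData} (hk : PT k) (hI : PT I) :
    PT (fun a => outerNeighbors (k a) (I a)) := by
  unfold _root_.outerNeighbors; fun_prop

@[fun_prop]
theorem innerEdges {k : α → ℕ} {I : α → InstData} (hk : PT k) (hI : PT I) :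
    PT (fun a => innerEdges (k a) (I a)) := by
  unfold _root_.innerEdges; fun_prop

@[fun_prop]
theorem starTuples {k : α → ℕ} {N : α → List (List ℕ)} (hk : PT k) (j : ℕ) (hN : PT N) :
    PT (fun a => starTuples (k a) j (N a)) := by
  unfold _root_.starTuples; fun_prop

variable {p : ℕ} [NeZero p]

@[fun_prop]
theorem faces {S : α → List ℕ} (j : ℕ) (hS : PT S) : PT (fun a => faces p j (S a)) := by
  induction j generalizing S with
  | zero => exact const _
  | succ j ih =>
    unfold _root_.faces
    have := ih (hS.list_tail)
    fun_prop

@[fun_prop]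
theorem starRow {k : α → ℕ} {S : α → List ℕ} (hk : PT k) (m : ℕ) (hS : PT S) :
    PT (fun a => starRow p (k a) m (S a)) := by
  unfold _root_.starRow; fun_prop

@[fun_prop]
theorem edgeRow {k : α → ℕ} {e : α → ℕ × ℕ} (hk : PT k) (he : PT e) :
    PT (fun a => edgeRow p (k a) (e a)) := by
  unfold _root_.edgeRow; fun_prop

@[fun_prop]
theorem keptStars {k : α → ℕ} {N : α → List (List ℕ)} (m : ℕ) (hk : PT k) (hN : PT N) :
    PT (fun a => keptStars p m (k a) (N a)) := by
  unfold _root_.keptStars; fun_prop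

@[fun_prop]
theorem thinEdges {k : α → ℕ} {E : α → List (ℕ × ℕ)} (thin : Bool) (hk : PT k) (hE : PT E) :
    PT (fun a => thinEdges p thin (k a) (E a)) := by
  unfold _root_.thinEdges; fun_prop

@[fun_prop]
theorem starGraph {k : α → ℕ} {E : α → List (ℕ × ℕ)} {stars : α → List (List ℕ)} (hk : PT k)
    (hE : PT E) (hs : PT stars) : PT (fun a => starGraph (k a) (E a) (stars a)) := by
  unfold _root_.starGraph; fun_prop

theorem kernelMap (m : ℕ) (thin : Bool) (no : List Bool × ℕ) : PT (kernelMap p m thin no) := by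
  unfold _root_.kernelMap kernelInst; fun_prop

theorem edgelessMap (empty single no : List Bool × ℕ) : PT (edgelessMap empty single no) := by
  unfold _root_.edgelessMap; fun_prop

end PT

/-! ### Correctness of the elimination -/

section ElimSpec

variable {p : ℕ}

theorem getD_map_range {α : Type*} (f : ℕ → α) (d : α) {n i : ℕ} (hi : i < n) :
    ((List.range n).map f).getD i d = f i := by
  simp [hi]

theorem length_reduceRow (r b : List (ZMod p)) : (reduceRow r b).length = r.length := by
  simp [reduceRow]

variable [Fact p.Prime] {K : Type*} [Field K] (φ : ZMod p →+* K) {γ : Type*}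

/-- The value of a row under an assignment of values to the columns. -/
def rowEval (μ : ℕ → K) (r : List (ZMod p)) : K :=
  ∑ i ∈ Finset.range r.length, φ (r.getD i 0) * μ i

theorem getD_reduceRow {r b : List (ZMod p)} (h : r.length = b.length) (i : ℕ) :
    (reduceRow r b).getD i 0 =
      r.getD i 0 - r.getD (pivot b) 0 * (b.getD (pivot b) 0)⁻¹ * b.getD i 0 := by
  by_cases hi : i < r.length
  · rw [reduceRow, getD_map_range _ _ hi]
  · have h1 : r.getD i 0 = 0 := List.getD_eq_default _ _ (by omega)
    have h2 : b.getD i 0 = 0 := List.getD_eq_default _ _ (by omega)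
    rw [List.getD_eq_default _ _ (by rw [length_reduceRow]; omega), h1, h2]
    simp

theorem rowEval_reduceRow (μ : ℕ → K) {r b : List (ZMod p)} (h : r.length = b.length) :
    rowEval φ μ (reduceRow r b) =
      rowEval φ μ r - φ (r.getD (pivot b) 0 * (b.getD (pivot b) 0)⁻¹) * rowEval φ μ b := by
  simp only [rowEval, length_reduceRow, getD_reduceRow h, ← h, Finset.mul_sum,
    ← Finset.sum_sub_distrib]
  refine Finset.sum_congr rfl fun i _ => ?_
  rw [map_sub, map_mul _ (_ * _)]
  ring

theorem pivot_spec {b : List (ZMod p)} (h : ∃ a ∈ b, a ≠ 0) :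
    pivot b < b.length ∧ b.getD (pivot b) 0 ≠ 0 := by
  obtain ⟨a, ha, hne⟩ := h
  obtain ⟨i, hi, rfl⟩ := List.mem_iff_getElem.1 ha
  have hmem : i ∈ (List.range b.length).filter fun i => !decide (b.getD i 0 = 0) := by
    simp [hi, hne]
  have hp : pivot b ∈ (List.range b.length).filter fun i => !decide (b.getD i 0 = 0) := by
    unfold pivot
    generalize (List.range b.length).filter (fun i => !decide (b.getD i 0 = 0)) = l at hmem
    cases l with
    | nil => simp at hmem
    | cons x l => simp
  rw [List.mem_filter] at hp
  exact ⟨List.mem_range.1 hp.1, by simpa using hp.2⟩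

/-- Each later row vanishes at the pivots of the earlier ones, so a reduction does not disturb the
zeros already made. Assignments that kill all the rows in `bs` do not notice the reduction. -/
theorem foldl_reduceRow_spec {M : ℕ} (bs : List (List (ZMod p)))
    (hbs : ∀ b ∈ bs, b.length = M ∧ b.getD (pivot b) 0 ≠ 0)
    (hp : bs.Pairwise fun b b' => b'.getD (pivot b) 0 = 0) {r : List (ZMod p)}
    (hr : r.length = M) :
    (∀ b ∈ bs, (bs.foldl reduceRow r).getD (pivot b) 0 = 0) ∧
      ∀ μ : ℕ → K, (∀ b ∈ bs, rowEval φ μ b = 0) →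
        rowEval φ μ (bs.foldl reduceRow r) = rowEval φ μ r := by
  induction bs using List.reverseRecOn with
  | nil => simp
  | append_singleton bs b ih =>
    rw [List.pairwise_append] at hp
    obtain ⟨ih1, ih2⟩ := ih (fun c hc => hbs c (by simp [hc])) hp.1
    obtain ⟨hb1, hb2⟩ := hbs b (by simp)
    have hlen : (bs.foldl reduceRow r).length = b.length := by
      rw [length_foldl_reduceRow, hr, hb1]
    rw [List.foldl_append, List.foldl_cons, List.foldl_nil]
    refine ⟨fun c hc => ?_, fun μ hμ => ?_⟩
    · rw [getD_reduceRow hlen]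
      rcases List.mem_append.1 hc with hc | hc
      · rw [ih1 c hc, hp.2.2 c hc b (by simp)]; simp
      · rw [List.mem_singleton.1 hc, inv_mul_cancel_right₀ hb2, sub_self]
    · rw [rowEval_reduceRow φ μ hlen, hμ b (by simp), mul_zero, sub_zero,
        ih2 μ fun c hc => hμ c (by simp [hc])]

/-- The invariants of the echelon form. The span of the kept rows appears in dual form: an
assignment that kills them kills all rows seen so far. It takes values in `K`, while the elimination
takes place over `ZMod p`. -/
theorem foldl_elimStep_spec {M : ℕ} (ρ : γ → List (ZMod p)) (l : List γ)
    (hρ : ∀ x ∈ l, (ρ x).length = M) {s : List (List (ZMod p)) × List γ}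
    (hs : s = (l.map fun x => (ρ x, x)).foldl elimStep ([], [])) :
    (∀ b ∈ s.1, b.length = M ∧ b.getD (pivot b) 0 ≠ 0) ∧
      (∀ b ∈ s.1, pivot b < M) ∧
      (s.1.Pairwise fun b b' => b'.getD (pivot b) 0 = 0) ∧
      s.1.length = s.2.length ∧ (∀ x ∈ s.2, x ∈ l) ∧
      ∀ μ : ℕ → K, (∀ x ∈ s.2, rowEval φ μ (ρ x) = 0) →
        (∀ b ∈ s.1, rowEval φ μ b = 0) ∧ ∀ x ∈ l, rowEval φ μ (ρ x) = 0 := by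
  induction l using List.reverseRecOn generalizing s with
  | nil => subst hs; simp
  | append_singleton l x ih =>
    rw [List.map_append, List.foldl_append] at hs
    obtain ⟨h1, h2, h3, h4, h5, h6⟩ := ih (fun y hy => hρ y (by simp [hy])) rfl
    generalize (l.map fun x => (ρ x, x)).foldl elimStep ([], []) = t at *
    have hx := hρ x (by simp)
    obtain ⟨r1, r2⟩ := foldl_reduceRow_spec φ t.1 h1 h3 hx
    have r3 := length_foldl_reduceRow t.1 (ρ x)
    rw [hx] at r3
    simp only [List.map_cons, List.map_nil, List.foldl_cons, List.foldl_nil, elimStep] at hs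
    generalize t.1.foldl reduceRow (ρ x) = r at *
    split_ifs at hs with hr
    · have hr' : ∃ a ∈ r, a ≠ 0 := by simpa using hr
      obtain ⟨p1, p2⟩ := pivot_spec hr'
      subst hs
      refine ⟨?_, ?_, ?_, by simp [h4], ?_, ?_⟩
      · simp only [List.mem_append, List.mem_singleton]
        rintro b (hb | rfl)
        exacts [h1 b hb, ⟨r3, p2⟩]
      · simp only [List.mem_append, List.mem_singleton]
        rintro b (hb | rfl)
        exacts [h2 b hb, r3 ▸ p1]
      · rw [List.pairwise_append]
        refine ⟨h3, List.pairwise_singleton _ _, fun b hb c hc => ?_⟩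
        rw [List.mem_singleton.1 hc]
        exact r1 b hb
      · simp only [List.mem_append, List.mem_singleton]
        rintro y (hy | rfl)
        exacts [Or.inl (h5 y hy), Or.inr rfl]
      · intro μ hμ
        obtain ⟨q1, q2⟩ := h6 μ fun y hy => hμ y (by simp [hy])
        have q3 := hμ x (by simp)
        refine ⟨?_, ?_⟩
        · simp only [List.mem_append, List.mem_singleton]
          rintro b (hb | rfl)
          exacts [q1 b hb, (r2 μ q1).trans q3]
        · simp only [List.mem_append, List.mem_singleton]
          rintro y (hy | rfl)
          exacts [q2 y hy, q3]
    · have hr' : ∀ a ∈ r, a = 0 := by simpa using hr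
      subst hs
      refine ⟨h1, h2, h3, h4, fun y hy => by simp [h5 y hy], fun μ hμ => ?_⟩
      obtain ⟨q1, q2⟩ := h6 μ hμ
      refine ⟨q1, ?_⟩
      simp only [List.mem_append, List.mem_singleton]
      rintro y (hy | rfl)
      · exact q2 y hy
      · rw [← r2 μ q1, rowEval]
        refine Finset.sum_eq_zero fun i hi => ?_
        have hi' := Finset.mem_range.1 hi
        rw [hr' (r.getD i 0) (by rw [List.getD_eq_getElem _ _ hi']; exact List.getElem_mem _),
          map_zero, zero_mul]

/-- The reduced rows have distinct pivots: a row is nonzero at its own pivot and zero at the earlier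
ones. Hence there are no more of them than columns. -/
theorem length_elim_le {M : ℕ} (ρ : γ → List (ZMod p)) (l : List γ)
    (hρ : ∀ x ∈ l, (ρ x).length = M) : (elim (l.map fun x => (ρ x, x))).length ≤ M := by
  obtain ⟨h1, h2, h3, h4, -, -⟩ := foldl_elimStep_spec (RingHom.id (ZMod p)) ρ l hρ rfl
  rw [elim, ← h4]
  generalize (l.map fun x => (ρ x, x)).foldl elimStep ([], []) = t at *
  have hnd : (t.1.map pivot).Nodup := by
    rw [List.Nodup, List.pairwise_map]
    refine h3.imp_of_mem fun {b c} _ hc h e => (h1 c hc).2 ?_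
    rw [← e]; exact h
  have := (hnd.subperm (l₂ := List.range M) fun i hi => by
    obtain ⟨b, hb, rfl⟩ := List.mem_map.1 hi
    exact List.mem_range.2 (h2 b hb)).length_le
  simpa using this

theorem mem_of_mem_elim {M : ℕ} (ρ : γ → List (ZMod p)) (l : List γ)
    (hρ : ∀ x ∈ l, (ρ x).length = M) : ∀ x ∈ elim (l.map fun x => (ρ x, x)), x ∈ l :=
  (foldl_elimStep_spec (RingHom.id (ZMod p)) ρ l hρ rfl).2.2.2.2.1

theorem rowEval_eq_zero_of_elim {M : ℕ} (ρ : γ → List (ZMod p)) (l : List γ)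
    (hρ : ∀ x ∈ l, (ρ x).length = M) (μ : ℕ → K)
    (h : ∀ x ∈ elim (l.map fun x => (ρ x, x)), rowEval φ μ (ρ x) = 0) :
    ∀ x ∈ l, rowEval φ μ (ρ x) = 0 :=
  ((foldl_elimStep_spec φ ρ l hρ rfl).2.2.2.2.2 μ h).2

end ElimSpec

/-! ### Correctness of the coding -/

theorem foldl_parseStep_replicate (m n : ℕ) (c : List Bool × List Bool) (cs : List (List Bool))
    (es : List (List Bool × List Bool)) :
    (List.replicate m true).foldl parseStep (0, n, c, cs, es) = (0, n + m, c, cs, es) := by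
  induction m generalizing n with
  | zero => rfl
  | succ m ih =>
    rw [List.replicate_succ, List.foldl_cons]
    change (List.replicate m true).foldl parseStep (0, n + 1, c, cs, es) = _
    rw [ih]
    congr 2
    ring

theorem foldl_parseStep_bits_two (b : List Bool) (n : ℕ) (cur first : List Bool)
    (cs : List (List Bool)) (es : List (List Bool × List Bool)) :
    (b.flatMap fun b => [true, b]).foldl parseStep (2, n, (cur, first), cs, es) =
      (2, n, (cur ++ b, first), cs, es) := by
  induction b generalizing cur with
  | nil => simp
  | cons a b ih =>
    rw [List.flatMap_cons, List.foldl_append]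
    change (b.flatMap fun b => [true, b]).foldl parseStep (2, n, (cur ++ [a], first), cs, es) = _
    rw [ih]; simp

theorem foldl_parseStep_bits_five (b : List Bool) (n : ℕ) (cur first : List Bool)
    (cs : List (List Bool)) (es : List (List Bool × List Bool)) :
    (b.flatMap fun b => [true, b]).foldl parseStep (5, n, (cur, first), cs, es) =
      (5, n, (cur ++ b, first), cs, es) := by
  induction b generalizing cur with
  | nil => simp
  | cons a b ih =>
    rw [List.flatMap_cons, List.foldl_append]
    change (b.flatMap fun b => [true, b]).foldl parseStep (5, n, (cur ++ [a], first), cs, es) = _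
    rw [ih]; simp

theorem foldl_parseStep_bits_seven (b : List Bool) (n : ℕ) (cur first : List Bool)
    (cs : List (List Bool)) (es : List (List Bool × List Bool)) :
    (b.flatMap fun b => [true, b]).foldl parseStep (7, n, (cur, first), cs, es) =
      (7, n, (cur ++ b, first), cs, es) := by
  induction b generalizing cur with
  | nil => simp
  | cons a b ih =>
    rw [List.flatMap_cons, List.foldl_append]
    change (b.flatMap fun b => [true, b]).foldl parseStep (7, n, (cur ++ [a], first), cs, es) = _
    rw [ih]; simp

theorem foldl_parseStep_vertex (v n : ℕ) (cs : List (List Bool))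
    (es : List (List Bool × List Bool)) :
    (true :: natCode v).foldl parseStep (1, n, ([], []), cs, es) =
      (1, n, ([], []), cs ++ [v.bits], es) := by
  unfold natCode
  rw [List.foldl_cons, List.foldl_append]
  change List.foldl parseStep ((v.bits.flatMap fun b => [true, b]).foldl parseStep
    (2, n, ([], []), cs, es)) [false] = _
  rw [foldl_parseStep_bits_two]
  rfl

theorem foldl_parseStep_cover (c : List ℕ) (n : ℕ) (cs : List (List Bool))
    (es : List (List Bool × List Bool)) :
    (listCode natCode c).foldl parseStep (1, n, ([], []), cs, es) =
      (4, n, ([], []), cs ++ c.map Nat.bits, es) := by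
  unfold listCode
  rw [List.foldl_append]
  induction c generalizing cs with
  | nil => simp [parseStep]
  | cons v c ih =>
    rw [List.flatMap_cons, List.foldl_append, foldl_parseStep_vertex, ih]
    simp

theorem foldl_parseStep_edge (u v n : ℕ) (cs : List (List Bool))
    (es : List (List Bool × List Bool)) :
    (true :: (natCode u ++ natCode v)).foldl parseStep (4, n, ([], []), cs, es) =
      (4, n, ([], []), cs, es ++ [(u.bits, v.bits)]) := by
  unfold natCode
  rw [List.foldl_cons, List.foldl_append, List.foldl_append, List.foldl_append]
  change List.foldl parseStep (List.foldl parseStep (List.foldl parseStep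
    ((u.bits.flatMap fun b => [true, b]).foldl parseStep (5, n, ([], []), cs, es)) [false]) _)
    [false] = _
  rw [foldl_parseStep_bits_five]
  change List.foldl parseStep ((v.bits.flatMap fun b => [true, b]).foldl parseStep
    (7, n, ([], u.bits), cs, es)) [false] = _
  rw [foldl_parseStep_bits_seven]
  rfl

theorem foldl_parseStep_edges (l : List (ℕ × ℕ)) (n : ℕ) (cs : List (List Bool))
    (es : List (List Bool × List Bool)) :
    (listCode (fun e : ℕ × ℕ => natCode e.1 ++ natCode e.2) l).foldl parseStep
      (4, n, ([], []), cs, es) =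
      (9, n, ([], []), cs, es ++ l.map fun e => (e.1.bits, e.2.bits)) := by
  unfold listCode
  rw [List.foldl_append]
  induction l generalizing es with
  | nil => simp [parseStep]
  | cons e l ih =>
    rw [List.flatMap_cons, List.foldl_append, foldl_parseStep_edge, ih]
    simp

/-- The parser reads the three blocks in modes `0`, `1` to `3`, and `4` to `8`; mode `9` marks the
end. -/
theorem parse_encodeInst (I : InstData) :
    parse (encodeInst I) = (9, I.1, ([], []), I.2.1.map Nat.bits,
      I.2.2.map fun e => (e.1.bits, e.2.bits)) := by
  unfold parse encodeInst
  rw [List.foldl_append, List.foldl_append, List.foldl_append, foldl_parseStep_replicate]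
  change List.foldl parseStep (List.foldl parseStep (1, 0 + I.1, ([], []), [], []) _) _ = _
  rw [foldl_parseStep_cover, foldl_parseStep_edges]
  simp

theorem Nat.bits_injective : Function.Injective Nat.bits := fun m => by
  induction m using Nat.binaryRec' with
  | zero =>
    intro n h
    by_contra hn
    rw [← Nat.bit_bodd_div2 n, Nat.bits_append_bit _ _ (by
      intro h0; by_contra hb; apply hn; rw [← Nat.bit_bodd_div2 n, h0]; simp at hb; simp [hb])] at h
    simp at h
  | bit b m hm ih =>
    intro n h
    rw [Nat.bits_append_bit _ _ hm] at h
    by_cases hn : n = 0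
    · subst hn; simp at h
    · have hn' : n.div2 = 0 → n.bodd = true := by
        intro h0; by_contra hb; apply hn; rw [← Nat.bit_bodd_div2 n, h0]; simp at hb; simp [hb]
      rw [← Nat.bit_bodd_div2 n, Nat.bits_append_bit _ _ hn', List.cons.injEq] at h
      rw [← Nat.bit_bodd_div2 n, h.1, ih h.2]

theorem lookupBits_bits {n v : ℕ} (h : v < n) : lookupBits n v.bits = v := by
  have : (List.range n).filter (fun i => decide (i.bits = v.bits)) = [v] := by
    have e : (fun i : ℕ => decide (i.bits = v.bits)) = fun i => i == v := by
      funext i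
      rw [Bool.eq_iff_iff]
      simp [Nat.bits_injective.eq_iff]
    rw [e, List.filter_beq, List.nodup_range.count]
    simp [h]
  rw [lookupBits, this]; rfl

/-- Only this direction is needed: the decoder returns some data on every string, and malformed
strings are recognised because encoding these data again does not give them back. -/
theorem decodeInst_encodeInst {I : InstData} (hc : ∀ v ∈ I.2.1, v < I.1)
    (he : ∀ e ∈ I.2.2, e.1 < I.1 ∧ e.2 < I.1) : decodeInst (encodeInst I) = I := by
  obtain ⟨n, c, es⟩ := I
  unfold decodeInst
  rw [parse_encodeInst]
  simp only [List.map_map, Prod.mk.injEq, true_and]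
  refine ⟨?_, ?_⟩
  · conv_rhs => rw [← List.map_id c]
    exact List.map_congr_left fun v hv => lookupBits_bits (hc v hv)
  · conv_rhs => rw [← List.map_id es]
    exact List.map_congr_left fun e h =>
      Prod.ext (lookupBits_bits (he e h).1) (lookupBits_bits (he e h).2)

theorem nodupTest_iff (c : List ℕ) : nodupTest c = true ↔ c.Nodup := by
  unfold nodupTest
  rw [List.all_eq_true]
  simp only [List.mem_range, Bool.not_eq_true', decide_eq_false_iff_not]
  induction c with
  | nil => simp
  | cons a c ih =>
    rw [List.nodup_cons, ← ih]
    constructor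
    · intro h
      exact ⟨by simpa using h 0 (by simp), fun i hi => by simpa using h (i + 1) (by simpa using hi)⟩
    · rintro ⟨h1, h2⟩ i hi
      cases i with
      | zero => simpa using h1
      | succ i => simpa using h2 i (by simpa using hi)

/-- The data of a graph with a vertex cover of size `k`. -/
structure InstData.Valid (k : ℕ) (I : InstData) : Prop where
  length_cover : I.2.1.length = k
  cover_lt : ∀ v ∈ I.2.1, v < I.1
  nodup : I.2.1.Nodup
  edge_lt : ∀ e ∈ I.2.2, e.1 < I.1 ∧ e.2 < I.1
  edge_ne : ∀ e ∈ I.2.2, e.1 ≠ e.2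
  covered : ∀ e ∈ I.2.2, e.1 ∈ I.2.1 ∨ e.2 ∈ I.2.1

theorem isValid_iff (k : ℕ) (I : InstData) : isValid k I = true ↔ I.Valid k := by
  unfold isValid
  simp only [Bool.and_eq_true, List.all_eq_true, nodupTest_iff, decide_eq_true_eq,
    Bool.not_eq_true', decide_eq_false_iff_not, Bool.or_eq_true]
  constructor
  · rintro ⟨⟨⟨h1, h2⟩, h3⟩, h4⟩
    exact ⟨h1, h2, h3, fun e he => (h4 e he).1.1, fun e he => (h4 e he).1.2,
      fun e he => (h4 e he).2⟩
  · rintro ⟨h1, h2, h3, h4, h5, h6⟩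
    exact ⟨⟨⟨h1, h2⟩, h3⟩, fun e he => ⟨⟨h4 e he, h5 e he⟩, h6 e he⟩⟩

/-! ### Instances and colorings -/

/-- The graph with vertex cover that is described by valid data. -/
def InstData.toGraph {k : ℕ} (I : InstData) (h : I.Valid k) : GraphWithCover where
  n := I.1
  graph :=
    { Adj := fun u v => (u.1, v.1) ∈ I.2.2 ∨ (v.1, u.1) ∈ I.2.2
      symm := ⟨fun _ _ h => h.symm⟩
      loopless := ⟨fun u hu => by rcases hu with hu | hu <;> exact h.edge_ne _ hu rfl⟩ }
  cover := Finset.univ.filter fun v => v.1 ∈ I.2.1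
  isVertexCover := by
    rintro u v (huv | huv)
    · simpa using h.covered _ huv
    · simpa using (h.covered _ huv).symm

theorem listCode_map {α β : Type*} (code : β → List Bool) (f : α → β) (l : List α) :
    listCode code (l.map f) = listCode (fun a => code (f a)) l := by
  simp [listCode, List.flatMap_map]

theorem isInstance_toGraph {k : ℕ} {I : InstData} (h : I.Valid k) :
    IsInstance (encodeInst I, k) (I.toGraph h) := by
  obtain ⟨n, c, es⟩ := I
  have hc : ∀ v ∈ c, v < n := h.cover_lt
  have he : ∀ e ∈ es, e.1 < n ∧ e.2 < n := h.edge_lt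
  have hlen : c.length = k := h.length_cover
  have e1 : (c.pmap Fin.mk hc).map Fin.val = c := by
    rw [List.map_pmap]; simp
  have hnd : (c.pmap Fin.mk hc).Nodup := List.Nodup.of_map Fin.val (by rw [e1]; exact h.nodup)
  have hmem : ∀ v : Fin n, v ∈ c.pmap Fin.mk hc ↔ v.1 ∈ c := fun v => by
    rw [List.mem_pmap]
    exact ⟨fun ⟨a, ha, e⟩ => by rw [← e]; exact ha, fun hv => ⟨v.1, hv, rfl⟩⟩
  have e2 : (es.pmap (fun e (h : e.1 < n ∧ e.2 < n) => ((⟨e.1, h.1⟩, ⟨e.2, h.2⟩) : Fin n × Fin n))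
      he).map (fun e => (e.1.1, e.2.1)) = es := by
    rw [List.map_pmap]; simp
  have hmem2 : ∀ u v : Fin n, (u, v) ∈ es.pmap (fun e (h : e.1 < n ∧ e.2 < n) =>
      ((⟨e.1, h.1⟩, ⟨e.2, h.2⟩) : Fin n × Fin n)) he ↔ (u.1, v.1) ∈ es := fun u v => by
    rw [List.mem_pmap]
    refine ⟨fun ⟨a, ha, e⟩ => ?_, fun hv => ⟨_, hv, rfl⟩⟩
    simp only [Prod.mk.injEq] at e
    rw [← e.1, ← e.2]; exact ha
  refine ⟨⟨c.pmap Fin.mk hc, es.pmap (fun e h => (⟨e.1, h.1⟩, ⟨e.2, h.2⟩)) he, hnd, fun v => ?_,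
    fun u v => ?_, ?_⟩, ?_⟩
  · exact (Finset.mem_filter_univ (α := Fin n) (p := fun v => v.1 ∈ c) v).trans (hmem v).symm
  · exact (or_congr (hmem2 u v) (hmem2 v u)).symm
  · have l1 := listCode_map natCode Fin.val (c.pmap Fin.mk hc)
    have l2 := listCode_map (fun e : ℕ × ℕ => natCode e.1 ++ natCode e.2)
      (fun e : Fin n × Fin n => (e.1.1, e.2.1)) (es.pmap (fun e (h : e.1 < n ∧ e.2 < n) =>
        ((⟨e.1, h.1⟩, ⟨e.2, h.2⟩) : Fin n × Fin n)) he)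
    rw [e1] at l1
    rw [e2] at l2
    simp only [encodeInst]
    rw [l1, l2]
    rfl
  · have : (Finset.univ.filter fun v : Fin n => v.1 ∈ c) = (c.pmap Fin.mk hc).toFinset := by
      ext v
      rw [List.mem_toFinset, hmem]
      simp
    change (Finset.univ.filter fun v : Fin n => v.1 ∈ c).card = k
    rw [this, List.toFinset_card_of_nodup hnd, List.length_pmap, hlen]

theorem exists_instData {x : List Bool} {k : ℕ} {G : GraphWithCover} (h : IsInstance (x, k) G) :
    ∃ I : InstData, I.Valid k ∧ x = encodeInst I ∧ I.1 = G.n ∧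
      ∀ u v : Fin G.n, (u.1, v.1) ∈ I.2.2 → G.graph.Adj u v := by
  obtain ⟨⟨c, es, hnd, hc, he, rfl⟩, hk⟩ := h
  have hadj : ∀ e ∈ es, G.graph.Adj e.1 e.2 := fun e h => (he _ _).2 (Or.inl h)
  refine ⟨(G.n, c.map Fin.val, es.map fun e => (e.1.1, e.2.1)), ⟨?_, ?_, ?_, ?_, ?_, ?_⟩, ?_,
    rfl, ?_⟩
  · have : G.cover = c.toFinset := by ext v; rw [hc, List.mem_toFinset]
    rw [this, List.toFinset_card_of_nodup hnd] at hk
    simpa using hk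
  · simp
  · exact hnd.map Fin.val_injective
  · simp only [List.mem_map]
    rintro _ ⟨e, -, rfl⟩
    exact ⟨e.1.2, e.2.2⟩
  · simp only [List.mem_map]
    rintro _ ⟨e, h, rfl⟩ h'
    exact (hadj e h).ne (Fin.ext h')
  · simp only [List.mem_map]
    rintro _ ⟨e, h, rfl⟩
    rcases G.isVertexCover (hadj e h) with h | h
    · exact Or.inl ⟨_, (hc _).1 h, rfl⟩
    · exact Or.inr ⟨_, (hc _).1 h, rfl⟩
  · simp only [encodeInst, listCode_map]
  · simp only [List.mem_map, Prod.mk.injEq]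
    rintro u v ⟨e, h, h1, h2⟩
    rw [← Fin.ext h1, ← Fin.ext h2]
    exact hadj e h

section Coloring

variable {V : Type*} (H : SimpleGraph V)

/-- This replaces the existential over graphs by conditions on the decoded data: strings in the
image of `encodeInst` are unambiguous, and for valid data colourings are just homomorphisms. -/
theorem mem_hColoringVC_iff (p : List Bool × ℕ) :
    p ∈ HColoringVC H ↔ encodeInst (decodeInst p.1) = p.1 ∧ (decodeInst p.1).Valid p.2 ∧
      ∃ col : Fin (decodeInst p.1).1 → V, ∀ u v, (u.1, v.1) ∈ (decodeInst p.1).2.2 →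
        H.Adj (col u) (col v) := by
  obtain ⟨x, k⟩ := p
  constructor
  · rintro ⟨G, hG, ⟨φ⟩⟩
    obtain ⟨I, hI, rfl, hn, hadj⟩ := exists_instData hG
    have hdec : decodeInst (encodeInst I) = I := decodeInst_encodeInst hI.cover_lt hI.edge_lt
    refine ⟨congrArg encodeInst hdec, ?_⟩
    generalize decodeInst (encodeInst I) = J at hdec
    subst hdec
    refine ⟨hI, fun u => φ (Fin.cast hn u), fun u v huv => φ.map_adj ?_⟩
    exact hadj _ _ huv
  · rintro ⟨h1, h2, col, hcol⟩
    dsimp only at h1 h2 hcol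
    refine ⟨(decodeInst x).toGraph h2, ?_, ⟨⟨col, fun {u v} huv => ?_⟩⟩⟩
    · have := isInstance_toGraph h2
      rwa [h1] at this
    · rcases huv with huv | huv
      · exact hcol u v huv
      · exact (hcol v u huv).symm

/-- The colors of the vertices solve the instance. -/
def InstData.Colorable (I : InstData) : Prop :=
  ∃ col : ℕ → V, ∀ e ∈ I.2.2, H.Adj (col e.1) (col e.2)

/-- Colourings may be defined on all of `ℕ` once there is some colour for the numbers that are not
vertices. -/
theorem mem_hColoringVC_iff_colorable [Nonempty V] (p : List Bool × ℕ) :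
    p ∈ HColoringVC H ↔ encodeInst (decodeInst p.1) = p.1 ∧ (decodeInst p.1).Valid p.2 ∧
      (decodeInst p.1).Colorable H := by
  rw [mem_hColoringVC_iff]
  refine and_congr_right fun _ => and_congr_right fun hv => ?_
  constructor
  · rintro ⟨col, h⟩
    refine ⟨fun i => if hi : i < (decodeInst p.1).1 then col ⟨i, hi⟩ else Classical.arbitrary V,
      fun e he => ?_⟩
    obtain ⟨h1, h2⟩ := hv.edge_lt e he
    dsimp only
    rw [dif_pos h1, dif_pos h2]
    exact h _ _ he
  · rintro ⟨col, h⟩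
    exact ⟨fun u => col u.1, fun u v he => h _ he⟩

theorem encodeInst_mem_iff [Nonempty V] {I : InstData} {k : ℕ} (hI : I.Valid k) :
    (encodeInst I, k) ∈ HColoringVC H ↔ I.Colorable H := by
  rw [mem_hColoringVC_iff_colorable]
  simp only [decodeInst_encodeInst hI.cover_lt hI.edge_lt]
  simp [hI]

/-- There is a coloring of the vertices of the cover that respects the given edges and such that
the colors of the vertices of every given star have a common neighbor. -/
def StarColorable (E : List (ℕ × ℕ)) (Ns : List (List ℕ)) : Prop :=
  ∃ col : ℕ → V, (∀ e ∈ E, H.Adj (col e.1) (col e.2)) ∧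
    ∀ N ∈ Ns, ∃ h, ∀ i ∈ N, H.Adj (col i) h

theorem adjTest_iff (es : List (ℕ × ℕ)) (u v : ℕ) :
    adjTest es u v = true ↔ (u, v) ∈ es ∨ (v, u) ∈ es := by
  simp [adjTest]

theorem mem_innerEdges {k : ℕ} {I : InstData} {e : ℕ × ℕ} :
    e ∈ innerEdges k I ↔ (e.1 < k ∧ e.2 < k) ∧
      adjTest I.2.2 (I.2.1.getD e.1 0) (I.2.1.getD e.2 0) = true := by
  obtain ⟨i, j⟩ := e
  simp [innerEdges]

theorem mem_outerNeighbors {k : ℕ} {I : InstData} {N : List ℕ} :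
    N ∈ outerNeighbors k I ↔ ∃ v, v < I.1 ∧ v ∉ I.2.1 ∧
      (List.range k).filter (fun i => adjTest I.2.2 (I.2.1.getD i 0) v) = N := by
  simp [outerNeighbors, and_assoc]

/-- Every edge has an end in the cover, so outer vertices impose no conditions on each other and
each may receive its own common neighbour. -/
theorem colorable_iff_starColorable [Nonempty V] {I : InstData} {k : ℕ} (hI : I.Valid k) :
    I.Colorable H ↔ StarColorable H (innerEdges k I) (outerNeighbors k I) := by
  classical
  have hadj : ∀ col : ℕ → V, (∀ e ∈ I.2.2, H.Adj (col e.1) (col e.2)) → ∀ u v,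
      adjTest I.2.2 u v = true → H.Adj (col u) (col v) := fun col h u v huv => by
    rcases (adjTest_iff _ _ _).1 huv with huv | huv
    · exact h _ huv
    · exact (h _ huv).symm
  constructor
  · rintro ⟨col, h⟩
    refine ⟨fun i => col (I.2.1.getD i 0), fun e he => hadj col h _ _ (mem_innerEdges.1 he).2,
      fun N hN => ?_⟩
    obtain ⟨v, -, -, rfl⟩ := mem_outerNeighbors.1 hN
    exact ⟨col v, fun i hi => hadj col h _ _ (List.mem_filter.1 hi).2⟩
  · rintro ⟨col, h1, h2⟩
    have hidx : ∀ u ∈ I.2.1, I.2.1.idxOf u < k ∧ I.2.1.getD (I.2.1.idxOf u) 0 = u := fun u hu => by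
      have := List.idxOf_lt_length_of_mem hu
      refine ⟨hI.length_cover ▸ this, ?_⟩
      rw [List.getD_eq_getElem _ _ this, List.getElem_idxOf]
    have h3 : ∀ v, ∃ h, v < I.1 → v ∉ I.2.1 → ∀ u ∈ I.2.1, adjTest I.2.2 u v = true →
        H.Adj (col (I.2.1.idxOf u)) h := fun v => by
      by_cases hv : v < I.1 ∧ v ∉ I.2.1
      · obtain ⟨h, hh⟩ := h2 _ (mem_outerNeighbors.2 ⟨v, hv.1, hv.2, rfl⟩)
        refine ⟨h, fun _ _ u hu huv => hh _ (List.mem_filter.2 ⟨List.mem_range.2 (hidx u hu).1, ?_⟩)⟩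
        rw [(hidx u hu).2]; exact huv
      · exact ⟨Classical.arbitrary V, fun h1 h2 => absurd ⟨h1, h2⟩ hv⟩
    choose out hout using h3
    have key : ∀ u v, u ∈ I.2.1 → v < I.1 → adjTest I.2.2 u v = true →
        H.Adj (if u ∈ I.2.1 then col (I.2.1.idxOf u) else out u)
          (if v ∈ I.2.1 then col (I.2.1.idxOf v) else out v) := fun u v hu hv huv => by
      rw [if_pos hu]
      split_ifs with hv'
      · refine h1 (I.2.1.idxOf u, I.2.1.idxOf v)
          (mem_innerEdges.2 ⟨⟨(hidx u hu).1, (hidx v hv').1⟩, ?_⟩)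
        rw [(hidx u hu).2, (hidx v hv').2]; exact huv
      · exact hout v hv hv' u hu huv
    refine ⟨fun u => if u ∈ I.2.1 then col (I.2.1.idxOf u) else out u, fun e he => ?_⟩
    rcases hI.covered e he with hc | hc
    · exact key _ _ hc (hI.edge_lt e he).2 ((adjTest_iff _ _ _).2 (Or.inl he))
    · exact (key _ _ hc (hI.edge_lt e he).1 ((adjTest_iff _ _ _).2 (Or.inr he))).symm

theorem valid_starGraph {k : ℕ} {E : List (ℕ × ℕ)} {stars : List (List ℕ)}
    (hE : ∀ e ∈ E, e.1 < k ∧ e.2 < k ∧ e.1 ≠ e.2) (hs : ∀ S ∈ stars, ∀ i ∈ S, i < k) :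
    (starGraph k E stars).Valid k := by
  have hmem : ∀ e ∈ (starGraph k E stars).2.2, e.1 < k ∧ e.2 < k + stars.length ∧ e.1 ≠ e.2 := by
    simp only [starGraph, List.mem_append, List.mem_flatMap, List.mem_range, List.mem_map]
    rintro e (he | ⟨j, hj, i, hi, rfl⟩)
    · have := hE e he; omega
    · rw [List.getD_eq_getElem _ _ hj] at hi
      have := hs _ (List.getElem_mem hj) i hi
      dsimp only; omega
  refine ⟨by simp [starGraph], by simp [starGraph]; omega, List.nodup_range, fun e he => ?_,
    fun e he => (hmem e he).2.2, fun e he => Or.inl (List.mem_range.2 (hmem e he).1)⟩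
  have := hmem e he
  simp only [starGraph]; omega

/-- The centre of the star with index `j` is the vertex `k + j`, and its colour is the required
common neighbour. -/
theorem starGraph_colorable_iff [Nonempty V] {k : ℕ} {E : List (ℕ × ℕ)} {stars : List (List ℕ)}
    (hE : ∀ e ∈ E, e.1 < k ∧ e.2 < k ∧ e.1 ≠ e.2) (hs : ∀ S ∈ stars, ∀ i ∈ S, i < k) :
    (starGraph k E stars).Colorable H ↔ StarColorable H E stars := by
  have hmem : ∀ e, e ∈ (starGraph k E stars).2.2 ↔
      e ∈ E ∨ ∃ j, j < stars.length ∧ ∃ i ∈ stars.getD j [], (i, k + j) = e := by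
    simp [starGraph]
  constructor
  · rintro ⟨col, h⟩
    refine ⟨col, fun e he => h e ((hmem e).2 (Or.inl he)), fun S hS => ?_⟩
    obtain ⟨j, hj, rfl⟩ := List.mem_iff_getElem.1 hS
    refine ⟨col (k + j), fun i hi => h (i, k + j) ((hmem _).2 (Or.inr ⟨j, hj, i, ?_, rfl⟩))⟩
    rwa [List.getD_eq_getElem _ _ hj]
  · rintro ⟨col, h1, h2⟩
    have h3 : ∀ j, ∃ h, j < stars.length → ∀ i ∈ stars.getD j [], H.Adj (col i) h := fun j => by
      by_cases hj : j < stars.length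
      · obtain ⟨h, hh⟩ := h2 _ (List.getElem_mem hj)
        exact ⟨h, fun _ => by rwa [List.getD_eq_getElem _ _ hj]⟩
      · exact ⟨Classical.arbitrary V, fun h => absurd h hj⟩
    choose out hout using h3
    refine ⟨fun u => if u < k then col u else out (u - k), fun e he => ?_⟩
    rcases (hmem e).1 he with he | ⟨j, hj, i, hi, rfl⟩
    · dsimp only
      rw [if_pos (hE e he).1, if_pos (hE e he).2.1]
      exact h1 e he
    · have hi' : i < k := by
        have hi2 := hi
        rw [List.getD_eq_getElem _ _ hj] at hi2
        exact hs _ (List.getElem_mem hj) i hi2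
      dsimp only
      rw [if_pos hi', if_neg (by omega), Nat.add_sub_cancel_left]
      exact hout j hj i hi

end Coloring

/-! ### Tuples and boundaries -/

theorem mem_tuples {k j : ℕ} {T : List ℕ} :
    T ∈ tuples k j ↔ T.length = j ∧ ∀ i ∈ T, i < k := by
  induction j generalizing T with
  | zero =>
    simp only [tuples, List.mem_singleton, List.length_eq_zero_iff]
    exact ⟨fun h => by simp [h], fun h => h.1⟩
  | succ j ih =>
    simp only [tuples, List.mem_flatMap, List.mem_range, List.mem_map, ih]
    constructor
    · rintro ⟨i, hi, T, ⟨hT, hT'⟩, rfl⟩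
      refine ⟨by simp [hT], ?_⟩
      rintro a (_ | ⟨_, ha⟩)
      exacts [hi, hT' a ha]
    · rintro ⟨h1, h2⟩
      cases T with
      | nil => simp at h1
      | cons a T =>
        exact ⟨a, h2 a List.mem_cons_self, T, ⟨by simpa using h1,
          fun i hi => h2 i (List.mem_cons_of_mem _ hi)⟩, rfl⟩

theorem length_tuples (k j : ℕ) : (tuples k j).length = k ^ j := by
  induction j with
  | zero => rfl
  | succ j ih => simp [tuples, List.length_flatMap, ih, pow_succ']

theorem nodup_tuples (k j : ℕ) : (tuples k j).Nodup := by
  induction j with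
  | zero => simp [tuples]
  | succ j ih =>
    rw [tuples, List.nodup_flatMap]
    refine ⟨fun i _ => ih.map fun a b h => (List.cons.inj h).2, ?_⟩
    refine List.nodup_range.imp fun {a b} hab => ?_
    rw [Function.onFun, List.disjoint_left]
    simp only [List.mem_map]
    rintro _ ⟨T, -, rfl⟩ ⟨T', -, h⟩
    exact hab (List.cons.inj h).1.symm

theorem mem_starTuples {k j : ℕ} {Ns : List (List ℕ)} {T : List ℕ} :
    T ∈ starTuples k j Ns ↔ (T.length = j ∧ ∀ i ∈ T, i < k) ∧ ∃ N ∈ Ns, ∀ i ∈ T, i ∈ N := by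
  simp [starTuples, mem_tuples]

theorem mem_faces {p j : ℕ} {S : List ℕ} (hS : S.length = j) {x : ZMod p × List ℕ}
    (hx : x ∈ faces p j S) : x.2.length + 1 = j ∧ ∀ i ∈ x.2, i ∈ S := by
  induction j generalizing S x with
  | zero => simp [faces] at hx
  | succ j ih =>
    cases S with
    | nil => simp at hS
    | cons a S =>
      simp only [faces, List.tail_cons, List.headD_cons, List.mem_cons, List.mem_map] at hx
      rcases hx with rfl | ⟨y, hy, rfl⟩
      · exact ⟨by simpa using hS, fun i hi => List.mem_cons_of_mem _ hi⟩
      · obtain ⟨h1, h2⟩ := ih (by simpa using hS) hy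
        refine ⟨by simpa using h1, ?_⟩
        rintro i (_ | ⟨_, hi⟩)
        exacts [List.mem_cons_self, List.mem_cons_of_mem _ (h2 i hi)]

section Boundary

variable {p : ℕ} [Fact p.Prime] {K : Type*} [Field K] (φ : ZMod p →+* K)

/-- Deleting the head has sign `1`; prepending the head to a face of the tail shifts its index by
one and therefore flips its sign. -/
theorem sum_faces {j : ℕ} {S : List ℕ} (hS : S.length = j) (g : List ℕ → K) :
    ((faces p j S).map fun x => φ x.1 * g x.2).sum =
      ∑ i : Fin j, (-1) ^ (i : ℕ) * g (S.eraseIdx i) := by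
  induction j generalizing S g with
  | zero => simp [faces]
  | succ j ih =>
    cases S with
    | nil => simp at hS
    | cons a S =>
      have h := ih (S := S) (by simpa using hS) (fun T => g (a :: T))
      rw [Fin.sum_univ_succ]
      simp only [faces, List.tail_cons, List.headD_cons, List.map_cons, List.sum_cons, map_one,
        one_mul, List.map_map, Fin.val_zero, pow_zero, List.eraseIdx_cons_zero, Fin.val_succ,
        List.eraseIdx_cons_succ, pow_succ, mul_neg, mul_one, neg_mul, Finset.sum_neg_distrib, ← h]
      congr 1
      rw [← neg_one_mul, ← List.sum_map_mul_left]
      simp [Function.comp_def]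

theorem rowEval_map (l : List (List ℕ)) (r : List ℕ → ZMod p) (g : List ℕ → K) :
    rowEval φ (fun i => g (l.getD i [])) (l.map r) = (l.map fun T => φ (r T) * g T).sum := by
  rw [rowEval, List.length_map]
  induction l with
  | nil => simp
  | cons a l ih =>
    rw [List.length_cons, Finset.sum_range_succ', List.map_cons, List.map_cons, List.sum_cons, ← ih,
      add_comm]
    simp

/-- Evaluating the row of a tuple at a function of `m`-tuples is the simplicial coboundary. Tuples
with repeated entries are allowed, so a face may occur several times; its signs are then summed. -/
theorem rowEval_starRow {k m : ℕ} {S : List ℕ} (hS : S.length = m + 1) (hk : ∀ i ∈ S, i < k)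
    (g : List ℕ → K) :
    rowEval φ (fun i => g ((tuples k m).getD i [])) (starRow p k m S) =
      ∑ i : Fin (m + 1), (-1) ^ (i : ℕ) * g (S.eraseIdx i) := by
  rw [starRow, rowEval_map, ← sum_faces φ hS, ← List.sum_toFinset _ (nodup_tuples k m)]
  have hmem : ∀ x ∈ faces p (m + 1) S, x.2 ∈ (tuples k m).toFinset := fun x hx => by
    obtain ⟨h1, h2⟩ := mem_faces hS hx
    rw [List.mem_toFinset, mem_tuples]
    exact ⟨by omega, fun i hi => hk i (h2 i hi)⟩
  generalize faces p (m + 1) S = L at hmem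
  induction L with
  | nil => simp
  | cons x L ih =>
    simp only [List.map_cons, List.sum_cons, map_add, add_mul, Finset.sum_add_distrib]
    rw [ih fun y hy => hmem y (List.mem_cons_of_mem _ hy)]
    congr 1
    rw [Finset.sum_eq_single x.2 (fun T _ hT => by rw [if_neg hT.symm]; simp)
      (fun h => absurd (hmem x List.mem_cons_self) h), if_pos rfl]

theorem rowEval_edgeRow {k : ℕ} {e : ℕ × ℕ} (h1 : e.1 < k) (h2 : e.2 < k) (μ : ℕ → K) :
    rowEval φ μ (edgeRow p k e) = μ e.1 + μ e.2 := by
  rw [rowEval, edgeRow, List.length_map, List.length_range]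
  rw [Finset.sum_congr rfl (g := fun i => (if e.1 = i then μ i else 0) + if e.2 = i then μ i else 0)
    fun i hi => ?_]
  · simp [Finset.sum_add_distrib, h1, h2]
  · rw [getD_map_range _ _ (Finset.mem_range.1 hi)]
    split_ifs <;> simp [add_mul]

end Boundary

/-! ### Determinants -/

section Determinants

variable {V K : Type*} [Field K] {m : ℕ} (x : V → Fin (m + 1) → K)

/-- The determinant of the vectors of a tuple of `m + 1` vertices. -/
def tupleDet (col : ℕ → V) (S : List ℕ) : K :=
  (Matrix.of fun i : Fin (m + 1) => x (col (S.getD i 0))).det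

/-- The determinant of the vectors of a tuple of `m` vertices and a fixed vector. -/
def faceDet (e : Fin (m + 1) → K) (col : ℕ → V) (T : List ℕ) : K :=
  (Matrix.of fun i : Fin (m + 1) =>
    (Fin.cons e fun j : Fin m => x (col (T.getD j 0)) : Fin (m + 1) → Fin (m + 1) → K) i).det

theorem getD_eraseIdx {n : ℕ} (S : List ℕ) (i : Fin (n + 1)) (j : Fin n) :
    (S.eraseIdx i).getD j 0 = S.getD (i.succAbove j) 0 := by
  simp only [List.getD_eq_getElem?_getD, List.getElem?_eraseIdx, Fin.succAbove, Fin.lt_def,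
    Fin.val_castSucc]
  split_ifs <;> simp

/-- Put `e` in front of the vectors of the tuple and border the matrix by a column of ones. Since
every row pairs with `ℓ` to `1`, the vector `(1, -ℓ)` is in the kernel and the determinant is zero.
Expansion along the column of ones gives the tuple itself and, with alternating signs, its faces
completed by `e`. -/
theorem tupleDet_eq (ℓ e : Fin (m + 1) → K) (he : e ⬝ᵥ ℓ = 1) (hx : ∀ v, x v ⬝ᵥ ℓ = 1)
    (col : ℕ → V) (S : List ℕ) :
    tupleDet x col S =
      ∑ i : Fin (m + 1), (-1) ^ (i : ℕ) * faceDet x e col (S.eraseIdx i) := by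
  let y : Fin (m + 2) → Fin (m + 1) → K := Fin.cons e fun i => x (col (S.getD i 0))
  have hy : ∀ i, y i ⬝ᵥ ℓ = 1 := Fin.cases he fun i => hx _
  let A : Matrix (Fin (m + 2)) (Fin (m + 2)) K := Matrix.of fun i => Fin.cons 1 (y i)
  have hA : A.det = 0 := by
    rw [← Matrix.exists_mulVec_eq_zero_iff]
    refine ⟨Fin.cons 1 (-ℓ), fun h => one_ne_zero (congrFun h 0), ?_⟩
    funext i
    have := hy i
    simp only [dotProduct] at this
    simp [A, Matrix.mulVec, dotProduct, Fin.sum_univ_succ (n := m + 1), this]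
  rw [Matrix.det_succ_column_zero, Fin.sum_univ_succ] at hA
  have h0 : (A.submatrix (Fin.succAbove 0) Fin.succ).det = tupleDet x col S := by
    unfold tupleDet
    congr 1
  have h1 : ∀ i : Fin (m + 1), (A.submatrix i.succ.succAbove Fin.succ).det =
      faceDet x e col (S.eraseIdx i) := fun i => by
    unfold faceDet
    congr 1
    ext a b
    refine Fin.cases ?_ (fun a => ?_) a
    · simp [A, y]
    · simpa [A, y] using congrArg (fun i => x (col i) b) (getD_eraseIdx S i a).symm
  rw [h0] at hA
  simp only [h1] at hA
  rw [← sub_eq_zero, ← hA, sub_eq_add_neg, ← Finset.sum_neg_distrib]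
  simp [A, pow_succ]

variable {x} {H : SimpleGraph V}

/-- If the determinant were nonzero, the vectors of neighbours of `h` would span the whole space,
including the vector of `h`. -/
theorem tupleDet_eq_zero (hx : IsIndependentRep H x) {col : ℕ → V} {S : List ℕ}
    (hS : S.length = m + 1) {h : V} (hh : ∀ i ∈ S, H.Adj (col i) h) : tupleDet x col S = 0 := by
  by_contra hne
  have hli := Matrix.linearIndependent_rows_iff_isUnit.2
    ((Matrix.isUnit_iff_isUnit_det _).2 (isUnit_iff_ne_zero.2 hne))
  have htop := hli.span_eq_top_of_card_eq_finrank' (by simp)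
  refine hx h ((le_of_eq htop.symm).trans ?_ Submodule.mem_top)
  rw [Submodule.span_le]
  rintro _ ⟨i, rfl⟩
  refine Submodule.subset_span ⟨col (S.getD i 0), ?_, rfl⟩
  rw [List.getD_eq_getElem _ _ (by omega)]
  exact (hh _ (List.getElem_mem _)).symm

/-- Choose members of `N` whose vectors form a basis of the span of all of them. A basis of `m + 1`
vectors contradicts `h2`. A smaller one fits in an `m`-tuple, and by faithfulness the common
neighbour of that tuple is adjacent to every colour with vector in the span. -/
theorem exists_common_neighbor [Nonempty V] (hx : IsFaithfulIndependentRep H x) {col : ℕ → V}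
    {N : List ℕ}
    (h1 : ∀ T : List ℕ, T.length = m → (∀ i ∈ T, i ∈ N) → ∃ h, ∀ i ∈ T, H.Adj (col i) h)
    (h2 : ∀ S : List ℕ, S.length = m + 1 → (∀ i ∈ S, i ∈ N) → tupleDet x col S = 0) :
    ∃ h, ∀ i ∈ N, H.Adj (col i) h := by
  cases hN : N with
  | nil => exact ⟨Classical.arbitrary V, by simp⟩
  | cons a N' =>
    rw [← hN]
    have ha : a ∈ N := by simp [hN]
    obtain ⟨r, hrm, f, hf, hspan, hli⟩ : ∃ r ≤ m + 1, ∃ f : Fin r → Fin (m + 1) → K,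
        (∀ i, f i ∈ (fun i => x (col i)) '' {i | i ∈ N}) ∧ Submodule.span K (Set.range f) =
          Submodule.span K ((fun i => x (col i)) '' {i | i ∈ N}) ∧ LinearIndependent K f :=
      ⟨_, (Submodule.finrank_le _).trans (by simp), Submodule.exists_fun_fin_finrank_span_eq K _⟩
    choose c hc hcf using hf
    rcases hrm.lt_or_eq with hlt | heq
    -- The `r` chosen members are padded with copies of `a` to a tuple of length exactly `m`.
    · obtain ⟨h, hh⟩ := h1 (List.ofFn c ++ List.replicate (m - r) a) (by simp; omega) (by
        intro i hi
        rcases List.mem_append.1 hi with hi | hi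
        · obtain ⟨j, rfl⟩ := List.mem_ofFn.1 hi
          exact hc j
        · rw [(List.mem_replicate.1 hi).2]; exact ha)
      refine ⟨h, fun i hi => (hx.2 _ _).2 ?_⟩
      have hle : Submodule.span K ((fun i => x (col i)) '' {i | i ∈ N}) ≤
          Submodule.span K (x '' H.neighborSet h) := by
        rw [← hspan, Submodule.span_le]
        rintro _ ⟨j, rfl⟩
        refine Submodule.subset_span ⟨col (c j), (hh _ ?_).symm, hcf j⟩
        exact List.mem_append_left _ (List.mem_ofFn.2 ⟨j, rfl⟩)
      exact hle (Submodule.subset_span ⟨i, hi, rfl⟩)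
    · subst heq
      refine absurd (h2 (List.ofFn c) (by simp) fun i hi => ?_) ?_
      · obtain ⟨j, rfl⟩ := List.mem_ofFn.1 hi
        exact hc j
      · have : (Matrix.of fun i : Fin (m + 1) => x (col ((List.ofFn c).getD i 0))) =
            Matrix.of f := by
          funext i
          change x (col ((List.ofFn c).getD i 0)) = f i
          rw [List.getD_eq_getElem _ _ (by rw [List.length_ofFn]; exact i.2), List.getElem_ofFn]
          exact hcf i
        rw [tupleDet, this, ← ne_eq, ← isUnit_iff_ne_zero, ← Matrix.isUnit_iff_isUnit_det,
          ← Matrix.linearIndependent_rows_iff_isUnit]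
        exact hli

theorem starColorable_keptStars_iff [Nonempty V] {p : ℕ} [Fact p.Prime] (φ : ZMod p →+* K)
    (hx : IsFaithfulIndependentRep H x) (ℓ : Fin (m + 1) → K) (hℓ : ∀ v, x v ⬝ᵥ ℓ = 1)
    {k : ℕ} {E : List (ℕ × ℕ)} {Ns : List (List ℕ)} (hk : ∀ N ∈ Ns, ∀ i ∈ N, i < k) :
    StarColorable H E (keptStars p m k Ns) ↔ StarColorable H E Ns := by
  have hlen : ∀ S ∈ starTuples k (m + 1) Ns, (starRow p k m S).length = k ^ m := fun S _ => by
    rw [starRow, List.length_map, length_tuples]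
  refine exists_congr fun col => and_congr_right fun _ => ⟨fun h N hN => ?_, fun h S hS => ?_⟩
  -- Any vector of the hyperplane can serve as the common apex of the faces.
  · let e := x (Classical.arbitrary V)
    have hrow : ∀ S ∈ starTuples k (m + 1) Ns,
        rowEval φ (fun i => faceDet x e col ((tuples k m).getD i [])) (starRow p k m S) =
          tupleDet x col S := fun S hS => by
      obtain ⟨⟨hS1, hS2⟩, -⟩ := mem_starTuples.1 hS
      rw [rowEval_starRow φ hS1 hS2, tupleDet_eq x ℓ e (hℓ _) hℓ]
    have hzero := rowEval_eq_zero_of_elim φ (starRow p k m) _ hlen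
      (fun i => faceDet x e col ((tuples k m).getD i [])) fun S hS => by
        have hS' := mem_of_mem_elim (starRow p k m) _ hlen S hS
        obtain ⟨g, hg⟩ := h S (List.mem_append_right _ hS)
        rw [hrow S hS']
        exact tupleDet_eq_zero hx.1 (mem_starTuples.1 hS').1.1 hg
    refine exists_common_neighbor hx (fun T hT hTN => ?_) fun S hS hSN => ?_
    · exact h T (List.mem_append_left _
        (mem_starTuples.2 ⟨⟨hT, fun i hi => hk N hN i (hTN i hi)⟩, N, hN, hTN⟩))
    · have hS' : S ∈ starTuples k (m + 1) Ns :=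
        mem_starTuples.2 ⟨⟨hS, fun i hi => hk N hN i (hSN i hi)⟩, N, hN, hSN⟩
      rw [← hrow S hS']
      exact hzero S hS'
  · have : ∃ N ∈ Ns, ∀ i ∈ S, i ∈ N := by
      rcases List.mem_append.1 hS with hS | hS
      · exact (mem_starTuples.1 hS).2
      · exact (mem_starTuples.1 (mem_of_mem_elim (starRow p k m) _ hlen S hS)).2
    obtain ⟨N, hN, hSN⟩ := this
    obtain ⟨g, hg⟩ := h N hN
    exact ⟨g, fun i hi => hg i (hSN i hi)⟩

/-- If adjacency of colours is the linear equation `μ u + μ v = 0`, then the condition of every edge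
follows from those of a basis of the edge rows. -/
theorem starColorable_thinEdges_iff {p : ℕ} [Fact p.Prime] (φ : ZMod p →+* K) (thin : Bool)
    (μ : V → K) (hμ : thin = true → ∀ u v, H.Adj u v ↔ μ u + μ v = 0) {k : ℕ} {E : List (ℕ × ℕ)}
    {Ns : List (List ℕ)} (hE : ∀ e ∈ E, e.1 < k ∧ e.2 < k) :
    StarColorable H (thinEdges p thin k E) Ns ↔ StarColorable H E Ns := by
  cases thin with
  | false => rfl
  | true =>
    have hlen : ∀ e ∈ E, (edgeRow p k e).length = k := fun e _ => by simp [edgeRow]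
    refine exists_congr fun col => and_congr_left fun _ => ?_
    change (∀ e ∈ elim (E.map fun e => (edgeRow p k e, e)), _) ↔ _
    refine ⟨fun h => ?_, fun h e he => h e (mem_of_mem_elim (edgeRow p k) E hlen e he)⟩
    have := rowEval_eq_zero_of_elim φ (edgeRow p k) E hlen (fun t => μ (col t)) fun e he => by
      have he' := mem_of_mem_elim (edgeRow p k) E hlen e he
      rw [rowEval_edgeRow φ (hE e he').1 (hE e he').2]
      exact (hμ rfl _ _).1 (h e he)
    intro e he
    have h2 := this e he
    rw [rowEval_edgeRow φ (hE e he).1 (hE e he).2] at h2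
    exact (hμ rfl _ _).2 h2

end Determinants

/-! ### Representations over fields of positive characteristic -/

/-- Nonzero primes are maximal. For the zero ideal, `a` in the radical makes `a * a + 1` a unit,
which forces `a = 0`. -/
theorem Int.isJacobsonRing : IsJacobsonRing ℤ := by
  rw [isJacobsonRing_iff_prime_eq]
  intro P hP
  by_cases h : P = ⊥
  · subst h
    refine le_antisymm (fun a ha => ?_) Ideal.le_jacobson
    have h1 := Ideal.mem_jacobson_bot.1 ha a
    rw [Ideal.mem_bot]
    by_contra ha'
    have h2 : 0 < a * a := mul_self_pos.2 ha'
    rcases Int.isUnit_iff.1 h1 with h1 | h1 <;> omega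
  · have := hP.isMaximal h
    exact Ideal.jacobson_eq_self_of_isMaximal

/-- A field that is a quotient of a finitely generated ring has positive characteristic. -/
theorem exists_prime_zmod_ringHom {R K : Type*} [CommRing R] [Algebra.FiniteType ℤ R] [Field K]
    (f : R →+* K) (hf : Function.Surjective f) :
    ∃ p : ℕ, p.Prime ∧ Nonempty (ZMod p →+* K) := by
  have := Int.isJacobsonRing
  have h1 : Algebra.FiniteType ℤ K := Algebra.FiniteType.of_surjective f.toIntAlgHom hf
  -- Zariski's lemma over the Jacobson ring `ℤ`. In characteristic zero, `ℤ` would embed in a field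
  -- integral over it and so be a field itself.
  have h2 : Module.Finite ℤ K := finite_of_finite_type_of_isJacobsonRing ℤ K
  obtain ⟨p, hp⟩ := CharP.exists K
  rcases CharP.char_is_prime_or_zero K p with hprime | rfl
  · exact ⟨p, hprime, ⟨ZMod.castHom dvd_rfl K⟩⟩
  · have := CharP.charP_to_charZero K
    have h3 : IsField ℤ := isField_of_isIntegral_of_isField (R := ℤ) (S := K)
      (by simpa using Int.cast_injective) (Field.toIsField K)
    obtain ⟨b, hb⟩ := h3.mul_inv_cancel (two_ne_zero (α := ℤ))
    omega

/-- The data that witness that vectors are a faithful independent representation, in an affine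
hyperplane. -/
structure RepCertificate {V : Type*} (H : SimpleGraph V) (d : ℕ) (R : Type*) [CommRing R] where
  vec : V → Fin d → R
  ann : V → V → Fin d → R
  -- Non-vanishing is recorded as invertibility, an equation, and so survives every ring
  -- homomorphism.
  inv : V → V → R
  fnl : Fin d → R
  ann_adj : ∀ u v w, ¬ H.Adj u v → H.Adj w v → vec w ⬝ᵥ ann u v = 0
  ann_self : ∀ u v, ¬ H.Adj u v → (vec u ⬝ᵥ ann u v) * inv u v = 1
  fnl_vec : ∀ v, vec v ⬝ᵥ fnl = 1

namespace RepCertificate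

variable {V : Type*} {H : SimpleGraph V} {d : ℕ}

/-- The image of a certificate under a ring homomorphism. -/
def map {R S : Type*} [CommRing R] [CommRing S] (f : R →+* S) (c : RepCertificate H d R) :
    RepCertificate H d S where
  vec v := f ∘ c.vec v
  ann u v := f ∘ c.ann u v
  inv u v := f (c.inv u v)
  fnl := f ∘ c.fnl
  ann_adj u v w h h' := by rw [← RingHom.map_dotProduct, c.ann_adj u v w h h', map_zero]
  ann_self u v h := by rw [← RingHom.map_dotProduct, ← map_mul, c.ann_self u v h, map_one]
  fnl_vec v := by rw [← RingHom.map_dotProduct, c.fnl_vec, map_one]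

/-- For non-adjacent `u` and `v` the functional `ann u v` kills the neighbours of `v` but not `u`.
The case `u = v` is independence. -/
theorem isFaithfulIndependentRep {K : Type*} [Field K] (c : RepCertificate H d K) :
    IsFaithfulIndependentRep H c.vec := by
  have key : ∀ u v, c.vec u ∈ Submodule.span K (c.vec '' H.neighborSet v) → H.Adj u v := by
    intro u v huv
    by_contra hadj
    have : ∀ y ∈ Submodule.span K (c.vec '' H.neighborSet v), y ⬝ᵥ c.ann u v = 0 := by
      intro y hy
      induction hy using Submodule.span_induction with
      | mem y hy =>
        obtain ⟨w, hw, rfl⟩ := hy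
        exact c.ann_adj u v w hadj (H.symm.symm _ _ hw)
      | zero => exact zero_dotProduct _
      | add y z _ _ hy hz => rw [add_dotProduct, hy, hz, add_zero]
      | smul a y _ hy => rw [smul_dotProduct, hy, smul_zero]
    have h1 := c.ann_self u v hadj
    rw [this _ huv, zero_mul] at h1
    exact zero_ne_one h1
  exact ⟨fun v hv => H.irrefl (key v v hv),
    fun u v => ⟨fun h => Submodule.subset_span ⟨u, h.symm, rfl⟩, key u v⟩⟩

/-- Over an infinite field some functional vanishes at none of finitely many nonzero vectors;
dividing each vector by its value puts all of them in a hyperplane. No `x v` is zero, because `v` is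
not adjacent to itself. -/
theorem nonempty_of_rep [Finite V] {F : Type*} [Field F] [Infinite F] {x : V → Fin d → F}
    (ann : V → V → Fin d → F) (h1 : ∀ u v w, ¬ H.Adj u v → H.Adj w v → x w ⬝ᵥ ann u v = 0)
    (h2 : ∀ u v, ¬ H.Adj u v → x u ⬝ᵥ ann u v ≠ 0) :
    Nonempty (RepCertificate H d F) := by
  obtain ⟨f, hf⟩ := Module.exists_dual_forall_apply_ne_zero (K := F) x fun v hv =>
    h2 v v (H.irrefl) (by rw [hv, zero_dotProduct])
  let ℓ : Fin d → F := fun i => f fun j => if i = j then 1 else 0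
  have hℓ : ∀ v, x v ⬝ᵥ ℓ = f (x v) := fun v => by
    rw [f.pi_apply_eq_sum_univ]; rfl
  refine ⟨⟨fun v => (f (x v))⁻¹ • x v, ann, fun u v => ((f (x u))⁻¹ * (x u ⬝ᵥ ann u v))⁻¹, ℓ,
    fun u v w h h' => ?_, fun u v h => ?_, fun v => ?_⟩⟩
  · rw [smul_dotProduct, h1 u v w h h', smul_zero]
  · rw [smul_dotProduct, smul_eq_mul]
    exact mul_inv_cancel₀ (mul_ne_zero (inv_ne_zero (hf u)) (h2 u v h))
  · rw [smul_dotProduct, hℓ, smul_eq_mul]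
    exact inv_mul_cancel₀ (hf v)

/-- Separating functionals exist already over `F`; the algebraic closure is used only because it is
infinite. -/
theorem nonempty_of_isFaithfulIndependentRep [Finite V] {F : Type*} [Field F]
    {x : V → Fin d → F} (hx : IsFaithfulIndependentRep H x) :
    Nonempty (RepCertificate H d (AlgebraicClosure F)) := by
  have h : ∀ u v, ∃ a : Fin d → F, ¬ H.Adj u v →
      (∀ w, H.Adj w v → x w ⬝ᵥ a = 0) ∧ x u ⬝ᵥ a ≠ 0 := fun u v => by
    by_cases huv : H.Adj u v
    · exact ⟨0, fun h => absurd huv h⟩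
    · obtain ⟨f, hf1, hf2⟩ := Submodule.exists_le_ker_of_notMem (mt (hx.2 u v).2 huv)
      have hf : ∀ y, y ⬝ᵥ (fun i => f fun j => if i = j then 1 else 0) = f y := fun y => by
        rw [f.pi_apply_eq_sum_univ]; rfl
      refine ⟨fun i => f fun j => if i = j then 1 else 0, fun _ => ⟨fun w hw => ?_, ?_⟩⟩
      · rw [hf]
        exact hf2 (Submodule.subset_span ⟨w, hw.symm, rfl⟩)
      · rwa [hf]
  choose a ha using h
  let φ := algebraMap F (AlgebraicClosure F)
  have := IsAlgClosed.instInfinite (K := AlgebraicClosure F)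
  refine nonempty_of_rep (x := fun v => φ ∘ x v) (fun u v => φ ∘ a u v) (fun u v w h h' => ?_)
    fun u v h => ?_
  · rw [← RingHom.map_dotProduct, (ha u v h).1 w h', map_zero]
  · rw [← RingHom.map_dotProduct]
    exact (map_ne_zero φ).2 (ha u v h).2

/-- Finitely many entries occur in a certificate, and its equations already hold in the ring that
they generate. -/
theorem exists_finiteType [Finite V] {R : Type*} [CommRing R] (c : RepCertificate H d R) :
    ∃ A : Subalgebra ℤ R, Algebra.FiniteType ℤ A ∧ Nonempty (RepCertificate H d A) := by
  let s : Set R := Set.range (fun i : V × Fin d => c.vec i.1 i.2) ∪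
    Set.range (fun i : V × V × Fin d => c.ann i.1 i.2.1 i.2.2) ∪
    Set.range (fun i : V × V => c.inv i.1 i.2) ∪ Set.range c.fnl
  have hs : s.Finite := (((Set.finite_range _).union (Set.finite_range _)).union
    (Set.finite_range _)).union (Set.finite_range _)
  have hsub : ∀ a ∈ s, a ∈ Algebra.adjoin ℤ s := fun a ha => Algebra.subset_adjoin ha
  have hdot : ∀ a b : Fin d → Algebra.adjoin ℤ s,
      ((a ⬝ᵥ b : Algebra.adjoin ℤ s) : R) = (fun i => (a i : R)) ⬝ᵥ fun i => (b i : R) :=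
    fun a b => by simp [dotProduct]
  refine ⟨Algebra.adjoin ℤ s, .adjoin_of_finite hs, ⟨⟨
    fun v i => ⟨c.vec v i, hsub _ (Or.inl (Or.inl (Or.inl ⟨(v, i), rfl⟩)))⟩,
    fun u v i => ⟨c.ann u v i, hsub _ (Or.inl (Or.inl (Or.inr ⟨(u, v, i), rfl⟩)))⟩,
    fun u v => ⟨c.inv u v, hsub _ (Or.inl (Or.inr ⟨(u, v), rfl⟩))⟩,
    fun i => ⟨c.fnl i, hsub _ (Or.inr ⟨i, rfl⟩)⟩, fun u v w h h' => ?_, fun u v h => ?_,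
    fun v => ?_⟩⟩⟩
  · apply Subtype.ext
    rw [hdot]
    exact c.ann_adj u v w h h'
  · apply Subtype.ext
    rw [MulMemClass.coe_mul, hdot]
    exact c.ann_self u v h
  · apply Subtype.ext
    rw [hdot]
    exact c.fnl_vec v

end RepCertificate

theorem IsFaithfulIndependentRep.exists_prime.{u, v} {V : Type v} [Finite V] {H : SimpleGraph V} {d : ℕ}
    {F : Type u} [Field F] {x : V → Fin d → F} (hx : IsFaithfulIndependentRep H x) :
    ∃ (p : ℕ) (K : Type u) (_ : Field K) (_ : ZMod p →+* K) (y : V → Fin d → K) (ℓ : Fin d → K),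
      p.Prime ∧ IsFaithfulIndependentRep H y ∧ ∀ v, y v ⬝ᵥ ℓ = 1 := by
  obtain ⟨c⟩ := RepCertificate.nonempty_of_isFaithfulIndependentRep hx
  obtain ⟨A, hA, ⟨c'⟩⟩ := c.exists_finiteType
  obtain ⟨M, hM⟩ := Ideal.exists_maximal A
  let _ := Ideal.Quotient.field M
  obtain ⟨p, hp, ⟨φ⟩⟩ := exists_prime_zmod_ringHom (Ideal.Quotient.mk M)
    Ideal.Quotient.mk_surjective
  exact ⟨p, A ⧸ M, inferInstance, φ, (c'.map (Ideal.Quotient.mk M)).vec, _, hp,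
    (c'.map (Ideal.Quotient.mk M)).isFaithfulIndependentRep, (c'.map _).fnl_vec⟩

/-! ### The size of the kernel -/

theorem length_natCode (v : ℕ) : (natCode v).length = 2 * v.size + 1 := by
  rw [natCode, List.length_append, List.length_singleton, List.length_flatMap]
  simp [Nat.size_eq_bits_len, mul_comm]

theorem length_listCode_le {α : Type*} (code : α → List Bool) (l : List α) {B : ℕ}
    (h : ∀ a ∈ l, (code a).length ≤ B) : (listCode code l).length ≤ l.length * (B + 1) + 1 := by
  rw [listCode, List.length_append, List.length_singleton]
  refine Nat.add_le_add_right ?_ 1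
  induction l with
  | nil => simp
  | cons a l ih =>
    have h1 := h a List.mem_cons_self
    have h2 := ih fun b hb => h b (List.mem_cons_of_mem _ hb)
    rw [List.flatMap_cons, List.length_append, List.length_cons, List.length_cons, Nat.add_mul]
    omega

theorem length_encodeInst_le {k : ℕ} {I : InstData} (hI : I.Valid k) {L : ℕ}
    (hL : I.1 ≤ 2 ^ L) :
    (encodeInst I).length ≤
      I.1 + 1 + (k * (2 * L + 2) + 1) + (I.2.2.length * (4 * L + 3) + 1) := by
  have hsize : ∀ v, v < I.1 → v.size ≤ L := fun v hv => Nat.size_le.2 (hv.trans_le hL)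
  have h1 := length_listCode_le natCode I.2.1 (B := 2 * L + 1) fun v hv => by
    have := hsize v (hI.cover_lt v hv)
    rw [length_natCode]; omega
  have h2 := length_listCode_le (fun e : ℕ × ℕ => natCode e.1 ++ natCode e.2) I.2.2
    (B := 4 * L + 2) fun e he => by
      have h3 := hsize _ (hI.edge_lt e he).1
      have h4 := hsize _ (hI.edge_lt e he).2
      rw [List.length_append, length_natCode, length_natCode]; omega
  rw [hI.length_cover, show 2 * L + 1 + 1 = 2 * L + 2 from rfl] at h1
  rw [show 4 * L + 2 + 1 = 4 * L + 3 from rfl] at h2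
  simp only [encodeInst, List.length_append, List.length_replicate, List.length_singleton]
  omega

theorem length_edgeRow {p k : ℕ} (e : ℕ × ℕ) : (edgeRow p k e).length = k := by
  simp [edgeRow]

section Kernel

variable {p : ℕ} [Fact p.Prime] {m k : ℕ}

theorem length_starTuples_le (Ns : List (List ℕ)) (j : ℕ) :
    (starTuples k j Ns).length ≤ k ^ j :=
  (List.length_filter_le _ _).trans (length_tuples k j).le

theorem length_keptStars_le (Ns : List (List ℕ)) : (keptStars p m k Ns).length ≤ 2 * k ^ m := by
  rw [keptStars, List.length_append, two_mul]
  refine Nat.add_le_add (length_starTuples_le Ns m) (length_elim_le (starRow p k m) _ fun S _ => ?_)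
  rw [starRow, List.length_map, length_tuples]

theorem keptStars_spec {Ns : List (List ℕ)} {S : List ℕ} (hS : S ∈ keptStars p m k Ns) :
    S.length ≤ m + 1 ∧ ∀ i ∈ S, i < k := by
  rcases List.mem_append.1 hS with hS | hS
  · obtain ⟨⟨h1, h2⟩, -⟩ := mem_starTuples.1 hS
    exact ⟨by omega, h2⟩
  · obtain ⟨⟨h1, h2⟩, -⟩ := mem_starTuples.1 (mem_of_mem_elim (M := k ^ m) (starRow p k m) _
      (fun S _ => by rw [starRow, List.length_map, length_tuples]) S hS)
    exact ⟨h1.le, h2⟩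

theorem mem_of_mem_thinEdges {thin : Bool} {E : List (ℕ × ℕ)} {e : ℕ × ℕ}
    (he : e ∈ thinEdges p thin k E) : e ∈ E := by
  cases thin with
  | false => exact he
  | true => exact mem_of_mem_elim (edgeRow p k) E (fun e _ => length_edgeRow e) e he

theorem length_innerEdges_le (I : InstData) : (innerEdges k I).length ≤ k ^ 2 := by
  refine (List.length_filter_le _ _).trans ?_
  simp [List.length_flatMap, sq]

theorem length_thinEdges_le {thin : Bool} (hm : 1 ≤ m) (hthin : thin = true ∨ 2 ≤ m)
    (I : InstData) : (thinEdges p thin k (innerEdges k I)).length ≤ k ^ m := by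
  rcases Nat.eq_zero_or_pos k with rfl | hk
  · cases h : thinEdges p thin 0 (innerEdges 0 I) with
    | nil => simp
    | cons e l =>
      have he : e ∈ thinEdges p thin 0 (innerEdges 0 I) := by rw [h]; exact List.mem_cons_self
      exact absurd (mem_innerEdges.1 (mem_of_mem_thinEdges he)).1.1 (Nat.not_lt_zero _)
  · cases thin with
    | true =>
      refine (length_elim_le (edgeRow p k) _ fun e _ => length_edgeRow e).trans ?_
      simpa using Nat.pow_le_pow_right hk hm
    | false =>
      exact (length_innerEdges_le I).trans (Nat.pow_le_pow_right hk (by simpa using hthin))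

theorem innerEdges_spec {I : InstData} (hI : I.Valid k) {e : ℕ × ℕ} (he : e ∈ innerEdges k I) :
    e.1 < k ∧ e.2 < k ∧ e.1 ≠ e.2 := by
  obtain ⟨⟨h1, h2⟩, h3⟩ := mem_innerEdges.1 he
  refine ⟨h1, h2, fun h => ?_⟩
  rw [h, adjTest_iff, or_self] at h3
  exact hI.edge_ne _ h3 rfl

theorem outerNeighbors_lt {I : InstData} {N : List ℕ} (hN : N ∈ outerNeighbors k I) :
    ∀ i ∈ N, i < k := by
  obtain ⟨v, -, -, rfl⟩ := mem_outerNeighbors.1 hN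
  exact fun i hi => List.mem_range.1 (List.mem_filter.1 hi).1

theorem valid_kernelInst {I : InstData} (hI : I.Valid k) (thin : Bool) :
    (kernelInst p m thin k I).Valid k :=
  valid_starGraph (fun _ he => innerEdges_spec hI (mem_of_mem_thinEdges he))
    fun _ hS => (keptStars_spec hS).2

theorem kernelInst_fst_le (hm : 1 ≤ m) (I : InstData) (thin : Bool) :
    (kernelInst p m thin k I).1 ≤ 3 * k ^ m := by
  have h1 : k ≤ k ^ m := Nat.le_self_pow (by omega) k
  have h2 := length_keptStars_le (p := p) (m := m) (k := k) (outerNeighbors k I)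
  change k + _ ≤ _
  omega

theorem length_edges_kernelInst_le {thin : Bool} (hm : 1 ≤ m) (hthin : thin = true ∨ 2 ≤ m)
    (I : InstData) : (kernelInst p m thin k I).2.2.length ≤ (2 * m + 3) * k ^ m := by
  have h1 := length_thinEdges_le (p := p) (k := k) hm hthin I
  have h2 := length_keptStars_le (p := p) (m := m) (k := k) (outerNeighbors k I)
  simp only [kernelInst, starGraph, List.length_append, List.length_flatMap, List.length_map]
  have h3 : ∀ l : List (List ℕ), (∀ S ∈ l, S.length ≤ m + 1) →
      ((List.range l.length).map fun j => (l.getD j []).length).sum ≤ l.length * (m + 1) := by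
    intro l hl
    refine (List.sum_le_card_nsmul _ (m + 1) ?_).trans (by simp)
    intro n hn
    obtain ⟨j, hj, rfl⟩ := List.mem_map.1 hn
    rw [List.getD_eq_getElem _ _ (List.mem_range.1 hj)]
    exact hl _ (List.getElem_mem _)
  have h4 := h3 (keptStars p m k (outerNeighbors k I)) fun S hS => (keptStars_spec hS).1
  have h5 := Nat.mul_le_mul_right (m + 1) h2
  have h6 : (2 * m + 3) * k ^ m = k ^ m + 2 * k ^ m * (m + 1) := by ring
  omega

theorem length_encodeInst_kernelInst_le {I : InstData} (hI : I.Valid k) {thin : Bool} (hm : 1 ≤ m)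
    (hthin : thin = true ∨ 2 ≤ m) :
    (encodeInst (kernelInst p m thin k I)).length + k ≤
      3 + k ^ m * ((4 + 6 + (2 * m + 3) * 11) + (2 * m + (2 * m + 3) * (4 * m)) * k.size) := by
  have h1 := kernelInst_fst_le (p := p) (k := k) hm I thin
  have h2 := length_edges_kernelInst_le (p := p) (k := k) hm hthin I
  have h3 : k ≤ k ^ m := Nat.le_self_pow (by omega) k
  -- This gives the length of the vertex names: `3 ≤ 2 ^ 2` and `k < 2 ^ k.size`.
  have h4 : 3 * k ^ m ≤ 2 ^ (2 + m * k.size) := by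
    rw [pow_add, mul_comm m, pow_mul]
    exact Nat.mul_le_mul (by norm_num) (Nat.pow_le_pow_left k.lt_size_self.le m)
  have h5 := length_encodeInst_le (valid_kernelInst (p := p) (m := m) hI thin) (h1.trans h4)
  have h6 := Nat.mul_le_mul_right (4 * (2 + m * k.size) + 3) h2
  have h7 := Nat.mul_le_mul_right (2 * (2 + m * k.size) + 2) h3
  have h8 : k ^ m * ((4 + 6 + (2 * m + 3) * 11) + (2 * m + (2 * m + 3) * (4 * m)) * k.size) =
      3 * k ^ m + k ^ m + k ^ m * (2 * (2 + m * k.size) + 2) +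
        (2 * m + 3) * k ^ m * (4 * (2 + m * k.size) + 3) := by ring
  omega

end Kernel

/-! ### Computability and growth of the bounds -/

/-- This recursion presents the binary length as a primitive recursive function, from which the size
bound is computable. -/
theorem Nat.size_succ_eq (n : ℕ) :
    (n + 1).size = if n + 1 < 2 ^ n.size then n.size else n.size + 1 := by
  split_ifs with h
  · exact le_antisymm (Nat.size_le.2 h) (Nat.size_le_size (Nat.le_succ n))
  · refine le_antisymm (Nat.size_le.2 ?_) (Nat.lt_size.2 (not_lt.1 h))
    have := n.lt_size_self
    rw [pow_succ]; omega

theorem primrec_pow : Primrec₂ fun a b : ℕ => a ^ b := by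
  have : Primrec₂ fun a b : ℕ => Nat.rec (motive := fun _ => ℕ) 1 (fun _ ih => ih * a) b :=
    Primrec.nat_rec (f := fun _ => 1) (g := fun a q => q.2 * a) (Primrec.const 1)
      (Primrec.nat_mul.comp (Primrec.snd.comp Primrec.snd) Primrec.fst)
  refine this.of_eq fun a b => ?_
  induction b with
  | zero => rfl
  | succ b ih => rw [pow_succ, ← ih]

theorem primrec_size : Primrec Nat.size := by
  have h : Primrec₂ fun n ih : ℕ => if n + 1 < 2 ^ ih then ih else ih + 1 :=
    Primrec.ite (Primrec.nat_lt.comp (Primrec.succ.comp Primrec.fst)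
      (primrec_pow.comp (Primrec.const 2) Primrec.snd)) Primrec.snd (Primrec.succ.comp Primrec.snd)
  refine (Primrec.nat_rec₁ 0 h).of_eq fun n => ?_
  induction n with
  | zero => rfl
  | succ n ih => rw [Nat.size_succ_eq, ← ih]

theorem computable_sizeBound (m a b c : ℕ) :
    Computable fun k : ℕ => c + k ^ m * (a + b * k.size) :=
  (Primrec.nat_add.comp (Primrec.const c) (Primrec.nat_mul.comp
    (primrec_pow.comp Primrec.id (Primrec.const m)) (Primrec.nat_add.comp (Primrec.const a)
      (Primrec.nat_mul.comp (Primrec.const b) primrec_size)))).to_comp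

/-- From `k = 2` on, the logarithm is at least `1` and absorbs the rounding in the binary length. -/
theorem size_le_logb {k : ℕ} (hk : 2 ≤ k) : (k.size : ℝ) ≤ 2 * Real.logb 2 k ∧
    1 ≤ Real.logb 2 k := by
  have hk0 : (0 : ℝ) < k := by positivity
  have h1 : (1 : ℝ) ≤ Real.logb 2 k := by
    rw [Real.le_logb_iff_rpow_le one_lt_two hk0, Real.rpow_one]
    exact_mod_cast hk
  obtain ⟨s, hs⟩ : ∃ s, k.size = s + 1 :=
    Nat.exists_eq_succ_of_ne_zero (Nat.size_pos.2 (by omega)).ne'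
  have h2 : (s : ℝ) ≤ Real.logb 2 k := by
    rw [Real.le_logb_iff_rpow_le one_lt_two hk0, Real.rpow_natCast]
    exact_mod_cast Nat.lt_size.1 (by omega : s < k.size)
  rw [hs]
  push_cast
  exact ⟨by linarith, h1⟩

theorem isBigO_sizeBound (m a b c : ℕ) :
    (fun k : ℕ => ((c + k ^ m * (a + b * k.size) : ℕ) : ℝ)) =O[atTop]
      fun k : ℕ => (k : ℝ) ^ m * Real.logb 2 k := by
  refine IsBigO.of_bound (c + a + 2 * b : ℝ) ?_
  filter_upwards [eventually_ge_atTop 2] with k hk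
  obtain ⟨h1, h2⟩ := size_le_logb hk
  have hk1 : (1 : ℝ) ≤ (k : ℝ) ^ m := one_le_pow₀ (by exact_mod_cast (by omega : 1 ≤ k))
  rw [Real.norm_of_nonneg (by positivity), Real.norm_of_nonneg (by positivity)]
  push_cast
  have h3 : (1 : ℝ) ≤ (k : ℝ) ^ m * Real.logb 2 k := one_le_mul_of_one_le_of_one_le hk1 h2
  have h4 : (c : ℝ) ≤ c * ((k : ℝ) ^ m * Real.logb 2 k) := le_mul_of_one_le_right (by positivity) h3
  have h5 : (k : ℝ) ^ m * (a + b * k.size) ≤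
      (k : ℝ) ^ m * (a * Real.logb 2 k + b * (2 * Real.logb 2 k)) := by
    gcongr
    exact le_mul_of_one_le_right (by positivity) h2
  nlinarith

theorem isBigO_vertexBound (m a c : ℕ) :
    (fun k : ℕ => ((a * k ^ m + c : ℕ) : ℝ)) =O[atTop] fun k : ℕ => (k : ℝ) ^ m := by
  refine IsBigO.of_bound (a + c : ℝ) ?_
  filter_upwards [eventually_ge_atTop 1] with k hk
  have hk1 : (1 : ℝ) ≤ (k : ℝ) ^ m := one_le_pow₀ (by exact_mod_cast hk)
  rw [Real.norm_of_nonneg (by positivity), Real.norm_of_nonneg (by positivity)]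
  push_cast
  nlinarith [le_mul_of_one_le_right (Nat.cast_nonneg (α := ℝ) c) hk1]

/-! ### Kernels -/

/-- The problem has a kernel with `O(k ^ m)` vertices and `O(k ^ m log k)` bits. -/
def HasKernel (Q : ParamProblem) (m : ℕ) : Prop :=
  ∃ (f : List Bool × ℕ → List Bool × ℕ) (h g : ℕ → ℕ), IsKernel Q f h ∧
    (∀ (x : List Bool) (k : ℕ), ∃ I : GraphWithCover, IsInstance (f (x, k)) I ∧ I.n ≤ g k) ∧
    (fun k : ℕ => (h k : ℝ)) =O[atTop] (fun k : ℕ => (k : ℝ) ^ m * Real.logb 2 k) ∧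
    (fun k : ℕ => (g k : ℝ)) =O[atTop] (fun k : ℕ => (k : ℝ) ^ m)

/-- The same `a` and `c` serve for bits and for vertices; `c` leaves room for fixed outputs that do
not depend on `k`. -/
theorem HasKernel.of_bounds {Q : ParamProblem} (m : ℕ) {f : List Bool × ℕ → List Bool × ℕ}
    (hf : IsPolyTime f) (hmem : ∀ p, p ∈ Q ↔ f p ∈ Q) (a b c : ℕ)
    (hsize : ∀ x k, (f (x, k)).1.length + (f (x, k)).2 ≤ c + k ^ m * (a + b * k.size))
    (hinst : ∀ x k, ∃ I : GraphWithCover, IsInstance (f (x, k)) I ∧ I.n ≤ a * k ^ m + c) :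
    HasKernel Q m :=
  ⟨f, _, _, ⟨hf, hmem, computable_sizeBound m a b c, hsize⟩, hinst, isBigO_sizeBound m a b c,
    isBigO_vertexBound m a c⟩

/-- The complete graph on `n` vertices. -/
def completeInst (n : ℕ) : InstData :=
  (n, List.range n, ((List.range n).flatMap fun i => (List.range n).map fun j => (i, j)).filter
    fun e => !decide (e.1 = e.2))

theorem mem_edges_completeInst {n : ℕ} {e : ℕ × ℕ} :
    e ∈ (completeInst n).2.2 ↔ (e.1 < n ∧ e.2 < n) ∧ e.1 ≠ e.2 := by
  obtain ⟨i, j⟩ := e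
  simp [completeInst]

theorem valid_completeInst (n : ℕ) : (completeInst n).Valid n :=
  ⟨by simp [completeInst], fun v hv => by simpa [completeInst] using hv, List.nodup_range,
    fun _ he => (mem_edges_completeInst.1 he).1, fun _ he => (mem_edges_completeInst.1 he).2,
    fun _ he => Or.inl (List.mem_range.2 (mem_edges_completeInst.1 he).1.1)⟩

section

variable {V : Type*} (H : SimpleGraph V)

theorem encodeInst_mem_hColoringVC_iff {I : InstData} {k : ℕ} (hI : I.Valid k) :
    (encodeInst I, k) ∈ HColoringVC H ↔
      ∃ col : Fin I.1 → V, ∀ u v, (u.1, v.1) ∈ I.2.2 → H.Adj (col u) (col v) := by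
  have hdec : decodeInst (encodeInst I) = I := decodeInst_encodeInst hI.cover_lt hI.edge_lt
  rw [mem_hColoringVC_iff]
  dsimp only
  generalize hJ : decodeInst (encodeInst I) = J
  obtain rfl : J = I := hJ.symm.trans hdec
  simp [hI]

/-- A homomorphism from a complete graph is injective, and there is one vertex too many. This is the
output for malformed input. -/
theorem completeInst_notMem [Finite V] :
    (encodeInst (completeInst (Nat.card V + 1)), Nat.card V + 1) ∉ HColoringVC H := by
  rw [encodeInst_mem_hColoringVC_iff H (valid_completeInst _)]
  rintro ⟨col, hcol⟩
  have hinj : Function.Injective col := fun u v huv => by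
    by_contra hne
    have := hcol u v (mem_edges_completeInst.2 ⟨⟨u.2, v.2⟩, fun h => hne (Fin.ext h)⟩)
    rw [huv] at this
    exact H.irrefl this
  have := Nat.card_le_card_of_injective col hinj
  rw [Nat.card_eq_fintype_card, Fintype.card_fin] at this
  exact absurd this (by simp [completeInst])

theorem kernelMap_cond (x : List Bool × ℕ) :
    (decide (encodeInst (decodeInst x.1) = x.1) && isValid x.2 (decodeInst x.1)) = true ↔
      encodeInst (decodeInst x.1) = x.1 ∧ (decodeInst x.1).Valid x.2 := by
  rw [Bool.and_eq_true, decide_eq_true_eq, isValid_iff]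

/-- The kernel from a faithful independent representation. -/
theorem hasKernel_of_rep [Finite V] [Nonempty V] {p : ℕ} [Fact p.Prime] {K : Type*} [Field K]
    (φ : ZMod p →+* K) {m : ℕ} (hm : 1 ≤ m) {x : V → Fin (m + 1) → K}
    (hx : IsFaithfulIndependentRep H x) (ℓ : Fin (m + 1) → K) (hℓ : ∀ v, x v ⬝ᵥ ℓ = 1)
    (thin : Bool) (hthin : thin = true ∨ 2 ≤ m) (μ : V → K)
    (hμ : thin = true → ∀ u v, H.Adj u v ↔ μ u + μ v = 0) : HasKernel (HColoringVC H) m := by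
  let N := Nat.card V + 1
  let no := (encodeInst (completeInst N), N)
  refine HasKernel.of_bounds m (PT.isPolyTime (PT.kernelMap (p := p) m thin no)) (fun y => ?_)
    (4 + 6 + (2 * m + 3) * 11) (2 * m + (2 * m + 3) * (4 * m))
    (3 + (encodeInst (completeInst N)).length + N) (fun y k => ?_) fun y k => ?_
  · unfold kernelMap
    split_ifs with h
    · rw [kernelMap_cond] at h
      rw [mem_hColoringVC_iff_colorable, encodeInst_mem_iff H (valid_kernelInst h.2 thin),
        colorable_iff_starColorable H h.2, kernelInst, starGraph_colorable_iff H
          (fun _ he => innerEdges_spec h.2 (mem_of_mem_thinEdges he))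
          (fun _ hS => (keptStars_spec hS).2),
        starColorable_thinEdges_iff φ thin μ hμ fun e he =>
          ⟨(innerEdges_spec h.2 he).1, (innerEdges_spec h.2 he).2.1⟩,
        starColorable_keptStars_iff φ hx ℓ hℓ fun _ hN => outerNeighbors_lt hN]
      exact ⟨fun h' => h'.2.2, fun h' => ⟨h.1, h.2, h'⟩⟩
    · rw [kernelMap_cond] at h
      refine iff_of_false (fun h' => h ?_) (completeInst_notMem H)
      rw [mem_hColoringVC_iff] at h'
      exact ⟨h'.1, h'.2.1⟩
  · unfold kernelMap
    split_ifs with h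
    · rw [kernelMap_cond] at h
      refine (length_encodeInst_kernelInst_le h.2 hm hthin).trans ?_
      dsimp only
      omega
    · dsimp only [no]
      omega
  · unfold kernelMap
    split_ifs with h
    · rw [kernelMap_cond] at h
      refine ⟨_, isInstance_toGraph (valid_kernelInst h.2 thin), ?_⟩
      have := kernelInst_fst_le (p := p) (k := k) hm (decodeInst y) thin
      have h1 : 3 * k ^ m ≤ (4 + 6 + (2 * m + 3) * 11) * k ^ m := Nat.mul_le_mul_right _ (by omega)
      change (kernelInst p m thin k (decodeInst y)).1 ≤ _
      omega
    · refine ⟨_, isInstance_toGraph (valid_completeInst N), ?_⟩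
      change N ≤ _
      omega

/-- A solvable instance has no edges, and an instance without edges is solvable if it has no
vertices or there is a colour at all. -/
theorem hasKernel_of_edgeless [Finite V] (hH : ∀ u v, ¬ H.Adj u v) (m : ℕ) :
    HasKernel (HColoringVC H) m := by
  classical
  let N := Nat.card V + 1
  let no := (encodeInst (completeInst N), N)
  -- Without any colour, an instance that has vertices is unsolvable, so the output must be the
  -- fixed unsolvable instance.
  let one : InstData × ℕ := if Nonempty V then ((1, [], []), 0) else (completeInst N, N)
  have hvalid : ∀ n, InstData.Valid 0 (n, [], []) := fun n => by
    constructor <;> simp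
  have hone : one.1.Valid one.2 := by
    dsimp only [one]
    split_ifs
    exacts [hvalid 1, valid_completeInst N]
  have hone_mem : (encodeInst one.1, one.2) ∈ HColoringVC H ↔ Nonempty V := by
    by_cases h : Nonempty V
    · refine iff_of_true ?_ h
      rw [show one = ((1, [], []), 0) from if_pos h, encodeInst_mem_hColoringVC_iff H (hvalid 1)]
      exact ⟨fun _ => h.some, by simp⟩
    · refine iff_of_false ?_ h
      rw [show one = (completeInst N, N) from if_neg h]
      exact completeInst_notMem H
  have hempty : (encodeInst (0, [], []), 0) ∈ HColoringVC H := by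
    rw [encodeInst_mem_hColoringVC_iff H (hvalid 0)]
    exact ⟨fun i => i.elim0, fun i => i.elim0⟩
  let f := edgelessMap (encodeInst (0, [], []), 0) (encodeInst one.1, one.2) no
  have hcases : ∀ y, ∃ I : InstData, ∃ k, I.Valid k ∧ f y = (encodeInst I, k) ∧
      (I, k) ∈ [(((0, [], []) : InstData), 0), one, (completeInst N, N)] := fun y => by
    dsimp only [f, edgelessMap]
    split_ifs
    · exact ⟨(0, [], []), 0, hvalid 0, rfl, by simp⟩
    · exact ⟨one.1, one.2, hone, rfl, by simp⟩
    · exact ⟨completeInst N, N, valid_completeInst N, rfl, by simp⟩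
  refine HasKernel.of_bounds m (f := f) (PT.isPolyTime (PT.edgelessMap _ _ _)) (fun y => ?_) 0 0
    ((encodeInst (0, [], [])).length + (encodeInst one.1).length + one.2 + one.1.1 +
      (encodeInst (completeInst N)).length + N) (fun y k => ?_) fun y k => ?_
  · dsimp only [f, edgelessMap]
    rw [mem_hColoringVC_iff]
    split_ifs with h h0
    · refine iff_of_true ?_ hempty
      rw [Bool.and_eq_true, kernelMap_cond, List.isEmpty_iff] at h
      refine ⟨h.1.1, h.1.2, ?_⟩
      generalize decodeInst y.1 = J at h h0
      exact ⟨fun i => absurd i.2 (by omega), by simp [h.2]⟩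
    · rw [hone_mem]
      rw [Bool.and_eq_true, kernelMap_cond, List.isEmpty_iff] at h
      refine ⟨fun ⟨_, _, col, _⟩ => ⟨col ⟨0, Nat.pos_of_ne_zero h0⟩⟩, fun hV => ⟨h.1.1, h.1.2, ?_⟩⟩
      exact ⟨fun _ => hV.some, by simp [h.2]⟩
    · refine iff_of_false ?_ (completeInst_notMem H)
      rintro ⟨h1, h2, col, h3⟩
      rw [Bool.and_eq_true, kernelMap_cond, List.isEmpty_iff] at h
      refine h ⟨⟨h1, h2⟩, List.eq_nil_iff_forall_not_mem.2 fun e he => ?_⟩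
      exact hH _ _ (h3 ⟨e.1, (h2.edge_lt e he).1⟩ ⟨e.2, (h2.edge_lt e he).2⟩ he)
  · obtain ⟨I, j, -, h, hmem⟩ := hcases (y, k)
    rw [h]
    simp only [List.mem_cons, Prod.mk.injEq, List.not_mem_nil, or_false] at hmem
    rcases hmem with ⟨rfl, rfl⟩ | hmem | ⟨rfl, rfl⟩
    · dsimp only; omega
    · rw [← hmem]; dsimp only; omega
    · dsimp only; omega
  · obtain ⟨I, j, hI, h, hmem⟩ := hcases (y, k)
    rw [h]
    refine ⟨_, isInstance_toGraph hI, ?_⟩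
    change I.1 ≤ _
    simp only [List.mem_cons, Prod.mk.injEq, List.not_mem_nil, or_false] at hmem
    rcases hmem with ⟨rfl, rfl⟩ | hmem | ⟨rfl, rfl⟩
    · exact Nat.zero_le _
    · rw [← hmem]; dsimp only; omega
    · dsimp only [completeInst]; omega

end

/-! ### Bipartite graphs -/

theorem hColoringVC_congr {V W : Type*} {H : SimpleGraph V} {H' : SimpleGraph W} (φ : H →g H')
    (ψ : H' →g H) : HColoringVC H = HColoringVC H' :=
  Set.ext fun _ => exists_congr fun _ => and_congr_right fun _ =>
    ⟨fun ⟨f⟩ => ⟨φ.comp f⟩, fun ⟨f⟩ => ⟨ψ.comp f⟩⟩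

/-- The representation of the complete graph on two vertices over the field with three elements. -/
def edgeCertificate : RepCertificate (⊤ : SimpleGraph (Fin 2)) 2 (ZMod 3) where
  vec v := ![1, if v = 0 then 1 else -1]
  -- The vectors `(1, 1)` and `(1, -1)` are orthogonal, and each has product `2` with itself, which
  -- is its own inverse modulo `3`.
  ann _ v := ![1, if v = 0 then 1 else -1]
  inv _ _ := 2
  fnl := ![1, 0]
  ann_adj := by decide
  ann_self := by decide
  fnl_vec := by decide

theorem hasKernel_edge : HasKernel (HColoringVC (⊤ : SimpleGraph (Fin 2))) 1 := by
  have h : ∀ u v : Fin 2, (⊤ : SimpleGraph (Fin 2)).Adj u v ↔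
      (if u = 0 then 1 else -1 : ZMod 3) + (if v = 0 then 1 else -1) = 0 := by decide
  have : Fact (Nat.Prime 3) := ⟨Nat.prime_three⟩
  exact hasKernel_of_rep _ (RingHom.id (ZMod 3)) le_rfl edgeCertificate.isFaithfulIndependentRep
    _ edgeCertificate.fnl_vec true (Or.inl rfl) (fun v => if v = 0 then 1 else -1)
    fun _ => h

section Plane

variable {V F : Type*} [Field F] {H : SimpleGraph V} {d : ℕ} {x : V → Fin d → F}

/-- The span of the neighbours of `v` is proper, so of dimension at most `1`, and it contains the
nonzero vector of `u`. -/
theorem IsIndependentRep.span_eq (hx : IsIndependentRep H x) (hd : d ≤ 2) {u v : V}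
    (h : H.Adj u v) :
    Submodule.span F (x '' H.neighborSet v) = Submodule.span F {x u} := by
  have hne : x u ≠ 0 := fun h0 => hx u (h0 ▸ Submodule.zero_mem _)
  refine (Submodule.eq_of_le_of_finrank_le (Submodule.span_mono ?_) ?_).symm
  · rintro _ rfl
    exact ⟨u, h.symm, rfl⟩
  · rw [finrank_span_singleton hne]
    have := Submodule.finrank_lt (s := Submodule.span F (x '' H.neighborSet v))
      fun htop => hx v (htop ▸ Submodule.mem_top)
    rw [Module.finrank_fin_fun] at this
    omega

theorem IsIndependentRep.two_le (hx : IsIndependentRep H x) {u v : V} (h : H.Adj u v) :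
    2 ≤ d := by
  have hne : x u ≠ 0 := fun h0 => hx u (h0 ▸ Submodule.zero_mem _)
  have h1 := Submodule.finrank_lt (s := Submodule.span F (x '' H.neighborSet v))
    fun htop => hx v (htop ▸ Submodule.mem_top)
  have h2 := Submodule.finrank_mono (Submodule.span_mono (R := F) (s := {x u})
    (t := x '' H.neighborSet v) (by rintro _ rfl; exact ⟨u, h.symm, rfl⟩))
  rw [finrank_span_singleton hne] at h2
  rw [Module.finrank_fin_fun] at h1
  omega

/-- To each vertex belong its own line `L v` and the span `W v` of its neighbours. An edge exchanges
the two, and they differ by independence. Comparing them in an arbitrary well-order of the subspaces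
is therefore a proper 2-colouring. -/
theorem IsIndependentRep.nonempty_hom (hx : IsIndependentRep H x) (hd : d ≤ 2) :
    Nonempty (H →g (⊤ : SimpleGraph (Fin 2))) := by
  classical
  let W : V → Submodule F (Fin d → F) := fun v => Submodule.span F (x '' H.neighborSet v)
  let L : V → Submodule F (Fin d → F) := fun v => Submodule.span F {x v}
  refine ⟨⟨fun v => if WellOrderingRel (L v) (W v) then 0 else 1, fun {u v} h => ?_⟩⟩
  have h1 : W v = L u := hx.span_eq hd h
  have h2 : W u = L v := hx.span_eq hd h.symm
  have h3 : L u ≠ L v := fun h3 => hx v (by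
    rw [hx.span_eq hd h]
    change x v ∈ L u
    rw [h3]
    exact Submodule.mem_span_singleton_self _)
  rw [SimpleGraph.top_adj, h1, h2]
  rcases trichotomous_of WellOrderingRel (L u) (L v) with h4 | h4 | h4
  · have h5 := asymm_of WellOrderingRel h4
    simp [h4, h5]
  · exact absurd h4 h3
  · have h5 := asymm_of WellOrderingRel h4
    simp [h4, h5]

theorem SimpleGraph.Adj.nonempty_hom {u v : V} (h : H.Adj u v) :
    Nonempty ((⊤ : SimpleGraph (Fin 2)) →g H) := by
  refine ⟨⟨![u, v], fun {a b} hab => ?_⟩⟩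
  fin_cases a <;> fin_cases b
  · exact absurd rfl hab
  · exact h
  · exact h.symm
  · exact absurd rfl hab

end Plane

theorem mainTheorem2 {V : Type*} [Finite V] (H : SimpleGraph V) (d : ℕ) (hd : 0 < d)
    {F : Type*} [Field F]
    (hH : ∃ x : V → Fin d → F, IsFaithfulIndependentRep H x) :
    ∃ (f : List Bool × ℕ → List Bool × ℕ) (h g : ℕ → ℕ),
      IsKernel (HColoringVC H) f h ∧
      (∀ (x : List Bool) (k : ℕ), ∃ I : GraphWithCover, IsInstance (f (x, k)) I ∧ I.n ≤ g k) ∧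
      (fun k : ℕ => (h k : ℝ)) =O[atTop] (fun k : ℕ => (k : ℝ) ^ (d - 1) * Real.logb 2 k) ∧
      (fun k : ℕ => (g k : ℝ)) =O[atTop] (fun k : ℕ => (k : ℝ) ^ (d - 1)) := by
  change HasKernel (HColoringVC H) (d - 1)
  obtain ⟨x, hx⟩ := hH
  by_cases hedge : ∃ u v, H.Adj u v
  · obtain ⟨u, v, huv⟩ := hedge
    have h2 := hx.1.two_le huv
    obtain ⟨m, rfl⟩ : ∃ m, d = m + 1 := ⟨d - 1, by omega⟩
    rw [Nat.add_sub_cancel]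
    rcases h2.eq_or_lt with h2 | h2
    -- Here `k ^ 2` edges inside the cover would be too many. Homomorphisms in both directions allow
    -- `H` to be replaced by a single edge, for which the edges can be thinned.
    · obtain rfl : m = 1 := by omega
      obtain ⟨φ⟩ := hx.1.nonempty_hom le_rfl
      obtain ⟨ψ⟩ := huv.nonempty_hom
      rw [hColoringVC_congr φ ψ]
      exact hasKernel_edge
    · obtain ⟨p, K, _, φ, y, ℓ, hp, hy, hℓ⟩ := hx.exists_prime
      have : Fact p.Prime := ⟨hp⟩
      have : Nonempty V := ⟨u⟩
      exact hasKernel_of_rep H φ (by omega) hy ℓ hℓ false (Or.inr (by omega)) 0 (by simp)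
  · push Not at hedge
    exact hasKernel_of_edgeless H hedge _
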